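/- **Setting.** Let $[k]=\{1,\dots,k\}$ and let $\triangle_{k,s}$ be the set of probability distributions on $[k]$ with support of size at most $s$. Each of $n$ users holds one of $n$ independent samples from an unknown $p\in\triangle_{k,s}$ and sends a message through a channel (a randomized map) $W_i:[k]\to\{0,1\}^*$; the channels act independently. $W_i$ is $\varepsilon$-LDP if $W_i(y\mid x)\le e^{\varepsilon}W_i(y\mid x')$ for all $x,x',y$. A server turns the $n$ messages into an estimate $\hat p$, a distribution on $[k]$. Let $\mathrm{SC}(k,s,\varepsilon,\alpha)$ be the least $n$ for which some $\varepsilon$-LDP channels $W_1,\dots,W_n$ (private-coin protocol) and some estimator satisfy $\Pr[d_{TV}(\hat p,p)\le\alpha]\ge 0.9$ for every $p\in\triangle_{k,s}$ ($\infty$ if there is none), and let $\mathrm{SC}_{\mathrm{pub}}$ be the same quantity when channels and estimator may depend on common public randomness. Put $$R=R(k,s,\varepsilon,\alpha)=\frac{s^2\max\{\log(k/s),1\}}{\alpha^2\varepsilon^2}.$$ **Theorem.** 1. (Upper bound.) For every $E>0$ there is $C>0$ such that $\mathrm{SC}(k,s,\varepsilon,\alpha)\le C\,R$ for all $1\le s\le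 k$, $0<\varepsilon\le E$ and $\alpha\in(0,1)$. 2. (Lower bound.) For every $E>0$ and $\alpha_0\in(0,1)$ there is $c>0$ such that $\mathrm{SC}(k,s,\varepsilon,\alpha)\ge c\,R$, and also $\mathrm{SC}_{\mathrm{pub}}(k,s,\varepsilon,\alpha)\ge c\,R$, for all $2\le s\le k/100$, $0<\varepsilon\le E$ and $0<\alpha\le\alpha_0$ with $\alpha\le 1-2s/k$. (The last condition holds automatically when $\alpha\le 0.98$.) 3. (Efficient one-bit private-coin protocol.) Let $K$ be the smallest power of two larger than $k$ and $H$ the $K\times K$ Sylvester–Hadamard matrix, with rows and columns numbered from $0$ and the elements of $[k]$ identified with the first $k$ rows. There are a fixed user program and a fixed server program such that for every $E>0$ there is $C>0$ with the following property. For all $1\le s\le k$, $0<\varepsilon\le E$, $\alpha\in(0,1)$ and all $n\ge C\,R$ there is a fixed assignment of a column $j_i$ of $H$ to each user $i\in\{0,\dots,n-1\}$, which is the cyclic assignment $j_i=i \bmod K$ whenever $n\ge K$, for which the following protocol is $\varepsilon$-LDP and satisfies $\Pr[d_{TV}(\hat p,p)\le\alpha]\ge0.9$ for every $p\in\triangle_{k,s}$.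 User $i$ sends one bit $Y_i$, equal to $1$ with probability $e^\varepsilon/(e^\varepsilon+1)$ if $H(X_i,j_i)=1$, and with probability $1/(e^\varepsilon+1)$ otherwise. With $J$ the set of assigned columns and $\hat t_j$ the fraction of ones among the users with column $j$, the server forms $$\tilde p(x)=\frac{e^\varepsilon+1}{|J|(e^\varepsilon-1)}\sum_{j\in J}H(x,j)\,(2\hat t_j-1),\qquad x\in[k],$$ and outputs a Euclidean projection $\hat p$ of $\tilde p$ onto $\triangle_{k,s}$. The fixed user program samples $Y_i$ from $k,s,n,j_i,X_i,e^\varepsilon$ and a private random number uniform on $[0,1]$, and the fixed server program computes $\hat p$ from $k,s,n,e^\varepsilon$, the columns $j_i$ and the messages. The running time of all $n$ users and the server together is at most $C'(n+k)\log^{A}(n+k+1)$ with absolute constants $C',A$. Programs are for a random access machine on which every elementary instruction costs one step: integers are words bounded by $(n+k+1)^{D}$ for an absolute constant $D$, and real numbers have exact arithmetic and comparison but no rounding to integers. -/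

import Mathlib

open MeasureTheory
open scoped ENNReal NNReal

noncomputable section

namespace SparseLDP

/-! ### Distributions, channels, privacy -/

/-- Distributions on `[k]` with support of size at most `s`. -/
def IsSparse {k : ℕ} (s : ℕ) (p : PMF (Fin k)) : Prop := p.support.ncard ≤ s

/-- Total variation distance, `½ ‖p - q‖₁`. -/
def tv {k : ℕ} (p q : PMF (Fin k)) : ℝ := (∑ x, |(p x).toReal - (q x).toReal|) / 2

/-- A channel with inputs in `[k]` and outputs in a message alphabet `M`:
`W x y` is the probability `W(y | x)`. -/
abbrev Channel (k : ℕ) (M : Type) : Type := Fin k → PMF M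

/-- `ε`-local differential privacy: `W(y | x) ≤ e^ε W(y | x')` for all `x, x', y`. -/
def IsLDP {k : ℕ} {M : Type} (ε : ℝ) (W : Channel k M) : Prop :=
  ∀ (x x' : Fin k) (y : M), W x y ≤ ENNReal.ofReal (Real.exp ε) * W x' y

/-- Every set of finite binary strings is measurable. -/
instance instMeasurableSpaceListBool : MeasurableSpace (List Bool) := ⊤

/-- Probability that the estimate is within total variation `α` of `p`, when the `n` users hold
independent samples from `p` and send their messages through the independent channels `W i`. -/
def successProb {k n : ℕ} {M : Type} [MeasurableSpace M] (W : Fin n → Channel k M)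
    (est : (Fin n → M) → PMF (Fin k)) (α : ℝ) (p : PMF (Fin k)) : ℝ≥0∞ :=
  Measure.pi (fun i => (p.bind (W i)).toMeasure) {y | tv p (est y) ≤ α}

/-! ### Minimax sample complexity -/

/-- With `n` users some private-coin protocol of `ε`-LDP channels (with messages in `{0,1}*`)
estimates every `s`-sparse distribution to accuracy `α` with probability at least `0.9`. -/
def PrivateCoinAchievable (k s : ℕ) (ε α : ℝ) (n : ℕ) : Prop :=
  ∃ (W : Fin n → Channel k (List Bool)) (est : (Fin n → List Bool) → PMF (Fin k)),
    (∀ i, IsLDP ε (W i)) ∧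
    ∀ p : PMF (Fin k), IsSparse s p → (9 / 10 : ℝ≥0∞) ≤ successProb W est α p

/-- The same with public coins: channels and estimator may depend on a common random `ω`.
No measurability in `ω` is asked; the (lower) integral makes sense without it. -/
def PublicCoinAchievable (k s : ℕ) (ε α : ℝ) (n : ℕ) : Prop :=
  ∃ (Ω : Type) (_ : MeasurableSpace Ω) (ρ : Measure Ω) (_ : IsProbabilityMeasure ρ)
    (W : Ω → Fin n → Channel k (List Bool)) (est : Ω → (Fin n → List Bool) → PMF (Fin k)),
    (∀ ω i, IsLDP ε (W ω i)) ∧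
    ∀ p : PMF (Fin k), IsSparse s p →
      (9 / 10 : ℝ≥0∞) ≤ ∫⁻ ω, successProb (W ω) (est ω) α p ∂ρ

/-- Minimax sample complexity (`⊤` if no number of users suffices). -/
def sampleComplexity (k s : ℕ) (ε α : ℝ) : ℕ∞ :=
  ⨅ n ∈ {n : ℕ | PrivateCoinAchievable k s ε α n}, (n : ℕ∞)

/-- Minimax sample complexity over public-coin protocols. -/
def sampleComplexityPublic (k s : ℕ) (ε α : ℝ) : ℕ∞ :=
  ⨅ n ∈ {n : ℕ | PublicCoinAchievable k s ε α n}, (n : ℕ∞)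

/-- The rate `s² max{log(k/s), 1} / (α² ε²)`. -/
def rate (k s : ℕ) (ε α : ℝ) : ℝ :=
  (s : ℝ) ^ 2 * max (Real.log ((k : ℝ) / s)) 1 / (α ^ 2 * ε ^ 2)

/-! ### One-bit Hadamard Response and sparse projection -/

/-- `log₂` of the Hadamard dimension. -/
def hadamardLog (k : ℕ) : ℕ := Nat.clog 2 (k + 1)

/-- The smallest power of two that is larger than `k`. -/
def hadamardDim (k : ℕ) : ℕ := 2 ^ hadamardLog k

/-- Entry `(x, j)` of the Sylvester-Hadamard matrix of dimension `2 ^ m`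
(rows and columns are numbered from `0`). -/
def hadamard (m x j : ℕ) : ℝ :=
  ∏ b ∈ Finset.range m, if x.testBit b && j.testBit b then -1 else 1

/-- `e^ε/(e^ε+1)` at `true` and `1/(e^ε+1)` at `false`. -/
def responseProb (ε : ℝ) (b : Bool) : ℝ :=
  if b then Real.exp ε / (Real.exp ε + 1) else 1 / (Real.exp ε + 1)

theorem responseProb_sum (ε : ℝ) (f : Bool) :
    ∑ b, ENNReal.ofReal (responseProb ε (b == f)) = 1 := by
  have h : Real.exp ε / (Real.exp ε + 1) + 1 / (Real.exp ε + 1) = 1 := by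
    rw [← add_div]
    exact div_self (by positivity)
  have h₁ : 0 ≤ Real.exp ε / (Real.exp ε + 1) := by positivity
  have h₂ : 0 ≤ 1 / (Real.exp ε + 1) := by positivity
  cases f
  · simp only [Fintype.sum_bool, responseProb]
    rw [← ENNReal.ofReal_add (by simpa using h₂) (by simpa using h₁)]
    simpa [add_comm] using congrArg ENNReal.ofReal h
  · simp only [Fintype.sum_bool, responseProb]
    rw [← ENNReal.ofReal_add (by simpa using h₁) (by simpa using h₂)]
    simpa using congrArg ENNReal.ofReal h

/-- Binary randomized response: the bit `f` is sent with probability `e^ε/(e^ε+1)`, the other bit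
with probability `1/(e^ε+1)`. -/
def randomizedResponse (ε : ℝ) (f : Bool) : PMF Bool :=
  PMF.ofFintype (fun b => ENNReal.ofReal (responseProb ε (b == f))) (responseProb_sum ε f)

open Classical in
/-- The one-bit Hadamard Response channel of a user assigned to column `j`: the bit `1` has
probability `e^ε/(e^ε+1)` if `H(x, j) = 1`, and probability `1/(e^ε+1)` otherwise. -/
def hrChannel (k : ℕ) (ε : ℝ) (j : ℕ) : Channel k Bool := fun x =>
  randomizedResponse ε (decide (hadamard (hadamardLog k) x j = 1))

/-- The fraction of ones among the messages of the users assigned to column `j`. -/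
def hrFraction {n : ℕ} (col : Fin n → ℕ) (y : Fin n → Bool) (j : ℕ) : ℝ :=
  (((Finset.univ.filter fun i => col i = j ∧ y i = true).card : ℝ)) /
    ((Finset.univ.filter fun i => col i = j).card : ℝ)

/-- The Hadamard Response estimate before projection:
`(e^ε+1)/(|J|(e^ε-1)) ∑_{j ∈ J} H(x, j) (2 t̂_j - 1)`, where `J` is the set of the columns in use
(all columns, if users are assigned cyclically and there are enough of them). -/
def hrEstimate {n : ℕ} (k : ℕ) (ε : ℝ) (col : Fin n → ℕ) (y : Fin n → Bool) (x : Fin k) : ℝ :=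
  (Real.exp ε + 1) / (((Finset.univ.image col).card : ℝ) * (Real.exp ε - 1)) *
    ∑ j ∈ Finset.univ.image col, hadamard (hadamardLog k) x j * (2 * hrFraction col y j - 1)

/-- `q` is a Euclidean projection of the vector `v` onto the `s`-sparse distributions on `[k]`. -/
def IsSparseProjection {k : ℕ} (s : ℕ) (v : Fin k → ℝ) (q : PMF (Fin k)) : Prop :=
  IsSparse s q ∧ ∀ r : PMF (Fin k), IsSparse s r →
    ∑ x, (v x - (q x).toReal) ^ 2 ≤ ∑ x, (v x - (r x).toReal) ^ 2

/-! ### A random access machine with integer words and real numbers, with a step count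

The machine has registers and arrays for natural numbers (of bounded size, as on a word RAM), and
registers and arrays for real numbers with exact arithmetic and comparison. There is no rounding
of reals to integers. A program names finitely many registers and arrays; array entries are
addressed through integer registers. -/

/-- Contents of the memory. -/
structure State where
  reg : ℕ → ℕ
  rreg : ℕ → ℝ
  arr : ℕ → ℕ → ℕ
  rarr : ℕ → ℕ → ℝ

inductive ArithOp where
  | add | sub | mul | div

/-- On integers: addition, truncated subtraction, multiplication, division with rounding down. -/
def ArithOp.evalNat : ArithOp → ℕ → ℕ → ℕ
  | .add, a, b => a + b
  | .sub, a, b => a - b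
  | .mul, a, b => a * b
  | .div, a, b => a / b

def ArithOp.evalReal : ArithOp → ℝ → ℝ → ℝ
  | .add, a, b => a + b
  | .sub, a, b => a - b
  | .mul, a, b => a * b
  | .div, a, b => a / b

/-- Elementary instructions; `d` is a destination register, `a`, `b` are source registers,
`A` is the name of an array. -/
inductive Instr where
  | const (d c : ℕ)
  | op (o : ArithOp) (d a b : ℕ)
  | load (A d a : ℕ)
  | store (A a b : ℕ)
  | rofNat (d a : ℕ)
  | rop (o : ArithOp) (d a b : ℕ)
  | rload (A d a : ℕ)
  | rstore (A a b : ℕ)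

def Instr.run (σ : State) : Instr → State
  | .const d c => { σ with reg := Function.update σ.reg d c }
  | .op o d a b => { σ with reg := Function.update σ.reg d (o.evalNat (σ.reg a) (σ.reg b)) }
  | .load A d a => { σ with reg := Function.update σ.reg d (σ.arr A (σ.reg a)) }
  | .store A a b =>
      { σ with arr := Function.update σ.arr A (Function.update (σ.arr A) (σ.reg a) (σ.reg b)) }
  | .rofNat d a => { σ with rreg := Function.update σ.rreg d (σ.reg a : ℝ) }
  | .rop o d a b => { σ with rreg := Function.update σ.rreg d (o.evalReal (σ.rreg a) (σ.rreg b)) }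
  | .rload A d a => { σ with rreg := Function.update σ.rreg d (σ.rarr A (σ.reg a)) }
  | .rstore A a b =>
      { σ with rarr := Function.update σ.rarr A (Function.update (σ.rarr A) (σ.reg a) (σ.rreg b)) }

/-- The result of an integer operation has to fit in a word, i.e. be at most `B`. -/
def Instr.Fits (B : ℕ) (σ : State) : Instr → Prop
  | .const _ c => c ≤ B
  | .op o _ a b => o.evalNat (σ.reg a) (σ.reg b) ≤ B
  | _ => True

/-- Tests: strict comparison of two integer registers, comparison of two real registers. -/
inductive Test where
  | lt (a b : ℕ)
  | rle (a b : ℕ)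

def Test.Holds (σ : State) : Test → Prop
  | .lt a b => σ.reg a < σ.reg b
  | .rle a b => σ.rreg a ≤ σ.rreg b

inductive Prog where
  | atom (i : Instr)
  | seq (P Q : Prog)
  | ite (c : Test) (P Q : Prog)
  | loop (c : Test) (P : Prog)

/-- `Exec B P σ t σ'`: with words bounded by `B`, program `P` started in `σ` halts in `σ'` after
exactly `t` steps; every elementary instruction and every evaluation of a test is one step. -/
inductive Exec (B : ℕ) : Prog → State → ℕ → State → Prop where
  | atom {i : Instr} {σ : State} (h : i.Fits B σ) : Exec B (.atom i) σ 1 (i.run σ)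
  | seq {P Q : Prog} {σ σ₁ σ₂ : State} {t₁ t₂ : ℕ} (h₁ : Exec B P σ t₁ σ₁)
      (h₂ : Exec B Q σ₁ t₂ σ₂) : Exec B (.seq P Q) σ (t₁ + t₂) σ₂
  | iteTrue {c : Test} {P Q : Prog} {σ σ₁ : State} {t : ℕ} (hc : c.Holds σ)
      (h : Exec B P σ t σ₁) : Exec B (.ite c P Q) σ (t + 1) σ₁
  | iteFalse {c : Test} {P Q : Prog} {σ σ₁ : State} {t : ℕ} (hc : ¬ c.Holds σ)
      (h : Exec B Q σ t σ₁) : Exec B (.ite c P Q) σ (t + 1) σ₁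
  | loopDone {c : Test} {P : Prog} {σ : State} (hc : ¬ c.Holds σ) : Exec B (.loop c P) σ 1 σ
  | loopStep {c : Test} {P : Prog} {σ σ₁ σ₂ : State} {t₁ t₂ : ℕ} (hc : c.Holds σ)
      (h₁ : Exec B P σ t₁ σ₁) (h₂ : Exec B (.loop c P) σ₁ t₂ σ₂) :
      Exec B (.loop c P) σ (t₁ + t₂ + 1) σ₂

/-- Input of a user: `k`, `s`, `n`, the column `j` assigned to the user, the sample `x`, the number
`e^ε`, and a private random number `u`. All other cells hold `0`. -/
def userInput (k s n j x : ℕ) (ε u : ℝ) : State where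
  reg := fun r => match r with
    | 0 => k
    | 1 => s
    | 2 => n
    | 3 => j
    | 4 => x
    | _ => 0
  rreg := fun r => match r with
    | 0 => Real.exp ε
    | 1 => u
    | _ => 0
  arr := fun _ _ => 0
  rarr := fun _ _ => 0

/-- Input of the server: `k`, `s`, `n`, the number `e^ε`, the array of the assigned columns, and
the array of the received bits. All other cells hold `0`. -/
def serverInput (k s n : ℕ) (ε : ℝ) (col : Fin n → ℕ) (y : Fin n → Bool) : State where
  reg := fun r => match r with
    | 0 => k
    | 1 => s
    | 2 => n
    | _ => 0
  rreg := fun r => match r with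
    | 0 => Real.exp ε
    | _ => 0
  arr := fun A i => if h : i < n then
      (match A with
        | 0 => col ⟨i, h⟩
        | 1 => (y ⟨i, h⟩).toNat
        | _ => 0)
    else 0
  rarr := fun _ _ => 0

/-- With words bounded by `B`, the user program `P` samples the message of a user with column `j`
from the channel `W` in at most `T` steps: with `u` uniform on `[0, 1]`, the bit left in
integer register `0` has distribution `W x`. -/
def UserSamples (B T : ℕ) (P : Prog) (k s n j : ℕ) (ε : ℝ) (W : Channel k Bool) : Prop :=
  ∀ x : Fin k, ∃ out : ℝ → Bool,
    (∀ u ∈ Set.Icc (0 : ℝ) 1, ∃ t ≤ T, ∃ σ : State,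
      Exec B P (userInput k s n j x ε u) t σ ∧ σ.reg 0 = (out u).toNat) ∧
    ∀ b : Bool, W x b = volume {u : ℝ | u ∈ Set.Icc (0 : ℝ) 1 ∧ out u = b}

/-- With words bounded by `B`, the server program `P` computes the estimate from every possible
list of messages in at most `T` steps; entry `x` of the estimate is left in cell `x` of the real
array `0`. -/
def ServerComputes (B T : ℕ) (P : Prog) {k n : ℕ} (s : ℕ) (ε : ℝ) (col : Fin n → ℕ)
    (est : (Fin n → Bool) → PMF (Fin k)) : Prop :=
  ∀ y : Fin n → Bool, ∃ t ≤ T, ∃ σ : State,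
    Exec B P (serverInput k s n ε col y) t σ ∧ ∀ x : Fin k, σ.rarr 0 x = (est y x).toReal

end SparseLDP

end

/-! Upper bound. Randomized response multiplies the mean of the sign of a user's bit by
(e^ε-1)/(e^ε+1), so the vector before projection is a linear combination of independent signs; it is
unbiased once all columns are in use, because the rows of `H` are orthogonal. If the groups are
nearly equal, every weight is O(1/(nε)), and each coordinate error g_x is subgaussian with variance
proxy v = O(1/(nε²)). The projection error only sees the at most 2s coordinates in the supports of p
and of its projection (`tv_sq_le`). Instead of a union bound over supports, one exponential moment
suffices: the expectation of ∑_x exp(g_x²/(4v)) is at most 2k, and a bound O(k) on this sum forces ∑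
g_x² = O(v s max(log(k/s),1)) over any 2s coordinates (`integral_exp_sq_le`,
`sum_sq_le_of_sum_exp_le`). If n < K, a random choice of one column from each of about n blocks has
coherence O(√(log k / n)) (`exists_balanced_choice`, `exists_columns`). The resulting bias is
harmless, since n < K together with n ≥ C R forces s² ≤ k, and then log k ≤ 2 max(log(k/s),1).

Lower bound. The hard distributions put mass 1-γ on a fixed point and γ/t on one point of each of t
blocks of length L ≈ k/s, the positions z being independent and uniform. Under an ε-LDP channel the
probability of a message is a constant plus γ/t times a sum of t independent terms, each varying by
at most e^ε-1 times the mixture probability q. So a user contributes at most γ²(e^ε-1)²/t to the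
average χ²-divergence from the mixture (`spike_channel_bounds`). A Chernoff bound shows that any
single estimate is α-close to at most a fraction e^{-λ} of the family, with λ of order s log(k/s) up
to constants depending on α₀ (`spike_separation`). The Fano-type inequality `change_of_measure`
combines the two into 0.9 λ ≤ n γ²(e^ε-1)²/t + 0.81 λ. The choice is γ = 2α for α ≤ 1/2, and γ = 1
for larger α. The inequality holds for every outcome of the public coins, hence on average.

Running time. The estimate is a fast Walsh-Hadamard transform. Its projection is soft thresholding
of the s largest entries (`isSparseProjection_of_top`). A tournament tree delivers these entries in
decreasing order at logarithmic cost each, and the threshold is updated as they arrive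
(`Selection.skip`, `Selection.take`), so no sorting and no search for the threshold are needed. -/

noncomputable section

namespace SparseLDP

/-! ### Reasoning about programs -/

/-- Started in `σ`, the program `P` halts within `T` steps in a state satisfying `Q`. -/
def Reaches (B : ℕ) (P : Prog) (T : ℕ) (Q : State → Prop) (σ : State) : Prop :=
  ∃ t ≤ T, ∃ σ', Exec B P σ t σ' ∧ Q σ'

/-- A nonempty sequence of instructions. -/
def block : Instr → List Instr → Prog
  | i, [] => .atom i
  | i, j :: l => .seq (.atom i) (block j l)

/-- Consecutive execution of a list of instructions. -/
def runAll : List Instr → State → State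
  | [], σ => σ
  | i :: l, σ => runAll l (i.run σ)

/-- All the results of a list of instructions fit in a word. -/
def FitsAll (B : ℕ) : List Instr → State → Prop
  | [], _ => True
  | i :: l, σ => i.Fits B σ ∧ FitsAll B l (i.run σ)

namespace Reaches

variable {B T T₁ T₂ : ℕ} {P P' : Prog} {Q R : State → Prop} {σ : State} {c : Test}

theorem mono (h : Reaches B P T₁ Q σ) (hT : T₁ ≤ T₂) (hQ : ∀ σ', Q σ' → R σ') :
    Reaches B P T₂ R σ := by
  obtain ⟨t, ht, σ', he, hq⟩ := h
  exact ⟨t, ht.trans hT, σ', he, hQ _ hq⟩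

theorem seq (h : Reaches B P T₁ (fun σ' => Reaches B P' T₂ Q σ') σ) :
    Reaches B (.seq P P') (T₁ + T₂) Q σ := by
  obtain ⟨t, ht, σ', he, t', ht', σ'', he', hq⟩ := h
  exact ⟨t + t', by omega, σ'', .seq he he', hq⟩

theorem ite (h₁ : c.Holds σ → Reaches B P T Q σ) (h₂ : ¬ c.Holds σ → Reaches B P' T Q σ) :
    Reaches B (.ite c P P') (T + 1) Q σ := by
  by_cases hc : c.Holds σ
  · obtain ⟨t, ht, σ', he, hq⟩ := h₁ hc
    exact ⟨t + 1, by omega, σ', .iteTrue hc he, hq⟩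
  · obtain ⟨t, ht, σ', he, hq⟩ := h₂ hc
    exact ⟨t + 1, by omega, σ', .iteFalse hc he, hq⟩

theorem block {i : Instr} {l : List Instr} (hf : FitsAll B (i :: l) σ)
    (hq : Q (runAll (i :: l) σ)) : Reaches B (block i l) (l.length + 1) Q σ := by
  induction l generalizing i σ with
  | nil => exact ⟨1, by simp, _, .atom hf.1, hq⟩
  | cons j l ih =>
    obtain ⟨t, ht, σ', he, h⟩ := ih hf.2 hq
    refine ⟨1 + t, by simp only [List.length_cons]; omega, σ', .seq (.atom hf.1) he, h⟩

/-- The index of `Inv` is a variant: an upper bound on the rounds left, so the loop may stop early.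
Each round pays one step for its test, and the failing test pays the last one. -/
theorem loop (Inv : ℕ → State → Prop)
    (hstep : ∀ N σ, Inv N σ → c.Holds σ → ∃ M, N = M + 1 ∧ Reaches B P T (Inv M) σ)
    (N : ℕ) (σ : State) (h : Inv N σ) :
    Reaches B (.loop c P) (N * (T + 1) + 1) (fun σ' => ¬ c.Holds σ' ∧ ∃ M, Inv M σ') σ := by
  induction N generalizing σ with
  | zero =>
    refine ⟨1, by omega, σ, .loopDone fun hc => ?_, fun hc => ?_, 0, h⟩ <;>
    · obtain ⟨M, hM, -⟩ := hstep 0 σ h hc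
      omega
  | succ N ih =>
    by_cases hc : c.Holds σ
    · obtain ⟨M, hM, t, ht, σ', he, hi⟩ := hstep _ σ h hc
      obtain rfl : N = M := by omega
      obtain ⟨t', ht', σ'', he', hq⟩ := ih σ' hi
      exact ⟨t + t' + 1, by rw [Nat.succ_mul]; omega, σ'', .loopStep hc he he', hq⟩
    · exact ⟨1, by omega, σ, .loopDone hc, hc, _, h⟩

/-- Rule for counting loops: here the index is the number of completed rounds, and the variant of
`loop` is `N` minus it. -/
theorem count (Inv : ℕ → State → Prop) (N : ℕ)
    (hc : ∀ i σ, i ≤ N → Inv i σ → (c.Holds σ ↔ i < N))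
    (hstep : ∀ i σ, i < N → Inv i σ → Reaches B P T (Inv (i + 1)) σ) (σ : State) (h : Inv 0 σ) :
    Reaches B (.loop c P) (N * (T + 1) + 1) (Inv N) σ := by
  refine (loop (c := c) (fun M σ => M ≤ N ∧ Inv (N - M) σ) ?_ N σ ⟨le_rfl, by simpa using h⟩).mono
    le_rfl ?_
  · rintro M σ ⟨hM, hi⟩ hh
    have := (hc _ _ (Nat.sub_le _ _) hi).1 hh
    refine ⟨M - 1, by omega, (hstep _ _ this hi).mono le_rfl fun σ' h' => ⟨by omega, ?_⟩⟩
    rwa [show N - (M - 1) = N - M + 1 by omega]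
  · rintro σ' ⟨hh, M, hM, hi⟩
    have : ¬ N - M < N := fun h => hh ((hc _ _ (Nat.sub_le _ _) hi).2 h)
    rwa [show N - M = N by omega] at hi

end Reaches

/-! ### The user program -/

/-- Peels off the lowest binary digit, as the user program does by halving; `hadamard_succ` peels
off the highest one, as the fast transform does. -/
theorem hadamard_succ' (m x j : ℕ) : hadamard (m + 1) x j =
    (if x % 2 * (j % 2) = 1 then -1 else 1) * hadamard m (x / 2) (j / 2) := by
  unfold hadamard
  rw [Finset.prod_range_succ', mul_comm]
  simp only [Nat.testBit_succ]
  congr 1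
  simp only [Nat.testBit_zero]
  rcases Nat.mod_two_eq_zero_or_one x with h | h <;>
    rcases Nat.mod_two_eq_zero_or_one j with h' | h' <;> simp [h, h']

theorem hadamard_zero_left (m j : ℕ) : hadamard m 0 j = 1 := by
  simp [hadamard]

theorem hadamard_eq_or (m x j : ℕ) : hadamard m x j = 1 ∨ hadamard m x j = -1 := by
  unfold hadamard
  induction m with
  | zero => simp
  | succ m ih =>
    rw [Finset.prod_range_succ]
    rcases ih with h | h <;> rw [h] <;> split_ifs <;> simp

/-- Computes the parity of the number of common binary digits of registers `3` and `4`. -/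
def parityLoop : Prog :=
  .loop (.lt 7 4) (block (.op .div 9 4 6) [.op .mul 10 9 6, .op .sub 10 4 10, .op .add 4 9 7,
    .op .div 11 3 6, .op .mul 12 11 6, .op .sub 12 3 12, .op .add 3 11 7,
    .op .mul 10 10 12, .op .add 8 8 10, .op .div 9 8 6, .op .mul 9 9 6, .op .sub 8 8 9])

/-- One-bit Hadamard Response of one user. -/
def userProg : Prog :=
  .seq (block (.const 5 1) [.const 6 2]) <| .seq parityLoop <|
  .seq (block (.rofNat 2 5) [.rop .add 4 0 2]) <|
  .seq (.ite (.lt 7 8) (.atom (.rop .div 3 2 4)) (.atom (.rop .div 3 0 4)))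
    (.ite (.rle 1 3) (.atom (.const 0 1)) (.atom (.const 0 0)))

/-- The product of the sign recorded in register 8 and the entry for the digits not yet read stays
equal to `H`. Once register 4 is 0, the remaining entry is 1. -/
theorem reaches_parityLoop {B m : ℕ} (hB : 2 ≤ B) (ε u : ℝ) (σ : State)
    (h5 : σ.reg 5 = 1) (h6 : σ.reg 6 = 2) (h7 : σ.reg 7 = 0) (h8 : σ.reg 8 = 0)
    (h3 : σ.reg 3 ≤ B) (h4 : σ.reg 4 ≤ B) (hx : σ.reg 4 < 2 ^ m) (hr0 : σ.rreg 0 = Real.exp ε)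
    (hr1 : σ.rreg 1 = u) :
    Reaches B parityLoop (m * 14 + 1) (fun σ' => σ'.reg 5 = 1 ∧ σ'.reg 7 = 0 ∧
      σ'.rreg 0 = Real.exp ε ∧ σ'.rreg 1 = u ∧
      (0 < σ'.reg 8 ↔ hadamard m (σ.reg 4) (σ.reg 3) ≠ 1)) σ := by
  set H := hadamard m (σ.reg 4) (σ.reg 3)
  refine (Reaches.loop (T := 13) (fun N τ => τ.reg 5 = 1 ∧ τ.reg 6 = 2 ∧ τ.reg 7 = 0 ∧
    τ.rreg 0 = Real.exp ε ∧ τ.rreg 1 = u ∧ τ.reg 4 < 2 ^ N ∧ τ.reg 3 ≤ B ∧ τ.reg 4 ≤ B ∧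
    τ.reg 8 ≤ 1 ∧ (if τ.reg 8 = 1 then -1 else 1) * hadamard N (τ.reg 4) (τ.reg 3) = H) ?_ m σ
    ⟨h5, h6, h7, hr0, hr1, hx, h3, h4, by omega, by simp [h8, H]⟩).mono (by omega) ?_
  · rintro N τ ⟨h5, h6, h7, hr0, hr1, hx, h3, h4, h8, hH⟩ hc
    simp only [Test.Holds, h7] at hc
    obtain _ | N := N
    · omega
    refine ⟨N, rfl, Reaches.block ?_ ?_⟩
    · have : τ.reg 4 - τ.reg 4 / 2 * 2 = τ.reg 4 % 2 := by omega
      have : τ.reg 3 - τ.reg 3 / 2 * 2 = τ.reg 3 % 2 := by omega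
      have : τ.reg 4 % 2 * (τ.reg 3 % 2) ≤ 1 := by
        rcases Nat.mod_two_eq_zero_or_one (τ.reg 4) with h | h <;> rw [h] <;> omega
      simp [FitsAll, Instr.Fits, Instr.run, ArithOp.evalNat, *]
      omega
    · have e1 : τ.reg 4 - τ.reg 4 / 2 * 2 = τ.reg 4 % 2 := by omega
      have e2 : τ.reg 3 - τ.reg 3 / 2 * 2 = τ.reg 3 % 2 := by omega
      have h2 : τ.reg 4 % 2 * (τ.reg 3 % 2) ≤ 1 := by
        rcases Nat.mod_two_eq_zero_or_one (τ.reg 4) with h | h <;> rw [h] <;> omega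
      simp only [runAll, Instr.run, ArithOp.evalNat, Function.update_apply]
      simp [h5, h6, h7, hr0, hr1, e1, e2]
      refine ⟨by omega, by omega, by omega, by omega, ?_⟩
      rw [← hH, hadamard_succ', ← mul_assoc]
      generalize τ.reg 4 % 2 * (τ.reg 3 % 2) = z at *
      interval_cases z <;> interval_cases τ.reg 8 <;> simp
  · rintro σ' ⟨hc, M, h5, h6, h7, hr0, hr1, hx, h3, h4, h8, hH⟩
    refine ⟨h5, h7, hr0, hr1, ?_⟩
    simp only [Test.Holds, h7] at hc
    rw [show σ'.reg 4 = 0 by omega, hadamard_zero_left] at hH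
    rw [← hH]
    interval_cases σ'.reg 8 <;> simp
    norm_num

theorem volume_unit_le {a : ℝ} (h1 : a ≤ 1) :
    volume {u : ℝ | u ∈ Set.Icc (0 : ℝ) 1 ∧ decide (u ≤ a) = true} = ENNReal.ofReal a := by
  have : {u : ℝ | u ∈ Set.Icc (0 : ℝ) 1 ∧ decide (u ≤ a) = true} = Set.Icc 0 a := by
    ext u
    simp only [Set.mem_Icc, decide_eq_true_eq, Set.mem_ofPred_eq]
    constructor <;> intro h <;> refine ⟨?_, ?_⟩ <;> (try constructor) <;> linarith [h.1, h.2]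
  rw [this, Real.volume_Icc, sub_zero]

theorem volume_unit_gt {a : ℝ} (h0 : 0 ≤ a) :
    volume {u : ℝ | u ∈ Set.Icc (0 : ℝ) 1 ∧ decide (u ≤ a) = false} = ENNReal.ofReal (1 - a) := by
  have : {u : ℝ | u ∈ Set.Icc (0 : ℝ) 1 ∧ decide (u ≤ a) = false} = Set.Ioc a 1 := by
    ext u
    simp only [Set.mem_Icc, decide_eq_false_iff_not, Set.mem_ofPred_eq, Set.mem_Ioc, not_le]
    constructor <;> intro h <;> refine ⟨?_, ?_⟩ <;> (try constructor) <;> linarith [h.1, h.2]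
  rw [this, Real.volume_Ioc]

theorem userSamples {k s n j B : ℕ} (ε : ℝ) (hk : k ≤ B) (hj : j ≤ B) (hB : 2 ≤ B) :
    UserSamples B (hadamardLog k * 14 + 9) userProg k s n j ε (hrChannel k ε j) := by
  classical
  intro x
  set f : Bool := decide (hadamard (hadamardLog k) x j = 1) with hf
  have hE := Real.exp_pos ε
  have hmin : ∀ b, 0 ≤ responseProb ε b ∧ responseProb ε b ≤ 1 := by
    intro b
    unfold responseProb
    split_ifs
    · exact ⟨by positivity, by rw [div_le_one (by positivity)]; linarith⟩
    · exact ⟨by positivity, by rw [div_le_one (by positivity)]; linarith⟩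
  have hxK : (x : ℕ) < 2 ^ hadamardLog k :=
    x.2.trans_le ((Nat.le_succ k).trans (Nat.le_pow_clog (by norm_num) _))
  -- Inverse transform sampling: the bit is 1 exactly when `u` is at most the required probability.
  refine ⟨fun u => decide (u ≤ responseProb ε f), fun u _ => ?_, fun b => ?_⟩
  · have : Reaches B userProg (hadamardLog k * 14 + 9)
        (fun σ => σ.reg 0 = (decide (u ≤ responseProb ε f)).toNat) (userInput k s n j x ε u) := by
      unfold userProg
      refine Reaches.mono (T₁ := 2 + ((hadamardLog k * 14 + 1) + (2 + (2 + 2)))) ?_ (by omega)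
        (fun _ => id)
      refine Reaches.seq (Reaches.block (by simp [FitsAll, Instr.Fits]; omega) ?_)
      refine Reaches.seq ((reaches_parityLoop (m := hadamardLog k) hB ε u _ ?_ ?_ ?_ ?_ ?_ ?_ ?_ ?_
        ?_).mono le_rfl ?_)
      any_goals first | rfl | exact hj | exact x.2.le.trans hk | exact hxK
      rintro σ ⟨h5, h7, hr0, hr1, h8⟩
      replace h8 : 0 < σ.reg 8 ↔ hadamard (hadamardLog k) x j ≠ 1 := h8
      refine Reaches.seq (Reaches.block (by simp [FitsAll, Instr.Fits]) ?_)
      refine Reaches.seq (Reaches.mono (T₁ := 2) (Q := fun τ => τ.rreg 1 = u ∧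
        τ.rreg 3 = responseProb ε f) (Reaches.ite (T := 1) ?_ ?_) le_rfl ?_)
      · intro hc
        refine ⟨1, le_rfl, _, .atom trivial, ?_⟩
        simp only [Test.Holds, runAll, Instr.run, h7, h8] at hc
        simp [runAll, Instr.run, ArithOp.evalReal, hr1, hr0, h5,
          responseProb, hf, hc]
      · intro hc
        refine ⟨1, le_rfl, _, .atom trivial, ?_⟩
        simp only [Test.Holds, runAll, Instr.run, h7, h8, not_not] at hc
        simp [runAll, Instr.run, ArithOp.evalReal, hr1, hr0, h5,
          responseProb, hf, hc]
      · rintro τ ⟨ht1, ht3⟩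
        refine Reaches.ite (T := 1) ?_ ?_ <;> intro hc <;> simp only [Test.Holds, ht1, ht3] at hc
        · exact ⟨1, le_rfl, _, .atom (by simp [Instr.Fits]; omega), by simp [Instr.run, hc]⟩
        · exact ⟨1, le_rfl, _, .atom (by simp [Instr.Fits]), by
            simp [Instr.run, show ¬ u ≤ responseProb ε f from hc]⟩
    obtain ⟨t, ht, σ, he, h⟩ := this
    exact ⟨t, ht, σ, he, h⟩
  · have hsum : 1 - responseProb ε f = responseProb ε (!f) := by
      unfold responseProb
      cases f <;> simp <;> field_simp <;> ring
    have hW : hrChannel k ε j x b = ENNReal.ofReal (responseProb ε (b == f)) := rfl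
    rw [hW]
    cases b
    · rw [volume_unit_gt (hmin _).1, hsum]
      cases f <;> rfl
    · rw [volume_unit_le (hmin _).2]
      cases f <;> rfl

end SparseLDP
end

noncomputable section

namespace SparseLDP

/-! ### The Hadamard matrix and the fast Walsh-Hadamard transform -/

theorem hadamard_comm (m x j : ℕ) : hadamard m x j = hadamard m j x := by
  simp only [hadamard, Bool.and_comm]

theorem hadamard_succ (m x j : ℕ) : hadamard (m + 1) x j =
    hadamard m x j * if x.testBit m && j.testBit m then -1 else 1 := by
  simp only [hadamard, Finset.prod_range_succ]

theorem hadamard_add_two_pow (m x j : ℕ) : hadamard m x (2 ^ m + j) = hadamard m x j := by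
  unfold hadamard
  refine Finset.prod_congr rfl fun b hb => ?_
  rw [Nat.testBit_two_pow_add_gt (Finset.mem_range.1 hb)]

theorem sum_range_two_pow_succ (m : ℕ) (f : ℕ → ℝ) :
    ∑ j ∈ Finset.range (2 ^ (m + 1)), f j =
      ∑ j ∈ Finset.range (2 ^ m), (f j + f (2 ^ m + j)) := by
  rw [pow_succ, mul_two, Finset.sum_range_add, Finset.sum_add_distrib]

/-- The matrix is a tensor power of a 2 × 2 matrix, so inner products of rows factor over binary
digits. A digit where the rows differ contributes the factor 1 - 1. -/
theorem sum_hadamard_mul (m x x' : ℕ) :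
    ∑ j ∈ Finset.range (2 ^ m), hadamard m x j * hadamard m x' j =
      ∏ b ∈ Finset.range m, (1 + (if x.testBit b then -1 else 1) *
        (if x'.testBit b then -1 else 1)) := by
  induction m with
  | zero => simp [hadamard]
  | succ m ih =>
    rw [sum_range_two_pow_succ, Finset.prod_range_succ, ← ih, Finset.sum_mul]
    refine Finset.sum_congr rfl fun j hj => ?_
    simp only [hadamard_succ, hadamard_add_two_pow, Nat.testBit_two_pow_add_eq,
      Nat.testBit_lt_two_pow (Finset.mem_range.1 hj)]
    cases x.testBit m <;> cases x'.testBit m <;> simp <;> ring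

theorem sum_hadamard_mul_of_ne {m x x' : ℕ} (hx : x < 2 ^ m) (hx' : x' < 2 ^ m) (h : x ≠ x') :
    ∑ j ∈ Finset.range (2 ^ m), hadamard m x j * hadamard m x' j = 0 := by
  obtain ⟨b, hb⟩ := Nat.exists_testBit_ne_of_ne h
  have hbm : b < m := by
    by_contra hbm
    have h2 : 2 ^ m ≤ 2 ^ b := Nat.pow_le_pow_right (by norm_num) (not_lt.1 hbm)
    rw [Nat.testBit_lt_two_pow (hx.trans_le h2), Nat.testBit_lt_two_pow (hx'.trans_le h2)] at hb
    exact hb rfl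
  rw [sum_hadamard_mul]
  refine Finset.prod_eq_zero (Finset.mem_range.2 hbm) ?_
  cases h1 : x.testBit b <;> cases h2 : x'.testBit b <;> simp_all

theorem hadamard_mul_self (m x j : ℕ) : hadamard m x j * hadamard m x j = 1 := by
  rcases hadamard_eq_or m x j with h | h <;> rw [h] <;> norm_num

theorem abs_hadamard (m x j : ℕ) : |hadamard m x j| = 1 := by
  rcases hadamard_eq_or m x j with h | h <;> rw [h] <;> norm_num

/-- The array after `b` rounds of the fast Walsh-Hadamard transform. -/
def walsh (f : ℕ → ℝ) (b x : ℕ) : ℝ :=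
  ∑ j ∈ Finset.range (2 ^ b), hadamard b x j * f (j + 2 ^ b * (x / 2 ^ b))

theorem walsh_zero (f : ℕ → ℝ) (x : ℕ) : walsh f 0 x = f x := by
  simp [walsh, hadamard]

theorem walsh_of_lt (f : ℕ → ℝ) {m x : ℕ} (h : x < 2 ^ m) :
    walsh f m x = ∑ j ∈ Finset.range (2 ^ m), hadamard m x j * f j := by
  simp [walsh, Nat.div_eq_of_lt h]

/-- Round `b` joins the block of `x` with its neighbour of the same length `2 ^ b`. Digit `b` of `x`
tells which half `x` lies in, hence whether the two partial sums are added or subtracted. -/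
theorem walsh_succ_even (f : ℕ → ℝ) {b x : ℕ} (h : x / 2 ^ b % 2 = 0) :
    walsh f (b + 1) x = walsh f b x + walsh f b (x + 2 ^ b) := by
  have hb : x.testBit b = false := by rw [Nat.testBit_eq_decide_div_mod_eq]; simp [h]
  have hq : 2 ^ (b + 1) * (x / 2 ^ (b + 1)) = 2 ^ b * (x / 2 ^ b) := by
    rw [pow_succ, ← Nat.div_div_eq_div_mul, mul_assoc]
    congr 1
    omega
  have hq' : (x + 2 ^ b) / 2 ^ b = x / 2 ^ b + 1 := Nat.add_div_right _ (by positivity)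
  unfold walsh
  rw [sum_range_two_pow_succ, hq, hq', ← Finset.sum_add_distrib]
  refine Finset.sum_congr rfl fun j _ => ?_
  rw [hadamard_succ, hadamard_succ, hadamard_add_two_pow, hb, hadamard_comm b (x + 2 ^ b),
    add_comm x, hadamard_add_two_pow, hadamard_comm b j x,
    show j + 2 ^ b * (x / 2 ^ b + 1) = 2 ^ b + j + 2 ^ b * (x / 2 ^ b) by ring]
  simp

theorem walsh_succ_odd (f : ℕ → ℝ) {b x : ℕ} (h : x / 2 ^ b % 2 = 1) :
    walsh f (b + 1) x = walsh f b (x - 2 ^ b) - walsh f b x := by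
  have hb : x.testBit b = true := by rw [Nat.testBit_eq_decide_div_mod_eq]; simp [h]
  obtain ⟨y, rfl⟩ : ∃ y, x = 2 ^ b + y := by
    refine Nat.exists_eq_add_of_le ?_
    by_contra hlt
    rw [Nat.div_eq_of_lt (not_le.1 hlt)] at h
    simp at h
  have hq' : (2 ^ b + y) / 2 ^ b = y / 2 ^ b + 1 := Nat.add_div_left _ (by positivity)
  have hq : 2 ^ (b + 1) * ((2 ^ b + y) / 2 ^ (b + 1)) = 2 ^ b * (y / 2 ^ b) := by
    rw [pow_succ, ← Nat.div_div_eq_div_mul, mul_assoc]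
    congr 1
    omega
  unfold walsh
  rw [sum_range_two_pow_succ, hq, hq', add_tsub_cancel_left, ← Finset.sum_sub_distrib]
  refine Finset.sum_congr rfl fun j hj => ?_
  rw [hadamard_succ, hadamard_succ, hadamard_add_two_pow, hb, hadamard_comm b (2 ^ b + y),
    hadamard_add_two_pow, hadamard_comm b j y, Nat.testBit_two_pow_add_eq,
    Nat.testBit_lt_two_pow (Finset.mem_range.1 hj),
    show j + 2 ^ b * (y / 2 ^ b + 1) = 2 ^ b + j + 2 ^ b * (y / 2 ^ b) by ring]
  simp
  ring

/-! ### Projection onto the sparse distributions -/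

/-- After cancelling `U ∩ T`, the least value of `g` on `T \ U` separates the two remaining sums. -/
theorem sum_le_sum_of_top {ι : Type*} [DecidableEq ι] (g : ι → ℝ) (hg : ∀ x, 0 ≤ g x)
    {U T : Finset ι} (hc : U.card ≤ T.card) (htop : ∀ x ∉ T, ∀ y ∈ T, g x ≤ g y) :
    ∑ x ∈ U, g x ≤ ∑ x ∈ T, g x := by
  rw [← Finset.sum_sdiff (Finset.inter_subset_left : U ∩ T ⊆ U),
    ← Finset.sum_sdiff (Finset.inter_subset_right : U ∩ T ⊆ T)]
  gcongr ?_ + _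
  have h1 := Finset.card_sdiff_add_card_inter U T
  have h2 := Finset.card_sdiff_add_card_inter T U
  rw [Finset.inter_comm] at h2
  rw [Finset.sdiff_inter_self_left, Finset.sdiff_inter_self_right]
  rcases (T \ U).eq_empty_or_nonempty with he | hne
  · have : U \ T = ∅ := by
      rw [he, Finset.card_empty] at h2
      rw [← Finset.card_eq_zero]
      omega
    rw [he, this]
  · obtain ⟨y, hy, hmin⟩ := Finset.exists_min_image _ g hne
    calc ∑ x ∈ U \ T, g x ≤ (U \ T).card • g y := Finset.sum_le_card_nsmul _ _ _ fun x hx =>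
          htop x (Finset.mem_sdiff.1 hx).2 y (Finset.mem_sdiff.1 hy).1
      _ ≤ (T \ U).card • g y := nsmul_le_nsmul_left (hg y) (by omega)
      _ ≤ _ := Finset.card_nsmul_le_sum _ _ _ hmin

theorem sum_toReal_pmf {k : ℕ} (p : PMF (Fin k)) : ∑ x, (p x).toReal = 1 := by
  rw [← ENNReal.toReal_sum fun x _ => p.apply_ne_top x, ← tsum_fintype (L := .unconditional _),
    p.tsum_coe, ENNReal.toReal_one]

/-- Soft thresholding of the `s` largest entries is a Euclidean projection onto the `s`-sparse
distributions. -/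
theorem isSparseProjection_of_top {k s : ℕ} (v : Fin k → ℝ) (T : Finset (Fin k))
    (hT : T.card = s) (htop : ∀ x ∉ T, ∀ y ∈ T, v x ≤ v y) (τ : ℝ) (q : PMF (Fin k))
    (hq : ∀ x, (q x).toReal = if x ∈ T then max (v x - τ) 0 else 0) :
    IsSparseProjection s v q := by
  classical
  refine ⟨?_, fun r hr => ?_⟩
  · have : q.support ⊆ T := by
      intro x hx
      by_contra hxT
      have := hq x
      rw [if_neg (fun hh => hxT (by simpa using hh)), ENNReal.toReal_eq_zero_iff] at this
      exact hx (this.resolve_right (q.apply_ne_top x))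
    calc q.support.ncard ≤ (T : Set (Fin k)).ncard := Set.ncard_le_ncard this
      _ = s := by rw [Set.ncard_coe_finset, hT]
  set U : Finset (Fin k) := Finset.univ.filter fun x => r x ≠ 0 with hU
  have hUc : U.card ≤ T.card := by
    rw [hT]
    refine le_trans (le_of_eq ?_) hr
    rw [← Set.ncard_coe_finset]
    congr 1
    ext x
    simp [hU, PMF.mem_support_iff]
  have hsum := sum_le_sum_of_top (fun x => max (v x - τ) 0 ^ 2) (fun _ => by positivity) hUc
    (fun x hx y hy => by
      have := htop x hx y hy
      gcongr)
  -- All candidates have total mass 1, so replacing `v` by `v - τ` changes the objective by the same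
  -- constant for each of them.
  have expand : ∀ p : PMF (Fin k), ∑ x, (v x - (p x).toReal) ^ 2 =
      ∑ x, (v x - τ - (p x).toReal) ^ 2 + (2 * τ * (∑ x, (v x - τ) - 1) + k * τ ^ 2) := by
    intro p
    have : ∑ x, (v x - (p x).toReal) ^ 2 = ∑ x, ((v x - τ - (p x).toReal) ^ 2 +
        (2 * τ * ((v x - τ) - (p x).toReal) + τ ^ 2)) :=
      Finset.sum_congr rfl fun x _ => by ring
    rw [this, Finset.sum_add_distrib, Finset.sum_add_distrib, ← Finset.mul_sum,
      Finset.sum_sub_distrib (fun x => v x - τ), sum_toReal_pmf]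
    simp
  rw [expand q, expand r]
  gcongr ?_ + _
  have hqs : ∑ x, (v x - τ - (q x).toReal) ^ 2 =
      ∑ x, (v x - τ) ^ 2 - ∑ x ∈ T, max (v x - τ) 0 ^ 2 := by
    rw [← Finset.sum_filter_add_sum_filter_not Finset.univ (· ∈ T) fun x => (v x - τ) ^ 2,
      ← Finset.sum_filter_add_sum_filter_not Finset.univ (· ∈ T)
        fun x => (v x - τ - (q x).toReal) ^ 2, Finset.filter_mem_eq_inter, Finset.univ_inter,
      add_sub_right_comm, ← Finset.sum_sub_distrib]
    congr 1
    · refine Finset.sum_congr rfl fun x hx => ?_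
      rw [hq, if_pos hx]
      rcases le_total (v x - τ) 0 with h | h
      · rw [max_eq_right h]; ring
      · rw [max_eq_left h]; ring
    · refine Finset.sum_congr rfl fun x hx => ?_
      rw [hq, if_neg (Finset.mem_filter.1 hx).2, sub_zero]
  -- For `a ≥ 0`, the minimum of `(w - a) ^ 2` is `w ^ 2 - max w 0 ^ 2`. So a candidate supported in
  -- `U` gains at most the sum over `U`, while `q` gains all of the sum over `T`.
  have hrs : ∑ x, (v x - τ) ^ 2 - ∑ x ∈ U, max (v x - τ) 0 ^ 2 ≤
      ∑ x, (v x - τ - (r x).toReal) ^ 2 := by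
    rw [← Finset.sum_filter_add_sum_filter_not Finset.univ (· ∈ U) fun x => (v x - τ) ^ 2,
      ← Finset.sum_filter_add_sum_filter_not Finset.univ (· ∈ U)
        fun x => (v x - τ - (r x).toReal) ^ 2, Finset.filter_mem_eq_inter, Finset.univ_inter,
      add_sub_right_comm, ← Finset.sum_sub_distrib]
    gcongr ?_ + ?_
    · refine Finset.sum_le_sum fun x _ => ?_
      have hr0 : 0 ≤ (r x).toReal := ENNReal.toReal_nonneg
      rcases le_total (v x - τ) 0 with h | h
      · rw [max_eq_right h]; nlinarith
      · rw [max_eq_left h]; nlinarith [sq_nonneg (v x - τ - (r x).toReal)]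
    · refine Finset.sum_le_sum fun x hx => ?_
      have : r x = 0 := by simpa [hU] using hx
      simp [this]
  linarith

/-! ### Tournament trees -/

/-- Every internal node of the tree with `K` leaves (node `i` has children `2i` and `2i+1`)
carries the maximum of its children. -/
def IsMaxTree (K : ℕ) (w : ℕ → ℝ) : Prop :=
  ∀ i, 1 ≤ i → i < K → w i = max (w (2 * i)) (w (2 * i + 1))

theorem IsMaxTree.le_root {K : ℕ} {w : ℕ → ℝ} (h : IsMaxTree K w) :
    ∀ i, 1 ≤ i → i < 2 * K → w i ≤ w 1 := by
  intro i
  induction i using Nat.strong_induction_on with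
  | _ i ih =>
    intro h1 h2
    rcases Nat.lt_or_ge 1 i with hi | hi
    · refine le_trans ?_ (ih (i / 2) (by omega) (by omega) (by omega))
      rw [h (i / 2) (by omega) (by omega)]
      rcases Nat.mod_two_eq_zero_or_one i with hm | hm
      · rw [show 2 * (i / 2) = i by omega]; exact le_max_left _ _
      · rw [show 2 * (i / 2) + 1 = i by omega]; exact le_max_right _ _
    · rw [show i = 1 by omega]

/-! ### Threshold of the simplex projection, one entry at a time -/

/-- The set `T` of the largest entries of `v` below index `k`, of which those in `A` are the ones
above the threshold `τ`; `b` is a strict lower bound for the entries. -/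
structure Selection (k : ℕ) (v : ℕ → ℝ) (b : ℝ) (T A : Finset ℕ) (τ : ℝ) : Prop where
  lt : ∀ x ∈ T, x < k
  top : ∀ x < k, x ∉ T → ∀ y ∈ T, v x ≤ v y
  sub : A ⊆ T
  above : ∀ x ∈ A, τ < v x
  below : ∀ x ∈ T, x ∉ A → v x ≤ τ
  thr : (T = ∅ ∧ A = ∅ ∧ τ = b) ∨ (0 < A.card ∧ A.card * τ = ∑ x ∈ A, v x - 1)

/-- A next largest entry that does not exceed the threshold gets no mass, so `A` and `τ` stay. The
initial situation `τ = b` is excluded because every entry exceeds `b`: the first entry is always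
taken. -/
theorem Selection.skip {k : ℕ} {v : ℕ → ℝ} {b : ℝ} {T A : Finset ℕ} {τ : ℝ}
    (h : Selection k v b T A τ) {x : ℕ} (hx : x < k) (hxT : x ∉ T) (hb : b < v x)
    (hmax : ∀ y < k, y ∉ T → v y ≤ v x) (hle : v x ≤ τ) :
    Selection k v b (insert x T) A τ where
  lt y hy := by
    rcases Finset.mem_insert.1 hy with rfl | hy
    exacts [hx, h.lt y hy]
  top y hyk hy z hz := by
    rw [Finset.mem_insert, not_or] at hy
    rcases Finset.mem_insert.1 hz with rfl | hz
    exacts [hmax y hyk hy.2, h.top y hyk hy.2 z hz]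
  sub := h.sub.trans (Finset.subset_insert _ _)
  above := h.above
  below y hy hyA := by
    rcases Finset.mem_insert.1 hy with rfl | hy
    exacts [hle, h.below y hy hyA]
  thr := by
    rcases h.thr with ⟨-, -, h⟩ | h
    · linarith
    · exact .inr h

/-- If `A` is nonempty, the new threshold τ' is the average of `v x` (weight 1) and `τ` (weight
`A.card`), so τ < τ' < `v x`. Entries already below the threshold stay below, and those in `A`,
being at least `v x`, stay above. If `A` is empty, τ' is `v x - 1`. -/
theorem Selection.take {k : ℕ} {v : ℕ → ℝ} {b : ℝ} {T A : Finset ℕ} {τ : ℝ}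
    (h : Selection k v b T A τ) {x : ℕ} (hx : x < k) (hxT : x ∉ T)
    (hmax : ∀ y < k, y ∉ T → v y ≤ v x) (hlt : τ < v x) :
    Selection k v b (insert x T) (insert x A)
      ((∑ y ∈ insert x A, v y - 1) / ((insert x A).card : ℝ)) := by
  have hxA : x ∉ A := fun hh => hxT (h.sub hh)
  have hpos : (0 : ℝ) < A.card + 1 := by positivity
  set τ' := (∑ y ∈ insert x A, v y - 1) / ((insert x A).card : ℝ) with hτ'
  have hdef : (A.card + 1) * τ' = v x + ∑ y ∈ A, v y - 1 := by
    rw [hτ', Finset.sum_insert hxA, Finset.card_insert_of_notMem hxA]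
    push_cast
    field_simp
  have hτv : τ' < v x := by
    rcases h.thr with ⟨-, rfl, -⟩ | ⟨hc, hs⟩
    · simp at hdef
      linarith
    · have : (A.card : ℝ) * τ ≤ A.card * v x := by gcongr
      have h2 : (A.card + 1 : ℝ) * τ' < (A.card + 1) * v x := by
        have : (A.card : ℝ) * τ < A.card * v x := by
          have : (0 : ℝ) < A.card := by exact_mod_cast hc
          gcongr
        linarith
      exact lt_of_mul_lt_mul_left h2 hpos.le
  constructor
  · intro y hy
    rcases Finset.mem_insert.1 hy with rfl | hy
    exacts [hx, h.lt y hy]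
  · intro y hyk hy z hz
    rw [Finset.mem_insert, not_or] at hy
    rcases Finset.mem_insert.1 hz with rfl | hz
    exacts [hmax y hyk hy.2, h.top y hyk hy.2 z hz]
  · exact Finset.insert_subset_insert _ h.sub
  · intro y hy
    rcases Finset.mem_insert.1 hy with rfl | hy
    exacts [hτv, hτv.trans_le (h.top x hx hxT y (h.sub hy))]
  · intro y hy hyA
    rw [Finset.mem_insert, not_or] at hyA
    rcases Finset.mem_insert.1 hy with rfl | hy
    · exact absurd rfl hyA.1
    refine (h.below y hy hyA.2).trans ?_
    rcases h.thr with ⟨rfl, -⟩ | ⟨hc, hs⟩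
    · simp at hy
    · have : (A.card + 1 : ℝ) * τ ≤ (A.card + 1) * τ' := by linarith
      exact le_of_mul_le_mul_left this hpos
  · refine .inr ⟨by simp, ?_⟩
    rw [Finset.card_insert_of_notMem hxA, Finset.sum_insert hxA]
    push_cast
    exact hdef

/-- The equation for `τ` in `thr` says that the soft-thresholded entries have total mass 1; `hs`
rules out its empty alternative. -/
theorem Selection.exists_projection {k s : ℕ} (hs : 1 ≤ s) {v : ℕ → ℝ} {b : ℝ} {T A : Finset ℕ}
    {τ : ℝ} (h : Selection k v b T A τ) (hT : T.card = s) :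
    ∃ q : PMF (Fin k), IsSparseProjection s (fun x => v x) q ∧
      ∀ x : Fin k, (q x).toReal = if (x : ℕ) ∈ T ∧ τ ≤ v x then v x - τ else 0 := by
  classical
  have hthr : (A.card : ℝ) * τ = ∑ x ∈ A, v x - 1 := by
    rcases h.thr with ⟨rfl, -⟩ | h
    · simp at hT; omega
    · exact h.2
  set g : ℕ → ℝ := fun x => if x ∈ T ∧ τ ≤ v x then v x - τ else 0 with hg
  have hg0 : ∀ x, 0 ≤ g x := by
    intro x
    simp only [hg]
    split_ifs with h
    · linarith [h.2]
    · rfl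
  have hsum : ∑ x : Fin k, g x = 1 := by
    rw [Fin.sum_univ_eq_sum_range g k]
    have hAk : A ⊆ Finset.range k := fun x hx => Finset.mem_range.2 (h.lt x (h.sub hx))
    rw [← Finset.sum_subset hAk]
    · have : ∑ x ∈ A, g x = ∑ x ∈ A, (v x - τ) := Finset.sum_congr rfl fun x hx => by
        simp only [hg]
        rw [if_pos ⟨h.sub hx, (h.above x hx).le⟩]
      rw [this, Finset.sum_sub_distrib, Finset.sum_const, nsmul_eq_mul]
      linarith
    · intro x _ hxA
      simp only [hg]
      split_ifs with hh
      · linarith [hh.2, h.below x hh.1 hxA]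
      · rfl
  let q : PMF (Fin k) := PMF.ofFintype (fun x => ENNReal.ofReal (g x)) (by
    rw [← ENNReal.ofReal_sum_of_nonneg fun (x : Fin k) _ => hg0 x, hsum, ENNReal.ofReal_one])
  have hq : ∀ x : Fin k, (q x).toReal = g x := fun x => by
    simp only [q, PMF.ofFintype_apply, ENNReal.toReal_ofReal (hg0 x)]
  refine ⟨q, ?_, hq⟩
  let T' : Finset (Fin k) := Finset.univ.filter fun x => (x : ℕ) ∈ T
  refine isSparseProjection_of_top _ T' ?_ ?_ τ q fun x => ?_
  · rw [← hT, ← Finset.card_map Fin.valEmbedding]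
    congr 1
    ext x
    simp only [Finset.mem_map, Finset.mem_filter, Finset.mem_univ, true_and, T',
      Fin.valEmbedding_apply]
    exact ⟨fun ⟨y, hy, e⟩ => e ▸ hy, fun hx => ⟨⟨x, h.lt x hx⟩, hx, rfl⟩⟩
  · intro x hx y hy
    exact h.top x x.2 (by simpa [T'] using hx) y (by simpa [T'] using hy)
  · rw [hq]
    simp only [hg, T', Finset.mem_filter, Finset.mem_univ, true_and]
    by_cases hx : (x : ℕ) ∈ T
    · rcases le_total τ (v x) with h1 | h1
      · simp [hx, h1]
      · rcases h1.eq_or_lt with h2 | h2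
        · simp [hx, h2]
        · simp [hx, not_le.2 h2, h1]
    · simp [hx]

end SparseLDP
end

noncomputable section

namespace SparseLDP

/-! ### The server program -/

/-- Values of the registers that the server program sets once and for all. -/
structure Env (k s n K : ℕ) (e : ℝ) (σ : State) : Prop where
  r0 : σ.reg 0 = k
  r1 : σ.reg 1 = s
  r2 : σ.reg 2 = n
  r3 : σ.reg 3 = K
  r4 : σ.reg 4 = 1
  r5 : σ.reg 5 = 2
  r15 : σ.reg 15 = 0
  e0 : σ.rreg 0 = e
  e8 : σ.rreg 8 = 1
  e15 : σ.rreg 15 = 0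
  out : σ.rarr 0 = fun _ => 0

/-- The cells that `Env` speaks about. -/
def core (σ : State) :=
  ((σ.reg 0, σ.reg 1, σ.reg 2, σ.reg 3, σ.reg 4, σ.reg 5, σ.reg 15),
    (σ.rreg 0, σ.rreg 8, σ.rreg 15), σ.rarr 0)

/-- Instructions that write elsewhere leave `core` unchanged by definition, so the second hypothesis
is then `rfl`. -/
theorem Env.of_core {k s n K : ℕ} {e : ℝ} {σ σ' : State} (h : Env k s n K e σ)
    (h' : core σ' = core σ) : Env k s n K e σ' := by
  simp only [core, Prod.mk.injEq] at h'
  obtain ⟨⟨a0, a1, a2, a3, a4, a5, a15⟩, ⟨b0, b8, b15⟩, o⟩ := h'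
  exact ⟨a0.trans h.r0, a1.trans h.r1, a2.trans h.r2, a3.trans h.r3, a4.trans h.r4, a5.trans h.r5,
    a15.trans h.r15, b0.trans h.e0, b8.trans h.e8, b15.trans h.e15, o.trans h.out⟩

def setupProg : Prog :=
  .seq (block (.const 4 1) [.const 5 2, .op .add 6 0 4, .const 3 1, .rofNat 8 4])
    (.loop (.lt 3 6) (.atom (.op .mul 3 3 5)))

def countProg : Prog :=
  .seq (.atom (.const 7 0)) (.loop (.lt 7 2) (block (.load 0 8 7) [.load 2 9 8, .op .add 9 9 4,
    .store 2 8 9, .load 1 10 7, .load 3 9 8, .op .add 9 9 10, .store 3 8 9, .op .add 7 7 4]))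

/-- Register 12 counts the columns in use. Unused columns are skipped and keep the initial 0;
`.const 8 0` only fills the empty branch. -/
def signalProg : Prog :=
  .seq (block (.const 7 0) [.const 12 0]) (.loop (.lt 7 3) (.seq (block (.load 2 8 7) [.load 3 9 7])
    (.seq (.ite (.lt 15 8) (block (.rofNat 6 8) [.rofNat 7 9, .rop .add 7 7 7, .rop .div 7 7 6,
      .rop .sub 7 7 8, .rstore 1 7 7, .op .add 12 12 4]) (.atom (.const 8 0)))
      (.atom (.op .add 7 7 4)))))

/-- One round with half-block length in register 11. The results go to array 2, so that both inputs
of a butterfly remain available; `copyProg` moves them back. -/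
def butterflyProg : Prog :=
  .seq (.atom (.const 7 0)) (.loop (.lt 7 3) (.seq (block (.op .div 8 7 11) [.op .div 9 8 5,
    .op .mul 9 9 5, .op .sub 8 8 9, .rload 1 6 7])
    (.seq (.ite (.lt 15 8) (block (.op .sub 9 7 11) [.rload 1 7 9, .rop .sub 7 7 6])
      (block (.op .add 9 7 11) [.rload 1 7 9, .rop .add 7 6 7]))
      (block (.rstore 2 7 7) [.op .add 7 7 4]))))

def copyProg : Prog :=
  .seq (.atom (.const 7 0)) (.loop (.lt 7 3) (block (.rload 2 6 7) [.rstore 1 7 6, .op .add 7 7 4]))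

def walshProg : Prog :=
  .seq (.atom (.const 11 1)) (.loop (.lt 11 3)
    (.seq butterflyProg (.seq copyProg (.atom (.op .mul 11 11 5)))))

/-- Real register 1 receives the normalizing factor, real register 2 a sentinel below all possible
estimates. The leaf of `x` is cell `K + x` of array 3; leaves beyond `k` hold the sentinel. -/
def leavesProg : Prog :=
  .seq (block (.rop .add 6 0 8) [.rop .sub 7 0 8, .rofNat 1 12, .rop .mul 1 1 7, .rop .div 1 6 1,
      .rop .div 6 6 7, .rop .sub 2 15 6, .rop .sub 2 2 8, .const 7 0])
    (.loop (.lt 7 3) (.seq (.atom (.op .add 8 3 7))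
      (.seq (.ite (.lt 7 0) (block (.rload 1 6 7) [.rop .mul 6 1 6, .rstore 1 7 6, .rstore 3 8 6])
        (.atom (.rstore 3 8 2))) (.atom (.op .add 7 7 4)))))

def pullUpProg : Prog :=
  .seq (block (.op .mul 8 7 5) [.op .add 9 8 4, .rload 3 6 8, .rload 3 7 9])
    (.ite (.rle 6 7) (.atom (.rstore 3 7 7)) (.atom (.rstore 3 7 6)))

def buildProg : Prog :=
  .seq (.atom (.op .add 7 3 15)) (.loop (.lt 4 7) (.seq (.atom (.op .sub 7 7 4)) pullUpProg))

def descendProg : Prog :=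
  .seq (.atom (.const 7 1)) (.loop (.lt 7 3)
    (.seq (block (.op .mul 8 7 5) [.op .add 9 8 4, .rload 3 6 8, .rload 3 7 9])
      (.ite (.rle 7 6) (.atom (.op .add 7 8 15)) (.atom (.op .add 7 9 15)))))

def ascendProg : Prog :=
  .loop (.lt 4 7) (.seq (.atom (.op .div 7 7 5)) pullUpProg)

/-- Register 14 counts the rounds and register 13 the entries above the threshold; real registers 3
and 4 hold their sum and the threshold. A selected leaf is overwritten by the sentinel. -/
def selectProg : Prog :=
  .seq (block (.const 14 0) [.const 13 0, .rop .sub 3 15 15, .rop .add 4 2 15])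
    (.loop (.lt 14 1) (.seq descendProg (.seq (block (.rload 3 5 7) [.rstore 3 7 2])
      (.seq (.ite (.rle 5 4) (.atom (.const 10 0)) (block (.rop .add 3 3 5) [.op .add 13 13 4,
        .rofNat 6 13, .rop .sub 7 3 8, .rop .div 4 7 6]))
        (.seq ascendProg (.atom (.op .add 14 14 4)))))))

def outputProg : Prog :=
  .seq (.atom (.const 7 0)) (.loop (.lt 7 0) (.seq (block (.op .add 8 3 7) [.rload 3 6 8,
      .rload 1 7 7])
    (.seq (.ite (.rle 6 2) (.ite (.rle 4 7) (block (.rop .sub 7 7 4) [.rstore 0 7 7])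
      (.atom (.const 10 0))) (.atom (.const 10 0))) (.atom (.op .add 7 7 4)))))

/-- The server program: the Hadamard Response estimate by a fast Walsh-Hadamard transform, and its
sparse projection by selection with a tournament tree. -/
def serverProg : Prog :=
  .seq setupProg <| .seq countProg <| .seq signalProg <| .seq walshProg <| .seq leavesProg <|
  .seq buildProg <| .seq selectProg outputProg

attribute [local simp] FitsAll runAll Instr.run Instr.Fits ArithOp.evalNat ArithOp.evalReal
  Function.update_apply Test.Holds

theorem Reaches.atom {B : ℕ} {i : Instr} {Q : State → Prop} {σ : State} (hf : i.Fits B σ)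
    (hq : Q (i.run σ)) : Reaches B (.atom i) 1 Q σ :=
  ⟨1, le_rfl, _, .atom hf, hq⟩

variable {k s n m B : ℕ} {e : ℝ}

theorem reaches_setup (hk : k + 1 ≤ B) (h2 : 2 ≤ B) (hK : hadamardDim k ≤ B)
    (col : Fin n → ℕ) (y : Fin n → Bool) (ε : ℝ) :
    Reaches B setupProg (2 * hadamardLog k + 6) (fun σ => Env k s n (hadamardDim k) (Real.exp ε) σ ∧
      σ.arr = (serverInput k s n ε col y).arr ∧ σ.rarr = fun _ _ => 0)
      (serverInput k s n ε col y) := by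
  refine Reaches.mono (T₁ := 5 + (hadamardLog k * (1 + 1) + 1)) (Reaches.seq (Reaches.block
    (by simp [serverInput]; omega) ?_)) (by omega) (fun _ h => h)
  refine (Reaches.loop (fun N σ => ∃ a, a + N = hadamardLog k ∧ Env k s n (2 ^ a) (Real.exp ε) σ ∧
    σ.reg 6 = k + 1 ∧ σ.arr = (serverInput k s n ε col y).arr ∧ σ.rarr = fun _ _ => 0)
    ?_ (hadamardLog k) _ ⟨0, ?_⟩).mono le_rfl ?_
  · rintro N σ ⟨a, ha, he, h6, harr, hrarr⟩ hc
    simp only [Test.Holds, he.r3, h6] at hc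
    -- With no rounds left register 3 would be `2 ^ hadamardLog k`, which is at least `k + 1`, so
    -- the test would fail.
    have hNa : N ≠ 0 := by
      rintro rfl
      rw [add_zero] at ha
      subst ha
      exact absurd (Nat.le_pow_clog (b := 2) (by norm_num) (k + 1)) (not_le.2 hc)
    obtain ⟨M, rfl⟩ := Nat.exists_eq_succ_of_ne_zero hNa
    have hle : 2 ^ a * 2 ≤ 2 ^ hadamardLog k := by
      rw [← pow_succ]
      exact Nat.pow_le_pow_right (by norm_num) (by omega)
    refine ⟨M, rfl, Reaches.atom ?_ ⟨a + 1, by omega, ?_, ?_⟩⟩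
    · simp [he.r3, he.r5]
      exact hle.trans hK
    · exact ⟨he.r0, he.r1, he.r2, by simp [he.r3, he.r5, pow_succ], he.r4, he.r5, he.r15, he.e0,
        he.e8, he.e15, he.out⟩
    · exact ⟨h6, harr, hrarr⟩
  · refine ⟨by simp, ⟨rfl, rfl, rfl, rfl, rfl, rfl, rfl, rfl, ?_, rfl, rfl⟩, rfl, rfl, rfl⟩
    simp
  · rintro σ ⟨hc, N, a, ha, he, h6, harr, hrarr⟩
    simp only [Test.Holds, he.r3, h6, not_lt] at hc
    have : hadamardLog k ≤ a := Nat.clog_le_of_le_pow hc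
    obtain rfl : a = hadamardLog k := by omega
    exact ⟨he, harr, hrarr⟩

/-- Number of the first `i` users that are assigned to column `j`. -/
def colCount (c : ℕ → ℕ) (i j : ℕ) : ℕ := ∑ a ∈ Finset.range i, if c a = j then 1 else 0

/-- Sum of the messages of the first `i` users that are assigned to column `j`. -/
def onesCount (c b : ℕ → ℕ) (i j : ℕ) : ℕ := ∑ a ∈ Finset.range i, if c a = j then b a else 0

theorem colCount_le (c : ℕ → ℕ) (i j : ℕ) : colCount c i j ≤ i := by
  refine (Finset.sum_le_sum (g := fun _ => 1) fun a _ => ?_).trans (by simp)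
  split_ifs <;> omega

theorem onesCount_le (c : ℕ → ℕ) {b : ℕ → ℕ} (hb : ∀ i, b i ≤ 1) (i j : ℕ) :
    onesCount c b i j ≤ i := by
  refine (Finset.sum_le_sum (g := fun _ => 1) fun a _ => ?_).trans (by simp)
  have := hb a
  split_ifs <;> omega

theorem reaches_count {K : ℕ} (hn : n ≤ B) (c b : ℕ → ℕ) (hb : ∀ i, b i ≤ 1) (σ : State)
    (he : Env k s n K e σ) (h0 : σ.arr 0 = c) (h1 : σ.arr 1 = b) (h2 : σ.arr 2 = fun _ => 0)
    (h3 : σ.arr 3 = fun _ => 0) :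
    Reaches B countProg (10 * n + 2) (fun τ => Env k s n K e τ ∧ τ.arr 2 = colCount c n ∧
      τ.arr 3 = onesCount c b n ∧ τ.rarr = σ.rarr) σ := by
  refine Reaches.mono (T₁ := 1 + (n * (9 + 1) + 1)) (Reaches.seq (Reaches.atom (Nat.zero_le _)
    (Reaches.count (fun i τ => Env k s n K e τ ∧ τ.reg 7 = i ∧ τ.arr 0 = c ∧ τ.arr 1 = b ∧
      τ.arr 2 = colCount c i ∧ τ.arr 3 = onesCount c b i ∧ τ.rarr = σ.rarr) n ?_ ?_ _ ?_)))
    (by omega) fun τ h => ⟨h.1, h.2.2.2.2.1, h.2.2.2.2.2.1, h.2.2.2.2.2.2⟩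
  · rintro i τ - ⟨he, h7, -⟩
    simp [he.r2, h7]
  · rintro i τ hi ⟨he, h7, h0, h1, h2, h3, hr⟩
    have g1 := colCount_le c i (c i)
    have g2 := onesCount_le c hb i (c i)
    have g3 := hb i
    refine Reaches.block ?_ ⟨he.of_core rfl, ?_, h0, h1, ?_, ?_, hr⟩
    · simp [h7, h0, h1, h2, h3, he.r4]
      omega
    · simp [h7, he.r4]
    · funext j
      rw [colCount, Finset.sum_range_succ, ← colCount]
      by_cases hj : j = c i
      · simp [h7, h0, h2, he.r4, hj]
      · simp [h7, h0, h2, he.r4, hj, Ne.symm hj]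
    · funext j
      rw [onesCount, Finset.sum_range_succ, ← onesCount]
      by_cases hj : j = c i
      · simp [h7, h0, h1, h3, hj]
      · simp [h7, h0, h1, h3, hj, Ne.symm hj]
  · refine ⟨he.of_core rfl, rfl, h0, h1, h2.trans ?_, h3.trans ?_, rfl⟩ <;> funext j <;>
      simp [colCount, onesCount]

/-- `2 t̂_j - 1` on the columns in use. -/
def signal (K : ℕ) (cn on : ℕ → ℕ) (j : ℕ) : ℝ :=
  if j < K ∧ 0 < cn j then ((on j : ℝ) + on j) / cn j - 1 else 0

/-- Number of columns in use. -/
def usedCount (K : ℕ) (cn : ℕ → ℕ) : ℕ := ((Finset.range K).filter fun j => 0 < cn j).card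

theorem usedCount_le (K : ℕ) (cn : ℕ → ℕ) : usedCount K cn ≤ K :=
  (Finset.card_filter_le _ _).trans (by simp)

theorem usedCount_succ (K : ℕ) (cn : ℕ → ℕ) :
    usedCount (K + 1) cn = usedCount K cn + if 0 < cn K then 1 else 0 := by
  unfold usedCount
  rw [Finset.range_add_one, Finset.filter_insert]
  split_ifs
  · rw [Finset.card_insert_of_notMem (by simp)]
  · rfl

theorem reaches_signal {K : ℕ} (hK : K ≤ B) (cn on : ℕ → ℕ) (σ : State)
    (he : Env k s n K e σ) (h2 : σ.arr 2 = cn) (h3 : σ.arr 3 = on) (h1 : σ.rarr 1 = fun _ => 0) :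
    Reaches B signalProg (12 * K + 3) (fun τ => Env k s n K e τ ∧ τ.reg 12 = usedCount K cn ∧
      τ.rarr 1 = signal K cn on) σ := by
  -- The invariant is the final assertion with `i` in place of `K`: entries from `i` on still have
  -- their initial value 0.
  refine Reaches.mono (T₁ := 2 + (K * ((2 + ((7 + 1) + 1)) + 1) + 1)) (Reaches.seq (Reaches.block
    (by simp) (Reaches.count (fun i τ => Env k s n K e τ ∧ τ.reg 7 = i ∧ τ.arr 2 = cn ∧
      τ.arr 3 = on ∧ τ.reg 12 = usedCount i cn ∧ τ.rarr 1 = signal i cn on) K ?_ ?_ _ ?_)))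
    (by omega) fun τ h => ⟨h.1, h.2.2.2.2.1, h.2.2.2.2.2⟩
  · rintro i τ - ⟨he, h7, -⟩
    simp [he.r3, h7]
  · rintro i τ hi ⟨he, h7, h2, h3, h12, h1⟩
    have hu := usedCount_le i cn
    refine Reaches.seq (Reaches.block (by simp) ?_)
    refine Reaches.seq (Reaches.mono (Q := fun υ => Env k s n K e υ ∧ υ.reg 7 = i ∧ υ.arr 2 = cn ∧
      υ.arr 3 = on ∧ υ.reg 12 = usedCount (i + 1) cn ∧ υ.rarr 1 = signal (i + 1) cn on)
      (Reaches.ite ?_ ?_) le_rfl ?_)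
    · intro hc
      simp [h2, h7, he.r15] at hc
      refine Reaches.block ?_ ⟨he.of_core rfl, h7, h2, h3, ?_, ?_⟩
      · simp [h12, he.r4]; omega
      · simp [h12, he.r4, usedCount_succ, hc]
      · funext j
        simp [h7, h1, h2, h3, he.e8, signal]
        by_cases hj : j = i
        · simp [hj, hc]
        · simp [hj, show j ≤ i ↔ j < i by omega]
    · intro hc
      simp [h2, h7, he.r15] at hc
      refine (Reaches.atom ?_ ⟨he.of_core rfl, h7, h2, h3, ?_, ?_⟩).mono (T₁ := 1) (by omega)
        fun _ h => h
      · exact Nat.zero_le _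
      · simp [h12, usedCount_succ, hc]
      · funext j
        simp [h1, signal]
        by_cases hj : j = i
        · simp [hj, hc]
        · simp [show j ≤ i ↔ j < i by omega]
    · rintro υ ⟨he, h7, h2, h3, h12, h1⟩
      refine Reaches.atom (by simp [h7, he.r4]; omega) ⟨he.of_core rfl, by simp [h7, he.r4], h2, h3,
        h12, h1⟩
  · refine ⟨he.of_core rfl, rfl, h2, h3, ?_, ?_⟩
    · simp [usedCount]
    · refine h1.trans ?_
      funext j
      simp [signal]

/-- The butterfly partner of an index in a lower half stays inside the array. -/
theorem add_two_pow_lt {x b : ℕ} (hb : b < m) (hx : x < 2 ^ m) (h : x / 2 ^ b % 2 = 0) :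
    x + 2 ^ b < 2 ^ m := by
  obtain ⟨d, rfl⟩ := Nat.exists_eq_add_of_lt hb
  have hp : 0 < 2 ^ b := by positivity
  have e1 : 2 ^ (b + d + 1) = (2 * 2 ^ d) * 2 ^ b := by ring
  rw [e1] at hx ⊢
  have h1 := (Nat.div_lt_iff_lt_mul hp).2 hx
  rw [← Nat.div_lt_iff_lt_mul hp, Nat.add_div_right _ hp]
  omega

theorem reaches_butterfly (hB : 2 ^ m ≤ B) (f : ℕ → ℝ) (J b : ℕ) (hb : b < m) (σ : State)
    (he : Env k s n (2 ^ m) e σ) (h12 : σ.reg 12 = J) (h11 : σ.reg 11 = 2 ^ b)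
    (h1 : ∀ x < 2 ^ m, σ.rarr 1 x = walsh f b x) :
    Reaches B butterflyProg (12 * 2 ^ m + 2) (fun τ => Env k s n (2 ^ m) e τ ∧ τ.reg 12 = J ∧
      τ.reg 11 = 2 ^ b ∧ ∀ x < 2 ^ m, τ.rarr 2 x = walsh f (b + 1) x) σ := by
  refine Reaches.mono (T₁ := 1 + (2 ^ m * ((5 + ((3 + 1) + 2)) + 1) + 1)) (Reaches.seq
    (Reaches.atom (Nat.zero_le _) (Reaches.count (fun i τ => Env k s n (2 ^ m) e τ ∧ τ.reg 7 = i ∧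
      τ.reg 12 = J ∧ τ.reg 11 = 2 ^ b ∧ (∀ x < 2 ^ m, τ.rarr 1 x = walsh f b x) ∧
      ∀ x < i, τ.rarr 2 x = walsh f (b + 1) x) (2 ^ m) ?_ ?_ _ ?_)))
    (by omega) fun τ h => ⟨h.1, h.2.2.1, h.2.2.2.1, h.2.2.2.2.2⟩
  · rintro i τ - ⟨he, h7, -⟩
    simp [he.r3, h7]
  · rintro i τ hi ⟨he, h7, h12, h11, h1, h2⟩
    have hbit : i / 2 ^ b - i / 2 ^ b / 2 * 2 = i / 2 ^ b % 2 := by omega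
    have hdiv : i / 2 ^ b ≤ i := Nat.div_le_self _ _
    refine Reaches.seq (Reaches.block ?_ ?_)
    · simp [h7, h11, he.r5]; omega
    refine Reaches.seq (T₁ := 3 + 1) (T₂ := 2) (Reaches.mono (Q := fun υ => Env k s n (2 ^ m) e υ ∧ υ.reg 7 = i ∧
      υ.reg 12 = J ∧ υ.reg 11 = 2 ^ b ∧ (∀ x < 2 ^ m, υ.rarr 1 x = walsh f b x) ∧
      (∀ x < i, υ.rarr 2 x = walsh f (b + 1) x) ∧ υ.rreg 7 = walsh f (b + 1) i)
      (Reaches.ite ?_ ?_) le_rfl ?_)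
    · intro hc
      simp [h7, h11, he.r5, he.r15, hbit] at hc
      replace hc : i / 2 ^ b % 2 = 1 := by omega
      refine Reaches.block ?_ ⟨he.of_core rfl, h7, h12, h11, h1, h2, ?_⟩
      · simp [h7, h11]; omega
      · simp [h7, h11, h1 i hi, h1 (i - 2 ^ b) (by omega), walsh_succ_odd f hc]
    · intro hc
      simp [h7, h11, he.r5, he.r15, hbit] at hc
      have hlt := add_two_pow_lt hb hi hc
      refine Reaches.block ?_ ⟨he.of_core rfl, h7, h12, h11, h1, h2, ?_⟩
      · simp [h7, h11]; omega
      · simp [h7, h11, h1 i hi, h1 _ hlt, walsh_succ_even f hc]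
    · rintro υ ⟨he, h7, h12, h11, h1, h2, hr⟩
      refine Reaches.block (by simp [h7, he.r4]; omega) ⟨he.of_core rfl, by simp [h7, he.r4], h12,
        h11, h1, ?_⟩
      intro x hx
      simp [h7, hr]
      by_cases hxi : x = i
      · simp [hxi]
      · simp [hxi, h2 x (by omega)]
  · exact ⟨he.of_core rfl, rfl, h12, h11, h1, by simp⟩

theorem reaches_copy {K : ℕ} (hB : K ≤ B) (g : ℕ → ℝ) (J b : ℕ) (σ : State)
    (he : Env k s n K e σ) (h12 : σ.reg 12 = J) (h11 : σ.reg 11 = b)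
    (h2 : ∀ x < K, σ.rarr 2 x = g x) :
    Reaches B copyProg (4 * K + 2) (fun τ => Env k s n K e τ ∧ τ.reg 12 = J ∧
      τ.reg 11 = b ∧ ∀ x < K, τ.rarr 1 x = g x) σ := by
  refine Reaches.mono (T₁ := 1 + (K * (3 + 1) + 1)) (Reaches.seq
    (Reaches.atom (Nat.zero_le _) (Reaches.count (fun i τ => Env k s n K e τ ∧ τ.reg 7 = i ∧
      τ.reg 12 = J ∧ τ.reg 11 = b ∧ (∀ x < K, τ.rarr 2 x = g x) ∧
      ∀ x < i, τ.rarr 1 x = g x) K ?_ ?_ _ ?_)))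
    (by omega) fun τ h => ⟨h.1, h.2.2.1, h.2.2.2.1, h.2.2.2.2.2⟩
  · rintro i τ - ⟨he, h7, -⟩
    simp [he.r3, h7]
  · rintro i τ hi ⟨he, h7, h12, h11, h2, h1⟩
    refine Reaches.block (by simp [h7, he.r4]; omega) ⟨he.of_core rfl, by simp [h7, he.r4], h12,
      h11, h2, ?_⟩
    intro x hx
    simp [h7]
    by_cases hxi : x = i
    · simp [hxi, h2 i hi]
    · simp [hxi, h1 x (by omega)]
  · exact ⟨he.of_core rfl, rfl, h12, h11, h2, by simp⟩

theorem reaches_walsh (hB : 2 ^ m ≤ B) (f : ℕ → ℝ) (J : ℕ) (σ : State)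
    (he : Env k s n (2 ^ m) e σ) (h12 : σ.reg 12 = J) (h1 : σ.rarr 1 = f) :
    Reaches B walshProg (m * (16 * 2 ^ m + 6) + 2) (fun τ => Env k s n (2 ^ m) e τ ∧
      τ.reg 12 = J ∧ ∀ x < 2 ^ m, τ.rarr 1 x = walsh f m x) σ := by
  have h1B : 1 ≤ B := le_trans Nat.one_le_two_pow hB
  refine Reaches.mono (T₁ := 1 + (m * (((12 * 2 ^ m + 2) + ((4 * 2 ^ m + 2) + 1)) + 1) + 1))
    (Reaches.seq (Reaches.atom (by simpa using h1B) (Reaches.count (fun b τ => Env k s n (2 ^ m) e τ ∧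
      τ.reg 12 = J ∧ τ.reg 11 = 2 ^ b ∧ ∀ x < 2 ^ m, τ.rarr 1 x = walsh f b x) m ?_ ?_ _ ?_)))
    (le_of_eq (by ring)) fun τ h => ⟨h.1, h.2.1, h.2.2.2⟩
  · rintro b τ - ⟨he, h12, h11, -⟩
    simp [he.r3, h11, Nat.pow_lt_pow_iff_right]
  · rintro b τ hb ⟨he, h12, h11, h1⟩
    refine Reaches.seq ((reaches_butterfly hB f J b hb τ he h12 h11 h1).mono le_rfl ?_)
    rintro τ ⟨he, h12, h11, h2⟩
    refine Reaches.seq ((reaches_copy hB _ J _ τ he h12 h11 h2).mono le_rfl ?_)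
    rintro τ ⟨he, h12, h11, h1⟩
    refine Reaches.atom ?_ ⟨he.of_core rfl, h12, ?_, h1⟩
    · have : 2 ^ (b + 1) ≤ 2 ^ m := Nat.pow_le_pow_right (by norm_num) hb
      simp [h11, he.r5, ← pow_succ]
      omega
    · simp [h11, he.r5, pow_succ]
  · refine ⟨he.of_core rfl, h12, rfl, fun x _ => ?_⟩
    rw [walsh_zero]
    exact congrFun h1 x

end SparseLDP
end

/-! ### Correctness of the tournament tree, the selection and the output -/

noncomputable section

namespace SparseLDP

attribute [local simp] FitsAll runAll Instr.run Instr.Fits ArithOp.evalNat ArithOp.evalReal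
  Function.update_apply Test.Holds

variable {k s n m B : ℕ} {e : ℝ}

theorem reaches_leaves {K : ℕ} (hB : 2 * K ≤ B) (F : ℕ → ℝ) (J : ℕ) (σ : State)
    (he : Env k s n K e σ) (h12 : σ.reg 12 = J) (h1 : ∀ x < K, σ.rarr 1 x = F x) (b c : ℝ)
    (hb : b = 0 - (e + 1) / (e - 1) - 1) (hc : c = (e + 1) / (J * (e - 1))) :
    Reaches B leavesProg (8 * K + 10) (fun τ => Env k s n K e τ ∧ τ.rreg 2 = b ∧
      (∀ x < K, x < k → τ.rarr 1 x = c * F x) ∧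
      ∀ x < K, τ.rarr 3 (K + x) = if x < k then c * F x else b) σ := by
  refine Reaches.mono (T₁ := 9 + (K * ((1 + ((4 + 1) + 1)) + 1) + 1)) (Reaches.seq (Reaches.block
    (by simp) (Reaches.count (fun i τ => Env k s n K e τ ∧ τ.reg 7 = i ∧ τ.rreg 1 = c ∧
      τ.rreg 2 = b ∧ (∀ x < K, i ≤ x → τ.rarr 1 x = F x) ∧
      (∀ x < i, x < k → τ.rarr 1 x = c * F x) ∧
      ∀ x < i, τ.rarr 3 (K + x) = if x < k then c * F x else b) K ?_ ?_ _ ?_)))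
    (by omega) fun τ h => ⟨h.1, h.2.2.2.1, h.2.2.2.2.2.1, h.2.2.2.2.2.2⟩
  · rintro i τ - ⟨he, h7, -⟩
    simp [he.r3, h7]
  · rintro i τ hi ⟨he, h7, hc, hb, hF, h1, h3⟩
    refine Reaches.seq (T₁ := 1) (T₂ := (4 + 1) + 1) (Reaches.atom (by simp [he.r3, h7]; omega) ?_)
    refine Reaches.seq (T₁ := 4 + 1) (T₂ := 1) (Reaches.mono (Q := fun υ => Env k s n K e υ ∧
      υ.reg 7 = i ∧ υ.rreg 1 = c ∧ υ.rreg 2 = b ∧ (∀ x < K, i + 1 ≤ x → υ.rarr 1 x = F x) ∧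
      (∀ x < i + 1, x < k → υ.rarr 1 x = c * F x) ∧
      ∀ x < i + 1, υ.rarr 3 (K + x) = if x < k then c * F x else b)
      (Reaches.ite ?_ ?_) le_rfl ?_)
    · intro hik
      simp [h7, he.r0] at hik
      refine Reaches.block (by simp) ⟨he.of_core rfl, h7, hc, hb, ?_, ?_, ?_⟩
      · intro x hx hix
        simp [h7, show x ≠ i by omega, hF x hx (by omega)]
      · intro x hx hxk
        by_cases hxi : x = i
        · simp [h7, hxi, hc, hF i hi le_rfl]
        · simp [h7, hxi, h1 x (by omega) hxk]
      · intro x hx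
        by_cases hxi : x = i
        · simp [h7, he.r3, hxi, hc, hF i hi le_rfl, hik]
        · simp [h7, he.r3, hxi, h3 x (by omega)]
    · intro hik
      simp [h7, he.r0] at hik
      refine Reaches.mono (T₁ := 1) (Reaches.atom trivial ⟨he.of_core rfl, h7, hc, hb,
        fun x hx hix => hF x hx (by omega), fun x hx hxk => h1 x (by omega) hxk, ?_⟩) (by omega)
        fun _ h => h
      intro x hx
      by_cases hxi : x = i
      · simp [h7, he.r3, hxi, hb, not_lt.2 hik]
      · simp [h7, he.r3, hxi, h3 x (by omega)]
    · rintro υ ⟨he, h7, hc, hb, hF, h1, h3⟩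
      exact Reaches.atom (by simp [h7, he.r4]; omega) ⟨he.of_core rfl, by simp [h7, he.r4], hc, hb,
        hF, h1, h3⟩
  · refine ⟨he.of_core rfl, rfl, ?_, ?_, fun x hx _ => h1 x hx, by simp, by simp⟩
    · simp [he.e0, he.e8, h12, hc]
    · simp [he.e0, he.e8, he.e15, hb]

/-- `τ` differs from `σ` only in the registers and the array used to update the tree. -/
structure TreeFrame (σ τ : State) : Prop where
  reg : ∀ r, r ≠ 7 → r ≠ 8 → r ≠ 9 → τ.reg r = σ.reg r
  rreg : ∀ r, r ≠ 6 → r ≠ 7 → τ.rreg r = σ.rreg r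
  rarr : ∀ A, A ≠ 3 → τ.rarr A = σ.rarr A

theorem TreeFrame.refl (σ : State) : TreeFrame σ σ := ⟨by simp, by simp, by simp⟩

theorem TreeFrame.trans {σ τ υ : State} (h : TreeFrame σ τ) (h' : TreeFrame τ υ) :
    TreeFrame σ υ where
  reg r h1 h2 h3 := (h'.reg r h1 h2 h3).trans (h.reg r h1 h2 h3)
  rreg r h1 h2 := (h'.rreg r h1 h2).trans (h.rreg r h1 h2)
  rarr A h1 := (h'.rarr A h1).trans (h.rarr A h1)

theorem Env.of_frame {K : ℕ} {σ τ : State} (h : Env k s n K e σ) (h' : TreeFrame σ τ) :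
    Env k s n K e τ := by
  refine h.of_core ?_
  simp [core, h'.reg, h'.rreg, h'.rarr]

theorem reaches_pullUp {i K : ℕ} (σ : State) (he : Env k s n K e σ) (h7 : σ.reg 7 = i)
    (hi : i < K) (hB : 2 * K ≤ B) :
    Reaches B pullUpProg 6 (fun τ => TreeFrame σ τ ∧ τ.reg 7 = i ∧ τ.rarr 3 =
      Function.update (σ.rarr 3) i (max (σ.rarr 3 (2 * i)) (σ.rarr 3 (2 * i + 1)))) σ := by
  refine Reaches.seq (T₁ := 4) (T₂ := 2) (Reaches.block ?_ ?_)
  · simp [h7, he.r4, he.r5]; omega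
  refine Reaches.ite (T := 1) ?_ ?_ <;> intro hc <;> simp [h7, he.r4, he.r5, mul_comm i] at hc <;>
    refine Reaches.atom trivial ⟨⟨?_, ?_, ?_⟩, h7, ?_⟩
  · intro r h1 h2 h3; simp [h2, h3]
  · intro r h1 h2; simp [h1, h2]
  · intro A h1; simp [h1]
  · simp [h7, he.r4, he.r5, mul_comm i, max_eq_right hc]
  · intro r h1 h2 h3; simp [h2, h3]
  · intro r h1 h2; simp [h1, h2]
  · intro A h1; simp [h1]
  · simp [h7, he.r4, he.r5, mul_comm i, max_eq_left hc.le]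

/-- Nodes are filled from `K - 1` down to 1, so both children are final when a node is computed. -/
theorem reaches_build {K : ℕ} (hK : 1 ≤ K) (hB : 2 * K ≤ B) (σ : State) (he : Env k s n K e σ) :
    Reaches B buildProg (8 * K + 2) (fun τ => TreeFrame σ τ ∧ IsMaxTree K (τ.rarr 3) ∧
      ∀ j, K ≤ j → τ.rarr 3 j = σ.rarr 3 j) σ := by
  refine Reaches.mono (T₁ := 1 + ((K - 1) * ((1 + 6) + 1) + 1)) (Reaches.seq (Reaches.atom
    (by simp [he.r3, he.r15]; omega) ((Reaches.loop (fun N τ => TreeFrame σ τ ∧ τ.reg 7 = N + 1 ∧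
      N + 1 ≤ K ∧ (∀ j, N + 1 ≤ j → j < K → τ.rarr 3 j = max (τ.rarr 3 (2 * j))
        (τ.rarr 3 (2 * j + 1))) ∧
      ∀ j, K ≤ j → τ.rarr 3 j = σ.rarr 3 j) ?_ (K - 1) _ ?_).mono le_rfl ?_))) (by omega)
      (fun _ h => h)
  · rintro N τ ⟨hf, h7, hN, ht, hl⟩ hc
    have he' := he.of_frame hf
    simp [he'.r4, h7] at hc
    obtain ⟨M, rfl⟩ := Nat.exists_eq_succ_of_ne_zero hc.ne'
    refine ⟨M, rfl, Reaches.seq (Reaches.atom (by simp [h7, he'.r4]; omega) ?_)⟩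
    refine (reaches_pullUp (i := M + 1) (Instr.run τ (.op .sub 7 7 4)) (he'.of_core rfl) ?_ (by omega)
      hB).mono le_rfl ?_
    · simp [h7, he'.r4]
    rintro υ ⟨hf', h7', hw⟩
    refine ⟨hf.trans (TreeFrame.trans ⟨?_, ?_, ?_⟩ hf'), h7', by omega, ?_, ?_⟩
    · intro r h1 h2 h3; simp [h1]
    · intro r h1 h2; simp
    · intro A h1; simp
    · intro j hj hjK
      rw [hw]
      by_cases hjM : j = M + 1
      · subst hjM
        simp [show 2 * (M + 1) ≠ M + 1 by omega, show 2 * (M + 1) ≠ M by omega]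
      · simp [hjM, show 2 * j ≠ M + 1 by omega, show 2 * j ≠ M by omega,
          ht j (by omega) hjK]
    · intro j hj
      rw [hw]
      simp [show j ≠ M + 1 by omega, hl j hj]
  · refine ⟨⟨?_, ?_, ?_⟩, ?_, by omega, ?_, ?_⟩
    · intro r h1 h2 h3; simp [h1]
    · intro r h1 h2; simp
    · intro A h1; simp
    · simp [he.r3, he.r15]; omega
    · intro j hj hjK; omega
    · intro j hj; rfl
  · rintro τ ⟨hc, N, hf, h7, hN, ht, hl⟩
    simp [(he.of_frame hf).r4, h7] at hc
    subst hc
    exact ⟨hf, fun i h1 h2 => ht i (by omega) h2, hl⟩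

/-- Moving to a larger child keeps the value of the root. The condition `2 ^ m ≤ τ.reg 7 * 2 ^ N`
expresses that at most `N` levels remain. -/
theorem reaches_descend (hB : 2 * 2 ^ m ≤ B) (σ : State) (he : Env k s n (2 ^ m) e σ)
    (ht : IsMaxTree (2 ^ m) (σ.rarr 3)) :
    Reaches B descendProg (7 * m + 2) (fun τ => TreeFrame σ τ ∧ τ.rarr 3 = σ.rarr 3 ∧
      2 ^ m ≤ τ.reg 7 ∧ τ.reg 7 < 2 * 2 ^ m ∧ σ.rarr 3 (τ.reg 7) = σ.rarr 3 1) σ := by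
  have hm : 1 ≤ 2 ^ m := Nat.one_le_two_pow
  refine Reaches.mono (T₁ := 1 + (m * ((4 + (1 + 1)) + 1) + 1)) (Reaches.seq (Reaches.atom
    (by simp; omega) ((Reaches.loop (fun N τ => TreeFrame σ τ ∧ τ.rarr 3 = σ.rarr 3 ∧
      2 ^ m ≤ τ.reg 7 * 2 ^ N ∧ 1 ≤ τ.reg 7 ∧ τ.reg 7 < 2 * 2 ^ m ∧
      σ.rarr 3 (τ.reg 7) = σ.rarr 3 1) ?_ m _ ?_).mono le_rfl ?_))) (by omega)
      (fun _ h => h)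
  · rintro N τ ⟨hf, h3, hN, h71, h7, hv⟩ hc
    have he' := he.of_frame hf
    simp [he'.r3] at hc
    have hN0 : N ≠ 0 := by
      rintro rfl
      simp at hN
      omega
    obtain ⟨M, rfl⟩ := Nat.exists_eq_succ_of_ne_zero hN0
    have hM : 2 ^ m ≤ 2 * τ.reg 7 * 2 ^ M := by
      rw [pow_succ] at hN
      linarith
    have hM' : 2 ^ m ≤ (2 * τ.reg 7 + 1) * 2 ^ M := hM.trans (Nat.mul_le_mul_right _ (by omega))
    have hmax := ht _ h71 hc
    refine ⟨M, rfl, Reaches.seq (Reaches.block (by simp [he'.r4, he'.r5]; omega) ?_)⟩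
    refine Reaches.ite (T := 1) ?_ ?_ <;> intro hcc <;>
      simp [he'.r4, he'.r5, mul_comm _ 2, h3] at hcc <;>
      refine Reaches.atom (by simp [he'.r4, he'.r5, he'.r15]; omega)
        ⟨hf.trans ⟨?_, ?_, ?_⟩, h3, ?_, ?_, ?_, ?_⟩
    · intro r h1 h2 h3; simp [h1, h2, h3]
    · intro r h1 h2; simp [h1, h2]
    · intro A h1; simp
    · simpa [he'.r5, he'.r15, mul_comm _ 2] using hM
    · simp [he'.r5, he'.r15]; omega
    · simp [he'.r5, he'.r15]; omega
    · simp [he'.r5, he'.r15, mul_comm _ 2]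
      rw [← hv, hmax, max_eq_left hcc]
    · intro r h1 h2 h3; simp [h1, h2, h3]
    · intro r h1 h2; simp [h1, h2]
    · intro A h1; simp
    · simpa [he'.r4, he'.r5, he'.r15, mul_comm _ 2] using hM'
    · simp [he'.r4, he'.r5, he'.r15]
    · simp [he'.r4, he'.r5, he'.r15]; omega
    · simp [he'.r4, he'.r5, he'.r15, mul_comm _ 2]
      rw [← hv, hmax, max_eq_right hcc.le]
  · refine ⟨⟨?_, ?_, ?_⟩, rfl, by simp, le_rfl, by simp; omega, rfl⟩
    · intro r h1 h2 h3; simp [h1]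
    · intro r h1 h2; simp
    · intro A h1; simp
  · rintro τ ⟨hc, N, hf, h3, hN, h71, h7, hv⟩
    simp [(he.of_frame hf).r3] at hc
    exact ⟨hf, h3, hc, h7, hv⟩

/-- Only the parent of the current node may violate the maximum property. Repairing it moves the
possible violation one level up; at the root the parent index is 0, which is no node. -/
theorem reaches_ascend (hB : 2 * 2 ^ m ≤ B) (σ : State) (he : Env k s n (2 ^ m) e σ)
    (h71 : 1 ≤ σ.reg 7) (h72 : σ.reg 7 < 2 * 2 ^ m)
    (ht : ∀ j, 1 ≤ j → j < 2 ^ m → j ≠ σ.reg 7 / 2 →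
      σ.rarr 3 j = max (σ.rarr 3 (2 * j)) (σ.rarr 3 (2 * j + 1))) :
    Reaches B ascendProg (8 * m + 1) (fun τ => TreeFrame σ τ ∧ IsMaxTree (2 ^ m) (τ.rarr 3) ∧
      ∀ j, 2 ^ m ≤ j → τ.rarr 3 j = σ.rarr 3 j) σ := by
  refine Reaches.mono (T₁ := m * ((1 + 6) + 1) + 1) ((Reaches.loop (fun N τ => TreeFrame σ τ ∧
    1 ≤ τ.reg 7 ∧ τ.reg 7 < 2 * 2 ^ N ∧ N ≤ m ∧
    (∀ j, 1 ≤ j → j < 2 ^ m → j ≠ τ.reg 7 / 2 →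
      τ.rarr 3 j = max (τ.rarr 3 (2 * j)) (τ.rarr 3 (2 * j + 1))) ∧
    ∀ j, 2 ^ m ≤ j → τ.rarr 3 j = σ.rarr 3 j) ?_ m _ ?_).mono le_rfl ?_) (by omega)
      (fun _ h => h)
  · rintro N τ ⟨hf, h71, h72, hNm, ht, hl⟩ hc
    have he' := he.of_frame hf
    simp [he'.r4] at hc
    have hN0 : N ≠ 0 := by
      rintro rfl
      simp at h72
      omega
    obtain ⟨M, rfl⟩ := Nat.exists_eq_succ_of_ne_zero hN0
    have hpow : 2 ^ (M + 1) ≤ 2 ^ m := Nat.pow_le_pow_right (by norm_num) hNm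
    have hp : τ.reg 7 / 2 < 2 ^ (M + 1) := by omega
    refine ⟨M, rfl, Reaches.seq (Reaches.atom (by simp [he'.r5]; omega) ?_)⟩
    refine (reaches_pullUp (i := τ.reg 7 / 2) (Instr.run τ (.op .div 7 7 5)) (he'.of_core rfl) ?_
      (by omega) hB).mono le_rfl ?_
    · simp [he'.r5]
    rintro υ ⟨hf', h7', hw⟩
    refine ⟨hf.trans (TreeFrame.trans ⟨?_, ?_, ?_⟩ hf'), by omega, by rw [pow_succ] at hp; omega,
      by omega, ?_, ?_⟩
    · intro r h1 h2 h3; simp [h1]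
    · intro r h1 h2; simp
    · intro A h1; simp
    · intro j hj hjK hj7
      rw [h7'] at hj7
      rw [hw]
      by_cases hji : j = τ.reg 7 / 2
      · subst hji
        simp [show 2 * (τ.reg 7 / 2) ≠ τ.reg 7 / 2 by omega,
          show 2 * (τ.reg 7 / 2) + 1 ≠ τ.reg 7 / 2 by omega]
      · simp [hji, show 2 * j ≠ τ.reg 7 / 2 by omega, show 2 * j + 1 ≠ τ.reg 7 / 2 by omega,
          ht j hj hjK hji]
    · intro j hj
      rw [hw]
      simp [show j ≠ τ.reg 7 / 2 by omega, hl j hj]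
  · exact ⟨TreeFrame.refl σ, h71, h72, le_rfl, ht, fun _ _ => rfl⟩
  · rintro τ ⟨hc, N, hf, h71, h72, hNm, ht, hl⟩
    simp [(he.of_frame hf).r4] at hc
    exact ⟨hf, fun i h1 h2 => ht i h1 h2 (by omega), hl⟩

/-- State of the selection of the largest entries after `t` rounds. -/
structure Selecting (k s n m : ℕ) (e : ℝ) (v : ℕ → ℝ) (b : ℝ) (t : ℕ) (T A : Finset ℕ)
    (σ : State) : Prop where
  env : Env k s n (2 ^ m) e σ
  r14 : σ.reg 14 = t
  bound : σ.rreg 2 = b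
  val : ∀ x < k, σ.rarr 1 x = v x
  sel : Selection k v b T A (σ.rreg 4)
  card : T.card = t
  r13 : σ.reg 13 = A.card
  sum : σ.rreg 3 = ∑ x ∈ A, v x
  tree : IsMaxTree (2 ^ m) (σ.rarr 3)
  leaf : ∀ x < 2 ^ m, σ.rarr 3 (2 ^ m + x) = if x < k ∧ x ∉ T then v x else b

/-- In each round the descent finds a largest unselected entry. The test against the threshold
chooses between `Selection.skip` and `Selection.take`, and the ascent restores the tree after the
leaf has been erased. -/
theorem reaches_select (hkm : k < 2 ^ m) (hsk : s ≤ k) (hB : 2 * 2 ^ m ≤ B) (v : ℕ → ℝ) (b : ℝ)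
    (hv : ∀ x < k, b < v x) (σ : State) (he : Env k s n (2 ^ m) e σ) (h2 : σ.rreg 2 = b)
    (h1 : ∀ x < k, σ.rarr 1 x = v x) (ht : IsMaxTree (2 ^ m) (σ.rarr 3))
    (hl : ∀ x < 2 ^ m, σ.rarr 3 (2 ^ m + x) = if x < k then v x else b) :
    Reaches B selectProg (s * (15 * m + 13) + 5)
      (fun τ => ∃ T A, Selecting k s n m e v b s T A τ) σ := by
  refine Reaches.mono (T₁ := 4 + (s * (((7 * m + 2) + (2 + ((5 + 1) + ((8 * m + 1) + 1)))) + 1) + 1))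
    (Reaches.seq (Reaches.block (by simp) (Reaches.count
      (fun t τ => ∃ T A, Selecting k s n m e v b t T A τ) s ?_ ?_ _ ?_)))
    (le_of_eq (by ring)) fun τ h => h
  · rintro t τ - ⟨T, A, h⟩
    simp [h.env.r1, h.r14]
  · rintro t τ hts ⟨T, A, h⟩
    have hAt : A.card ≤ t := h.card ▸ Finset.card_le_card h.sel.sub
    refine Reaches.seq ((reaches_descend hB τ h.env h.tree).mono le_rfl ?_)
    rintro υ ⟨hf, h3, h7l, h7u, hmax⟩
    have heυ := h.env.of_frame hf
    obtain ⟨x, hx⟩ := Nat.exists_eq_add_of_le h7l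
    have hxm : x < 2 ^ m := by omega
    -- the leaf reached is a remaining entry, and a largest one
    have hle : ∀ y < k, y ∉ T → v y ≤ υ.rarr 3 (υ.reg 7) := by
      intro y hy hyT
      have h1 := h.tree.le_root (2 ^ m + y) (by omega) (by omega)
      rw [h.leaf y (by omega), if_pos ⟨hy, hyT⟩] at h1
      rwa [h3, hmax]
    -- Since `t < s ≤ k`, some entry is unselected; it exceeds `b`, so the maximum is not a
    -- sentinel.
    obtain ⟨y, hyk, hyT⟩ : ∃ y < k, y ∉ T := by
      by_contra! hcon
      have : Finset.range k ⊆ T := fun y hy => hcon y (Finset.mem_range.1 hy)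
      have := Finset.card_le_card this
      rw [Finset.card_range, h.card] at this
      omega
    have hleaf : x < k ∧ x ∉ T := by
      by_contra hcon
      have := hle y hyk hyT
      rw [h3, hx, h.leaf x hxm, if_neg hcon] at this
      exact absurd (hv y hyk) (not_lt.2 this)
    have hval : υ.rarr 3 (υ.reg 7) = v x := by rw [h3, hx, h.leaf x hxm, if_pos hleaf]
    rw [hval] at hle
    refine Reaches.seq (Reaches.block (by simp) ?_)
    refine Reaches.seq (T₁ := 5 + 1) (Reaches.mono (Q := fun ω => ∃ A, Env k s n (2 ^ m) e ω ∧
      ω.reg 14 = t ∧ ω.rreg 2 = b ∧ (∀ x < k, ω.rarr 1 x = v x) ∧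
      Selection k v b (insert x T) A (ω.rreg 4) ∧ ω.reg 13 = A.card ∧ ω.rreg 3 = ∑ x ∈ A, v x ∧
      ω.rarr 3 = Function.update (τ.rarr 3) (2 ^ m + x) b ∧ ω.reg 7 = 2 ^ m + x)
      (Reaches.ite ?_ ?_) le_rfl ?_)
    · intro hc
      simp [hval, hf.rreg] at hc
      refine Reaches.mono (T₁ := 1) (Reaches.atom (Nat.zero_le _) ⟨A, heυ.of_core rfl, ?_, ?_, ?_,
        ?_, ?_, ?_, ?_, hx⟩) (by omega) fun _ h => h
      · simp [hf.reg, h.r14]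
      · simp [hf.rreg, h.bound]
      · simpa [hf.rarr] using h.val
      · simpa [hf.rreg] using h.sel.skip hleaf.1 hleaf.2 (hv x hleaf.1) hle hc
      · simp [hf.reg, h.r13]
      · simp [hf.rreg, h.sum]
      · simp [h3, hf.rreg, h.bound, hx]
    · intro hc
      simp [hval, hf.rreg] at hc
      have hxA : x ∉ A := fun hh => hleaf.2 (h.sel.sub hh)
      refine Reaches.block ?_ ⟨insert x A, heυ.of_core rfl, ?_, ?_, ?_, ?_, ?_, ?_, ?_, hx⟩
      · simp [hf.reg, h.r13, h.env.r4]
        omega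
      · simp [hf.reg, h.r14]
      · simp [hf.rreg, h.bound]
      · simpa [hf.rarr] using h.val
      · convert h.sel.take hleaf.1 hleaf.2 hle hc using 1
        simp [hf.reg, hf.rreg, hval, h.sum, h.r13, h.env.r4, h.env.e8, Finset.sum_insert hxA,
          Finset.card_insert_of_notMem hxA, add_comm]
      · simp [hf.reg, h.r13, h.env.r4, Finset.card_insert_of_notMem hxA]
      · simp [hf.rreg, hval, h.sum, Finset.sum_insert hxA, add_comm]
      · simp [h3, hf.rreg, h.bound, hx]
    · rintro ω ⟨A', heω, h14, h2, h1, hsel, h13, hS, hw, h7⟩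
      refine Reaches.seq ((reaches_ascend hB ω heω (by omega) (by omega) ?_).mono le_rfl ?_)
      · intro j hj hjm hj7
        rw [hw]
        rw [h7] at hj7
        simp [show j ≠ 2 ^ m + x by omega, show 2 * j ≠ 2 ^ m + x by omega,
          show 2 * j + 1 ≠ 2 ^ m + x by omega, h.tree j hj hjm]
      · rintro ξ ⟨hf', htree, hl⟩
        have heξ := heω.of_frame hf'
        refine Reaches.atom ?_ ⟨insert x T, A', heξ.of_core rfl, ?_, ?_, ?_, ?_, ?_, ?_, ?_, ?_, ?_⟩
        · simp [hf'.reg, h14, heω.r4]; omega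
        · simp [hf'.reg, h14, heω.r4]
        · simp [hf'.rreg, h2]
        · simpa [hf'.rarr] using h1
        · simpa [hf'.rreg] using hsel
        · rw [Finset.card_insert_of_notMem hleaf.2, h.card]
        · simp [hf'.reg, h13]
        · simp [hf'.rreg, hS]
        · exact htree
        · intro z hz
          simp only [Instr.run]
          rw [hl _ (by omega), hw]
          by_cases hzx : z = x
          · simp [hzx]
          · simp [hzx, h.leaf z hz]
  · refine ⟨∅, ∅, he.of_core rfl, rfl, h2, h1, ⟨by simp, by simp, by simp, by simp, by simp,
      .inl ⟨rfl, rfl, ?_⟩⟩, rfl, rfl, ?_, ht, by simpa using hl⟩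
    · simp [h2, he.e15]
    · simp [he.e15]

/-- Membership in `T` is read off the leaves: exactly the selected ones below index `k` hold the
sentinel. All other output cells keep the initial 0. -/
theorem reaches_output (hkm : k < 2 ^ m) (hB : 2 * 2 ^ m ≤ B) (v : ℕ → ℝ) (b : ℝ)
    (hv : ∀ x < k, b < v x) (T A : Finset ℕ) (σ : State) (h : Selecting k s n m e v b s T A σ) :
    Reaches B outputProg (9 * k + 2)
      (fun τ => ∀ x < k, τ.rarr 0 x = if x ∈ T ∧ σ.rreg 4 ≤ v x then v x - σ.rreg 4 else 0) σ := by
  have hkB : k ≤ B := by omega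
  refine Reaches.mono (T₁ := 1 + (k * ((3 + (((2 + 1) + 1) + 1)) + 1) + 1)) (Reaches.seq
    (Reaches.atom (Nat.zero_le _) (Reaches.count (fun i τ => τ.reg 7 = i ∧ τ.reg 0 = k ∧
      τ.reg 3 = 2 ^ m ∧ τ.reg 4 = 1 ∧ τ.rreg 2 = b ∧ τ.rreg 4 = σ.rreg 4 ∧
      τ.rarr 1 = σ.rarr 1 ∧ τ.rarr 3 = σ.rarr 3 ∧ τ.rarr 0 = fun x =>
        if x < i ∧ x ∈ T ∧ σ.rreg 4 ≤ v x then v x - σ.rreg 4 else 0) k ?_ ?_ _ ?_)))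
    (by omega) fun τ hτ x hx => ?_
  · rintro i τ - ⟨h7, h0, -⟩
    simp [h7, h0]
  · rintro i τ hi ⟨h7, h0, h3, h4, hb, hτ, h1, hw, ho⟩
    have hleaf := h.leaf i (by omega)
    have hbi := hv i hi
    refine Reaches.seq (Reaches.block (by simp [h7, h3]; omega) ?_)
    refine Reaches.seq (T₁ := (2 + 1) + 1) (T₂ := 1) (Reaches.mono (Q := fun υ => υ.reg 7 = i ∧
      υ.reg 0 = k ∧ υ.reg 3 = 2 ^ m ∧ υ.reg 4 = 1 ∧ υ.rreg 2 = b ∧ υ.rreg 4 = σ.rreg 4 ∧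
      υ.rarr 1 = σ.rarr 1 ∧ υ.rarr 3 = σ.rarr 3 ∧ υ.rarr 0 = fun x =>
        if x < i + 1 ∧ x ∈ T ∧ σ.rreg 4 ≤ v x then v x - σ.rreg 4 else 0)
      (Reaches.ite (T := 2 + 1) ?_ ?_) le_rfl ?_)
    · intro hc
      have hiT : i ∈ T := by
        by_contra hiT
        simp [h7, h3, hw, hleaf, hb, hi, hiT] at hc
        linarith
      refine Reaches.ite (T := 2) ?_ ?_ <;> intro hcc <;>
        simp [h7, h1, h.val i hi, hτ] at hcc
      · refine Reaches.block (by simp) ⟨h7, h0, h3, h4, hb, hτ, h1, hw, ?_⟩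
        funext x
        by_cases hxi : x = i
        · simp [h7, h1, h.val i hi, hτ, hxi, hiT, hcc]
        · simp [h7, ho, hxi, show x ≤ i ↔ x < i by omega]
      · refine Reaches.mono (T₁ := 1) (Reaches.atom (Nat.zero_le _)
          ⟨h7, h0, h3, h4, hb, hτ, h1, hw, ?_⟩) (by omega) fun _ h => h
        funext x
        by_cases hxi : x = i
        · simp [ho, hxi, not_le.2 hcc]
        · simp [ho, show x ≤ i ↔ x < i by omega]
    · intro hc
      have hiT : i ∉ T := by
        intro hiT
        simp [h7, h3, hw, hleaf, hb, hiT] at hc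
      refine Reaches.mono (T₁ := 1) (Reaches.atom (Nat.zero_le _)
        ⟨h7, h0, h3, h4, hb, hτ, h1, hw, ?_⟩) (by omega) fun _ h => h
      funext x
      by_cases hxi : x = i
      · simp [ho, hxi, hiT]
      · simp [ho, show x ≤ i ↔ x < i by omega]
    · rintro υ ⟨h7, h0, h3, h4, hb, hτ, h1, hw, ho⟩
      exact Reaches.atom (by simp [h7, h4]; omega) ⟨by simp [h7, h4], h0, h3, h4, hb, hτ, h1, hw, ho⟩
  · refine ⟨rfl, h.env.r0, h.env.r3, h.env.r4, h.bound, rfl, rfl, rfl, ?_⟩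
    simpa using h.env.out
  · simp [hτ.2.2.2.2.2.2.2.2, hx]

end SparseLDP
end

/-! ### The assembled server program, its running time and word size -/

noncomputable section

namespace SparseLDP

theorem lt_hadamardDim (k : ℕ) : k < hadamardDim k := Nat.le_pow_clog (by norm_num) _

theorem hadamardDim_le {k : ℕ} (hk : 1 ≤ k) : hadamardDim k ≤ 2 * k := by
  have h1 : 1 ≤ hadamardLog k := Nat.clog_pos (by norm_num) (by omega)
  have h2 : 2 ^ (hadamardLog k - 1) < k + 1 := Nat.pow_pred_clog_lt_self (by norm_num) (by omega)
  have h3 : hadamardDim k = 2 * 2 ^ (hadamardLog k - 1) := by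
    rw [hadamardDim, ← pow_succ', Nat.sub_add_cancel h1]
  omega

theorem colCount_eq {n : ℕ} (col : Fin n → ℕ) {c : ℕ → ℕ} (hc : ∀ i : Fin n, c i = col i)
    (j : ℕ) : colCount c n j = (Finset.univ.filter fun i => col i = j).card := by
  rw [colCount, Finset.sum_range, Finset.card_filter]
  simp only [hc]

theorem onesCount_eq {n : ℕ} (col : Fin n → ℕ) (y : Fin n → Bool) {c b : ℕ → ℕ}
    (hc : ∀ i : Fin n, c i = col i) (hb : ∀ i : Fin n, b i = (y i).toNat) (j : ℕ) :
    onesCount c b n j = (Finset.univ.filter fun i => col i = j ∧ y i = true).card := by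
  rw [onesCount, Finset.sum_range, Finset.card_filter]
  simp only [hc, hb]
  refine Finset.sum_congr rfl fun i _ => ?_
  cases y i <;> simp

theorem hrFraction_mem {n : ℕ} (col : Fin n → ℕ) (y : Fin n → Bool) (j : ℕ) :
    0 ≤ hrFraction col y j ∧ hrFraction col y j ≤ 1 := by
  have : (Finset.univ.filter fun i => col i = j ∧ y i = true).card ≤
      (Finset.univ.filter fun i => col i = j).card := Finset.card_le_card fun i hi =>
    Finset.mem_filter.2 ⟨Finset.mem_univ _, (Finset.mem_filter.1 hi).2.1⟩
  unfold hrFraction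
  exact ⟨by positivity, div_le_one_of_le₀ (by exact_mod_cast this) (by positivity)⟩

theorem signal_eq {n K : ℕ} (col : Fin n → ℕ) (y : Fin n → Bool) (hcol : ∀ i, col i < K)
    {c b : ℕ → ℕ} (hc : ∀ i : Fin n, c i = col i) (hb : ∀ i : Fin n, b i = (y i).toNat) (j : ℕ) :
    signal K (colCount c n) (onesCount c b n) j =
      if j ∈ Finset.univ.image col then 2 * hrFraction col y j - 1 else 0 := by
  have hmem : (j < K ∧ 0 < colCount c n j) ↔ j ∈ Finset.univ.image col := by
    rw [colCount_eq col hc, Finset.card_pos]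
    constructor
    · rintro ⟨-, i, hi⟩
      exact Finset.mem_image.2 ⟨i, Finset.mem_univ _, (Finset.mem_filter.1 hi).2⟩
    · intro h
      obtain ⟨i, -, rfl⟩ := Finset.mem_image.1 h
      exact ⟨hcol i, i, by simp⟩
  simp only [signal, hmem]
  rw [colCount_eq col hc, onesCount_eq col y hc hb, hrFraction]
  congr 1
  ring

theorem usedCount_eq {n K : ℕ} (col : Fin n → ℕ) (hcol : ∀ i, col i < K)
    {c : ℕ → ℕ} (hc : ∀ i : Fin n, c i = col i) :
    usedCount K (colCount c n) = (Finset.univ.image col).card := by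
  unfold usedCount
  congr 1
  ext j
  rw [Finset.mem_filter, colCount_eq col hc, Finset.card_pos, Finset.mem_image, Finset.mem_range]
  constructor
  · rintro ⟨-, i, hi⟩
    exact ⟨i, Finset.mem_univ _, (Finset.mem_filter.1 hi).2⟩
  · rintro ⟨i, -, rfl⟩
    exact ⟨hcol i, i, by simp⟩

/-- Bound on the running time of the server program. -/
def serverTime (k s n : ℕ) : ℕ :=
  (2 * hadamardLog k + 6) + ((10 * n + 2) + ((12 * hadamardDim k + 3) +
    ((hadamardLog k * (16 * hadamardDim k + 6) + 2) + ((8 * hadamardDim k + 10) +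
      ((8 * hadamardDim k + 2) + ((s * (15 * hadamardLog k + 13) + 5) + (9 * k + 2)))))))

theorem exists_projection_reaches {k s n B : ℕ} {ε : ℝ} (hs : 1 ≤ s) (hsk : s ≤ k) (hε : 0 < ε)
    (hB : 2 * hadamardDim k ≤ B) (hnB : n ≤ B) (hn : 0 < n) (col : Fin n → ℕ)
    (hcol : ∀ i, col i < hadamardDim k) (y : Fin n → Bool) :
    ∃ q : PMF (Fin k), IsSparseProjection s (hrEstimate k ε col y) q ∧
      Reaches B serverProg (serverTime k s n) (fun σ => ∀ x : Fin k, σ.rarr 0 x = (q x).toReal)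
        (serverInput k s n ε col y) := by
  have hkK := lt_hadamardDim k
  set I := serverInput k s n ε col y with hI
  have hc : ∀ i : Fin n, I.arr 0 i = col i := fun i => by simp [hI, serverInput]
  have hb : ∀ i : Fin n, I.arr 1 i = (y i).toNat := fun i => by simp [hI, serverInput]
  have hb1 : ∀ i, I.arr 1 i ≤ 1 := by
    intro i
    simp only [hI, serverInput]
    split_ifs with h
    · cases y ⟨i, h⟩ <;> simp
    · omega
  have h20 : I.arr 2 = fun _ => 0 := by funext i; simp [hI, serverInput]
  have h30 : I.arr 3 = fun _ => 0 := by funext i; simp [hI, serverInput]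
  set J := (Finset.univ.image col).card with hJ
  set e := Real.exp ε with he
  have he1 : 1 < e := Real.one_lt_exp_iff.2 hε
  set f := signal (hadamardDim k) (colCount (I.arr 0) n) (onesCount (I.arr 0) (I.arr 1) n) with hf
  have hfe : ∀ j, f j = if j ∈ Finset.univ.image col then 2 * hrFraction col y j - 1 else 0 :=
    signal_eq col y hcol hc hb
  set c : ℝ := (e + 1) / (J * (e - 1)) with hcdef
  set v : ℕ → ℝ := fun x => c * walsh f (hadamardLog k) x with hv
  set b : ℝ := 0 - (e + 1) / (e - 1) - 1 with hbdef
  have hsub : Finset.univ.image col ⊆ Finset.range (2 ^ hadamardLog k) := by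
    intro j hj
    obtain ⟨i, -, rfl⟩ := Finset.mem_image.1 hj
    exact Finset.mem_range.2 (hcol i)
  have hwalsh : ∀ x < k, walsh f (hadamardLog k) x = ∑ j ∈ Finset.univ.image col,
      hadamard (hadamardLog k) x j * (2 * hrFraction col y j - 1) := by
    intro x hx
    rw [walsh_of_lt f (hx.trans hkK), ← Finset.sum_subset hsub]
    · refine Finset.sum_congr rfl fun j hj => ?_
      rw [hfe, if_pos hj]
    · intro j _ hj
      rw [hfe, if_neg hj, mul_zero]
  have hest : ∀ x : Fin k, v x = hrEstimate k ε col y x := fun x => by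
    simp only [hv, hwalsh x x.2, hcdef, hrEstimate, hJ, he]
  have hJ0 : (0 : ℝ) < J := by
    have : 0 < J := Finset.card_pos.2 ⟨_, Finset.mem_image_of_mem col (Finset.mem_univ ⟨0, hn⟩)⟩
    exact_mod_cast this
  -- Each of the `J` summands has absolute value at most 1, so the estimates are at least `-(e + 1)
  -- / (e - 1)`, and the sentinel is smaller by 1.
  have hvb : ∀ x < k, b < v x := by
    intro x hx
    have h1 : |walsh f (hadamardLog k) x| ≤ J := by
      rw [hwalsh x hx]
      refine (Finset.abs_sum_le_sum_abs _ _).trans ?_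
      refine (Finset.sum_le_sum (g := fun _ => (1 : ℝ)) fun j _ => ?_).trans (by simp [hJ])
      rw [abs_mul, abs_hadamard, one_mul, abs_le]
      have := hrFraction_mem col y j
      constructor <;> linarith [this.1, this.2]
    have hc0 : 0 < c := by
      rw [hcdef]
      have : 0 < e - 1 := by linarith
      positivity
    have h2 : c * J = (e + 1) / (e - 1) := by
      rw [hcdef]
      have : e - 1 ≠ 0 := by linarith
      field_simp
    have h3 : -(c * J) ≤ v x := by
      simp only [hv]
      rw [← mul_neg]
      exact mul_le_mul_of_nonneg_left (abs_le.1 h1).1 hc0.le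
    rw [hbdef, ← h2]
    linarith
  have main : Reaches B serverProg (serverTime k s n) (fun σ => ∃ (T A : Finset ℕ) (τ : ℝ),
      Selection k v b T A τ ∧ T.card = s ∧
      ∀ x < k, σ.rarr 0 x = if x ∈ T ∧ τ ≤ v x then v x - τ else 0) I := by
    refine Reaches.seq ((reaches_setup (by omega) (by omega) (by omega) col y ε).mono le_rfl ?_)
    rintro σ ⟨hσ, harr, hrarr⟩
    have harr' : σ.arr = I.arr := harr
    refine Reaches.seq ((reaches_count hnB (I.arr 0) (I.arr 1) hb1 σ hσ (by rw [harr'])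
      (by rw [harr']) (by rw [harr', h20]) (by rw [harr', h30])).mono le_rfl ?_)
    rintro τ ⟨hτ, h2, h3, hr⟩
    refine Reaches.seq ((reaches_signal (by omega) _ _ τ hτ h2 h3 (by rw [hr, hrarr])).mono
      le_rfl ?_)
    rintro σ ⟨hσ, h12, h1⟩
    rw [usedCount_eq col hcol hc] at h12
    refine Reaches.seq ((reaches_walsh (B := B) (m := hadamardLog k)
      (by rw [← hadamardDim]; omega) f J σ hσ h12 h1).mono le_rfl ?_)
    rintro τ ⟨hτ, h12, h1⟩
    refine Reaches.seq ((reaches_leaves hB _ J τ hτ h12 h1 b c hbdef hcdef).mono le_rfl ?_)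
    rintro σ ⟨hσ, h2, h1, h3⟩
    refine Reaches.seq ((reaches_build (by omega) hB σ hσ).mono le_rfl ?_)
    rintro τ ⟨hf', ht, hl⟩
    have hτ := hσ.of_frame hf'
    refine Reaches.seq ((reaches_select (m := hadamardLog k) hkK hsk hB v b hvb τ hτ ?_ ?_ ht
      ?_).mono le_rfl ?_)
    · rw [hf'.rreg 2 (by norm_num) (by norm_num), h2]
    · intro x hx
      rw [hf'.rarr 1 (by norm_num)]
      exact h1 x (hx.trans hkK) hx
    · intro x hx
      have := h3 x hx
      rw [← hl _ (by omega)] at this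
      exact this
    · rintro σ ⟨T, A, hsel⟩
      refine (reaches_output (m := hadamardLog k) hkK hB v b hvb T A σ hsel).mono le_rfl ?_
      intro τ hout
      exact ⟨T, A, _, hsel.sel, hsel.card, hout⟩
  obtain ⟨t, ht, σ, hex, T, A, τ, hsel, hcard, hout⟩ := main
  obtain ⟨q, hq, hqx⟩ := hsel.exists_projection hs hcard
  refine ⟨q, ?_, t, ht, σ, hex, fun x => ?_⟩
  · convert hq using 1
    funext x
    exact (hest x).symm
  · rw [hout x x.2, hqx]

theorem exists_serverComputes {k s n B : ℕ} {ε : ℝ} (hs : 1 ≤ s) (hsk : s ≤ k) (hε : 0 < ε)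
    (hB : 2 * hadamardDim k ≤ B) (hnB : n ≤ B) (hn : 0 < n) (col : Fin n → ℕ)
    (hcol : ∀ i, col i < hadamardDim k) :
    ∃ est : (Fin n → Bool) → PMF (Fin k),
      (∀ y, IsSparseProjection s (hrEstimate k ε col y) (est y)) ∧
      ServerComputes B (serverTime k s n) serverProg s ε col est := by
  choose est h1 h2 using exists_projection_reaches hs hsk hε hB hnB hn col hcol
  exact ⟨est, h1, h2⟩

theorem hadamardLog_le_log {k n : ℕ} (hk : 1 ≤ k) (hn : 1 ≤ n) :
    (hadamardLog k : ℝ) ≤ 3 * Real.log ((n : ℝ) + k + 1) ∧ 1 ≤ Real.log ((n : ℝ) + k + 1) := by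
  have hk' : (1 : ℝ) ≤ k := by exact_mod_cast hk
  have hn' : (1 : ℝ) ≤ n := by exact_mod_cast hn
  -- Here `n + k + 1 ≥ 3 > e`; this lets the logarithm absorb additive constants.
  have h1 : 1 ≤ Real.log ((n : ℝ) + k + 1) := by
    rw [Real.le_log_iff_exp_le (by positivity)]
    have := Real.exp_one_lt_d9
    linarith
  refine ⟨?_, h1⟩
  have h2 : ((2 : ℝ) ^ hadamardLog k) ≤ 2 * ((n : ℝ) + k + 1) := by
    have := hadamardDim_le hk
    have h : ((hadamardDim k : ℕ) : ℝ) ≤ 2 * k := by exact_mod_cast this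
    rw [hadamardDim] at h
    push_cast at h
    linarith
  have h3 := Real.log_le_log (by positivity) h2
  rw [Real.log_pow, Real.log_mul (by norm_num) (by positivity)] at h3
  have := Real.log_two_gt_d9
  nlinarith

theorem running_time_le {k s n : ℕ} (hsk : s ≤ k) (hk : 1 ≤ k) (hn : 1 ≤ n) :
    (n : ℝ) * ((hadamardLog k * 14 + 9 : ℕ) : ℝ) + (serverTime k s n : ℝ) ≤
      1000 * ((n : ℝ) + k) * Real.log ((n : ℝ) + k + 1) ^ 1 := by
  obtain ⟨hm, hL⟩ := hadamardLog_le_log hk hn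
  have hK := hadamardDim_le hk
  have h : n * (hadamardLog k * 14 + 9) + serverTime k s n ≤
      130 * ((n + k) * (hadamardLog k + 1)) := by
    unfold serverTime
    have e1 : hadamardLog k * (16 * hadamardDim k + 6) ≤ hadamardLog k * (38 * k) :=
      Nat.mul_le_mul_left _ (by omega)
    have e2 : s * (15 * hadamardLog k + 13) ≤ k * (15 * hadamardLog k + 13) :=
      Nat.mul_le_mul_right _ hsk
    have e3 : hadamardLog k ≤ k * hadamardLog k := Nat.le_mul_of_pos_left _ hk
    nlinarith
  have h' : (n : ℝ) * ((hadamardLog k * 14 + 9 : ℕ) : ℝ) + (serverTime k s n : ℝ) ≤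
      130 * (((n : ℝ) + k) * (hadamardLog k + 1)) := by exact_mod_cast h
  refine h'.trans ?_
  have : ((n : ℝ) + k) * (hadamardLog k + 1) ≤
      ((n : ℝ) + k) * (4 * Real.log ((n : ℝ) + k + 1)) := by
    gcongr
    linarith
  have h0 : 0 ≤ ((n : ℝ) + k) * Real.log ((n : ℝ) + k + 1) := by positivity
  rw [pow_one]
  nlinarith

theorem word_bounds {k n : ℕ} (hk : 1 ≤ k) (hn : 1 ≤ n) :
    2 * hadamardDim k ≤ (n + k + 1) ^ 3 ∧ n ≤ (n + k + 1) ^ 3 := by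
  have hK := hadamardDim_le hk
  have h1 : 3 ≤ n + k + 1 := by omega
  have h2 : 9 ≤ (n + k + 1) ^ 2 := by nlinarith
  have h3 : 9 * (n + k + 1) ≤ (n + k + 1) ^ 3 := by
    rw [pow_succ]
    exact Nat.mul_le_mul_right _ h2
  omega

end SparseLDP
end

noncomputable section

namespace SparseLDP

/-! ### Exponential moments -/

/-- The integral factors over the coordinates, and Hoeffding's lemma bounds each factor: a variable
with values in an interval of length 2 has variance proxy 1. -/
theorem integral_exp_sum_le {ι Ω : Type*} [Fintype ι] [MeasurableSpace Ω] [Finite Ω]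
    [MeasurableSingletonClass Ω] (ν : ι → Measure Ω) [∀ i, IsProbabilityMeasure (ν i)]
    (φ : ι → Ω → ℝ) (hφ : ∀ i x, φ i x ∈ Set.Icc (-1 : ℝ) 1) (w : ι → ℝ) :
    ∫ y, Real.exp (∑ i, w i * (φ i (y i) - ∫ x, φ i x ∂ν i)) ∂Measure.pi ν ≤
      Real.exp (∑ i, w i ^ 2 / 2) := by
  simp only [Real.exp_sum]
  rw [integral_fintype_prod_eq_prod (f := fun i x => Real.exp (w i * (φ i x - ∫ x, φ i x ∂ν i)))]
  refine Finset.prod_le_prod (fun i _ => integral_nonneg fun _ => (Real.exp_pos _).le) fun i _ => ?_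
  have h := (ProbabilityTheory.hasSubgaussianMGF_of_mem_Icc (μ := ν i) (X := φ i)
    (measurable_of_finite _).aemeasurable (ae_of_all _ (hφ i))).mgf_le (w i)
  refine h.trans (le_of_eq ?_)
  congr 1
  norm_num

theorem integral_exp_sq_gaussian :
    ∫ z, Real.exp (z ^ 2 / 4) ∂ProbabilityTheory.gaussianReal 0 1 = √2 := by
  rw [ProbabilityTheory.integral_gaussianReal_eq_integral_smul (by norm_num)]
  have : ∀ z : ℝ, ProbabilityTheory.gaussianPDFReal 0 1 z • Real.exp (z ^ 2 / 4) =
      (√(2 * Real.pi))⁻¹ * Real.exp (-(1 / 4) * z ^ 2) := by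
    intro z
    rw [ProbabilityTheory.gaussianPDFReal, smul_eq_mul, mul_assoc, ← Real.exp_add]
    simp
    ring_nf
    exact Or.inl trivial
  simp only [this]
  rw [integral_const_mul, integral_gaussian, ← Real.sqrt_inv, ← Real.sqrt_mul (by positivity)]
  congr 1
  have := Real.pi_pos
  field_simp
  norm_num

/-- The integral of a nonintegrable function is 0 by convention, whereas this one is √2. -/
theorem integrable_exp_sq_gaussian :
    Integrable (fun z : ℝ => Real.exp (z ^ 2 / 4)) (ProbabilityTheory.gaussianReal 0 1) := by
  by_contra h
  have := integral_exp_sq_gaussian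
  rw [integral_undef h] at this
  have h2 : (0 : ℝ) < √2 := by positivity
  linarith

/-- Square-exponential moment of a subgaussian random variable. -/
theorem integral_exp_sq_le {Ω : Type*} [MeasurableSpace Ω] [Finite Ω] [MeasurableSingletonClass Ω]
    (μ : Measure Ω) [IsProbabilityMeasure μ] (g : Ω → ℝ) {v : ℝ} (hv : 0 < v)
    (hg : ∀ t : ℝ, ∫ y, Real.exp (t * g y) ∂μ ≤ Real.exp (t ^ 2 * v / 2)) :
    ∫ y, Real.exp (g y ^ 2 / (4 * v)) ∂μ ≤ 2 := by
  have := Fintype.ofFinite Ω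
  set γ := ProbabilityTheory.gaussianReal 0 1
  -- Gaussian linearization: `exp (g ^ 2 / (4 * v))` is the mean of `exp (t * g * z)` over a
  -- standard normal `z`. After exchanging integrals the hypothesis leaves the mean of `exp (z ^ 2 /
  -- 4)`, which is √2.
  set t := √(1 / (2 * v)) with ht
  have ht2 : t ^ 2 = 1 / (2 * v) := Real.sq_sqrt (by positivity)
  have hmgf : ∀ a : ℝ, ∫ z, Real.exp (a * z) ∂γ = Real.exp (a ^ 2 / 2) := by
    intro a
    have := congrFun (ProbabilityTheory.mgf_id_gaussianReal (μ := 0) (v := 1)) a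
    simpa [ProbabilityTheory.mgf] using this
  have hint : ∀ a : ℝ, Integrable (fun z => Real.exp (a * z)) γ := fun a =>
    ProbabilityTheory.integrable_exp_mul_gaussianReal a
  calc ∫ y, Real.exp (g y ^ 2 / (4 * v)) ∂μ
      = ∫ y, (∫ z, Real.exp (t * g y * z) ∂γ) ∂μ := by
        refine integral_congr_ae (ae_of_all _ fun y => ?_)
        simp only [hmgf]
        congr 1
        rw [mul_pow, ht2]
        field_simp
        norm_num
    _ = ∫ z, (∫ y, Real.exp (t * z * g y) ∂μ) ∂γ := by
        simp only [integral_fintype (Integrable.of_finite (μ := μ))]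
        rw [integral_finsetSum _ fun y _ => ?_]
        · refine Finset.sum_congr rfl fun y _ => ?_
          rw [integral_smul]
          congr 2
          funext z
          congr 1
          ring
        · simp only [smul_eq_mul]
          refine Integrable.const_mul ?_ _
          convert hint (t * g y) using 2
          ring_nf
    _ ≤ ∫ z, Real.exp (z ^ 2 / 4) ∂γ := by
        refine integral_mono_of_nonneg (ae_of_all _ fun z => integral_nonneg fun _ =>
          (Real.exp_pos _).le) integrable_exp_sq_gaussian (ae_of_all _ fun z => ?_)
        refine (hg (t * z)).trans (le_of_eq ?_)
        congr 1
        rw [mul_pow, ht2]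
        field_simp
        ring
    _ ≤ 2 := by
        rw [integral_exp_sq_gaussian, Real.sqrt_le_left (by norm_num)]
        norm_num

/-! ### Error of the sparse projection -/

theorem support_eq_filter {k : ℕ} (p : PMF (Fin k)) [DecidablePred fun x => p x ≠ 0] :
    p.support.ncard = (Finset.univ.filter fun x => p x ≠ 0).card := by
  rw [← Set.ncard_coe_finset]
  congr 1
  ext x
  simp [PMF.mem_support_iff]

/-- The projection error is controlled by the error of the vector on some `2s` entries. -/
theorem tv_sq_le {k s : ℕ} {v : Fin k → ℝ} {p q : PMF (Fin k)} (hp : IsSparse s p)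
    (hq : IsSparseProjection s v q) :
    ∃ T : Finset (Fin k), T.card ≤ 2 * s ∧
      tv p q ^ 2 ≤ 2 * s * ∑ x ∈ T, (v x - (p x).toReal) ^ 2 := by
  classical
  set T : Finset (Fin k) := (Finset.univ.filter fun x => p x ≠ 0) ∪
    (Finset.univ.filter fun x => q x ≠ 0) with hT
  have hTc : T.card ≤ 2 * s := by
    refine (Finset.card_union_le _ _).trans ?_
    rw [← support_eq_filter, ← support_eq_filter, two_mul]
    exact Nat.add_le_add hp hq.1
  have hoff : ∀ x ∉ T, (p x).toReal = 0 ∧ (q x).toReal = 0 := by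
    intro x hx
    simp only [hT, Finset.mem_union, Finset.mem_filter, Finset.mem_univ, true_and, not_or,
      not_not] at hx
    simp [hx.1, hx.2]
  have hsumT : ∀ F : Fin k → ℝ, (∀ x ∉ T, F x = 0) → ∑ x, F x = ∑ x ∈ T, F x := fun F hF =>
    (Finset.sum_subset (Finset.subset_univ _) fun x _ hx => hF x hx).symm
  refine ⟨T, hTc, ?_⟩
  set h : Fin k → ℝ := fun x => (q x).toReal - (p x).toReal with hh
  have hproj := hq.2 p hp
  have hexp : ∑ x, (v x - (q x).toReal) ^ 2 = ∑ x, (v x - (p x).toReal) ^ 2 +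
      ∑ x, (h x ^ 2 - 2 * h x * (v x - (p x).toReal)) := by
    rw [← Finset.sum_add_distrib]
    exact Finset.sum_congr rfl fun x _ => by simp only [hh]; ring
  rw [hexp, hsumT (fun x => h x ^ 2 - 2 * h x * (v x - (p x).toReal))
    fun x hx => by simp [hh, hoff x hx]] at hproj
  -- Completing the square turns the comparison with the competitor `p` into: the sum of `h ^ 2` is
  -- at most 4 times the squared error on `T`. Cauchy-Schwarz then passes to the ℓ¹ norm.
  have h1 : ∑ x ∈ T, (h x ^ 2 / 2 - 2 * (v x - (p x).toReal) ^ 2) ≤ 0 := by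
    refine le_trans (Finset.sum_le_sum fun x _ => ?_) (by linarith :
      ∑ x ∈ T, (h x ^ 2 - 2 * h x * (v x - (p x).toReal)) ≤ 0)
    nlinarith [sq_nonneg (h x - 2 * (v x - (p x).toReal))]
  rw [Finset.sum_sub_distrib, ← Finset.sum_div, ← Finset.mul_sum] at h1
  have htv : tv p q = (∑ x ∈ T, |h x|) / 2 := by
    unfold tv
    rw [hsumT _ fun x hx => by simp [hoff x hx]]
    simp only [hh, abs_sub_comm]
  have hcs : (∑ x ∈ T, |h x|) ^ 2 ≤ T.card * ∑ x ∈ T, h x ^ 2 := by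
    simpa using sq_sum_le_card_mul_sum_sq (s := T) (f := fun x => |h x|)
  have hTc' : (T.card : ℝ) ≤ 2 * s := by exact_mod_cast hTc
  have h0 : 0 ≤ ∑ x ∈ T, h x ^ 2 := Finset.sum_nonneg fun _ _ => sq_nonneg _
  rw [htv, div_pow]
  have h2 : (T.card : ℝ) * ∑ x ∈ T, h x ^ 2 ≤ 2 * s * ∑ x ∈ T, h x ^ 2 := by gcongr
  have h3 : (2 * s : ℝ) * ∑ x ∈ T, h x ^ 2 ≤
      2 * s * (4 * ∑ x ∈ T, (v x - (p x).toReal) ^ 2) := by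
    gcongr
    linarith
  linarith

/-- A bound on `∑ exp (lam g²)` controls the sum of the squares over any `2s` entries. -/
theorem sum_sq_le_of_sum_exp_le {k s : ℕ} (hs : 1 ≤ s) (hsk : s ≤ k) {g : Fin k → ℝ} {lam : ℝ}
    (hZ : ∑ x, Real.exp (lam * g x ^ 2) ≤ 20 * k) (T : Finset (Fin k))
    (hT : T.card ≤ 2 * s) :
    lam * ∑ x ∈ T, g x ^ 2 ≤ 12 * s * max (Real.log ((k : ℝ) / s)) 1 := by
  have hs0 : (0 : ℝ) < s := by exact_mod_cast hs
  have hk0 : (0 : ℝ) < k := by exact_mod_cast hs.trans hsk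
  set ℓ := max (Real.log ((k : ℝ) / s)) 1 with hℓ
  have hℓ1 : 1 ≤ ℓ := le_max_right _ _
  -- The exponential is linearized by `w ≤ exp (w - a) + a - 1`. This `a` makes `exp (-a) * (20 *
  -- k)` of order `s`.
  set a := Real.log ((k : ℝ) / s) + 1 with ha
  have hlog : 0 ≤ Real.log ((k : ℝ) / s) := by
    refine Real.log_nonneg ?_
    rw [one_le_div hs0]
    exact_mod_cast hsk
  have hea : Real.exp (-a) ≤ s / k * (1 / 2) := by
    rw [ha, neg_add, Real.exp_add, Real.exp_neg, Real.exp_log (by positivity), inv_div]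
    gcongr
    rw [Real.exp_neg, one_div]
    gcongr
    linarith [Real.exp_one_gt_d9]
  have hpt : ∀ x, lam * g x ^ 2 ≤ Real.exp (-a) * Real.exp (lam * g x ^ 2) + (a - 1) := by
    intro x
    have := Real.add_one_le_exp (lam * g x ^ 2 - a)
    rw [sub_eq_neg_add, Real.exp_add] at this
    linarith
  have hTc : (T.card : ℝ) ≤ 2 * s := by exact_mod_cast hT
  calc lam * ∑ x ∈ T, g x ^ 2 = ∑ x ∈ T, lam * g x ^ 2 := Finset.mul_sum _ _ _
    _ ≤ ∑ x ∈ T, (Real.exp (-a) * Real.exp (lam * g x ^ 2) + (a - 1)) :=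
        Finset.sum_le_sum fun x _ => hpt x
    _ = Real.exp (-a) * ∑ x ∈ T, Real.exp (lam * g x ^ 2) + T.card * (a - 1) := by
        rw [Finset.sum_add_distrib, ← Finset.mul_sum, Finset.sum_const, nsmul_eq_mul]
    _ ≤ (s / k * (1 / 2)) * (20 * k) + 2 * s * ℓ := by
        gcongr
        · refine le_trans (Finset.sum_le_sum_of_subset_of_nonneg (Finset.subset_univ _)
            fun x _ _ => (Real.exp_pos _).le) hZ
        · rw [ha]; linarith
        · rw [ha, add_sub_cancel_right]; exact le_max_left _ _
    _ = s * (10 + 2 * ℓ) := by field_simp; ring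
    _ ≤ 12 * s * ℓ := by nlinarith

/-! ### The noise of Hadamard Response -/

/-- The sign of a bit. -/
def bitSign (b : Bool) : ℝ := if b then 1 else -1

theorem bitSign_mem (b : Bool) : bitSign b ∈ Set.Icc (-1 : ℝ) 1 := by
  cases b <;> simp [bitSign]

theorem bitSign_eq (b : Bool) : bitSign b = 2 * (if b = true then 1 else 0) - 1 := by
  cases b <;> norm_num [bitSign]

/-- The contraction factor of randomized response; the estimate divides by it. -/
theorem integral_bitSign {k : ℕ} (ε : ℝ) (j : ℕ) (p : PMF (Fin k)) :
    ∫ b, bitSign b ∂(p.bind (hrChannel k ε j)).toMeasure =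
      (Real.exp ε - 1) / (Real.exp ε + 1) *
        ∑ x, (p x).toReal * hadamard (hadamardLog k) x j := by
  classical
  have hW : ∀ x : Fin k, (hrChannel k ε j x true).toReal - (hrChannel k ε j x false).toReal =
      (Real.exp ε - 1) / (Real.exp ε + 1) * hadamard (hadamardLog k) x j := by
    intro x
    have hE := Real.exp_pos ε
    have h1 : 0 ≤ Real.exp ε / (Real.exp ε + 1) := by positivity
    have h2 : 0 ≤ 1 / (Real.exp ε + 1) := by positivity
    have hne : ((-1 : ℝ) = 1) ↔ False := by norm_num
    simp only [hrChannel, randomizedResponse, PMF.ofFintype_apply, responseProb]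
    rcases hadamard_eq_or (hadamardLog k) x j with h | h
    · simp only [h, decide_true, beq_self_eq_true, if_true, ENNReal.toReal_ofReal h1]
      simp only [Bool.false_beq, Bool.not_true, Bool.false_eq_true, if_false,
        ENNReal.toReal_ofReal h2]
      ring
    · simp only [h, hne, decide_false, beq_self_eq_true, if_true, ENNReal.toReal_ofReal h1]
      simp only [Bool.true_beq, Bool.false_eq_true, if_false,
        ENNReal.toReal_ofReal h2]
      ring
  have hb : ∀ b, ((p.bind (hrChannel k ε j)) b).toReal =
      ∑ x, (p x).toReal * (hrChannel k ε j x b).toReal := by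
    intro b
    rw [PMF.bind_apply, tsum_fintype, ENNReal.toReal_sum]
    · simp [ENNReal.toReal_mul]
    · exact fun x _ => ENNReal.mul_ne_top (p.apply_ne_top _) (PMF.apply_ne_top _ _)
  rw [PMF.integral_eq_sum, Fintype.sum_bool, hb, hb, Finset.mul_sum]
  simp only [bitSign, if_true, smul_eq_mul, mul_one, Bool.false_eq_true, if_false, mul_neg,
    ← sub_eq_add_neg]
  rw [← Finset.sum_sub_distrib]
  refine Finset.sum_congr rfl fun x _ => ?_
  rw [← mul_sub, hW]
  ring

end SparseLDP
end

/-! ### Bias, noise and success probability of Hadamard Response -/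

noncomputable section

namespace SparseLDP

theorem sum_div_fiber_card {n : ℕ} (col : Fin n → ℕ) (F : Fin n → ℝ) :
    ∑ j ∈ Finset.univ.image col, (∑ i with col i = j, F i) /
      ((Finset.univ.filter fun i => col i = j).card : ℝ) =
    ∑ i, F i / ((Finset.univ.filter fun i' => col i' = col i).card : ℝ) := by
  rw [← Finset.sum_fiberwise_of_maps_to (s := Finset.univ) (t := Finset.univ.image col) (g := col)
    fun i _ => Finset.mem_image_of_mem _ (Finset.mem_univ i)]
  refine Finset.sum_congr rfl fun j _ => ?_
  rw [Finset.sum_div]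
  refine Finset.sum_congr rfl fun i hi => ?_
  rw [(Finset.mem_filter.1 hi).2]

theorem fiber_card_pos {n : ℕ} (col : Fin n → ℕ) {j : ℕ} (hj : j ∈ Finset.univ.image col) :
    (0 : ℝ) < ((Finset.univ.filter fun i => col i = j).card : ℝ) := by
  obtain ⟨i, -, rfl⟩ := Finset.mem_image.1 hj
  exact_mod_cast Finset.card_pos.2 ⟨i, by simp⟩

theorem two_mul_hrFraction_sub_one {n : ℕ} (col : Fin n → ℕ) (y : Fin n → Bool) {j : ℕ}
    (hj : j ∈ Finset.univ.image col) : 2 * hrFraction col y j - 1 =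
      (∑ i with col i = j, bitSign (y i)) /
        ((Finset.univ.filter fun i => col i = j).card : ℝ) := by
  have h0 := fiber_card_pos col hj
  simp only [bitSign_eq]
  rw [Finset.sum_sub_distrib, ← Finset.mul_sum, Finset.sum_boole, Finset.filter_filter, hrFraction]
  simp
  field_simp

/-- Regrouping by users exhibits the estimate as a fixed linear combination of independent signs, to
which Hoeffding's lemma applies. -/
theorem hrEstimate_eq {k n : ℕ} (ε : ℝ) (col : Fin n → ℕ) (y : Fin n → Bool) (x : Fin k) :
    hrEstimate k ε col y x = ∑ i, (Real.exp ε + 1) / (Real.exp ε - 1) /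
      (((Finset.univ.image col).card : ℝ) *
        ((Finset.univ.filter fun i' => col i' = col i).card : ℝ)) *
      hadamard (hadamardLog k) x (col i) * bitSign (y i) := by
  have h1 : ∑ j ∈ Finset.univ.image col,
      hadamard (hadamardLog k) x j * (2 * hrFraction col y j - 1) =
      ∑ j ∈ Finset.univ.image col, (∑ i with col i = j,
        hadamard (hadamardLog k) x (col i) * bitSign (y i)) /
      ((Finset.univ.filter fun i => col i = j).card : ℝ) := by
    refine Finset.sum_congr rfl fun j hj => ?_
    rw [two_mul_hrFraction_sub_one col y hj, ← mul_div_assoc, Finset.mul_sum]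
    congr 1
    exact Finset.sum_congr rfl fun i hi => by rw [(Finset.mem_filter.1 hi).2]
  rw [hrEstimate, h1, sum_div_fiber_card, Finset.mul_sum]
  refine Finset.sum_congr rfl fun i _ => ?_
  simp only [div_eq_mul_inv, mul_inv]
  ring

/-- The Hadamard Response estimate on users assigned to columns of small coherence. -/
theorem successProb_hr {k s n : ℕ} (hs : 1 ≤ s) (hsk : s ≤ k) (hn : 0 < n) {ε α : ℝ} (hε : 0 < ε)
    (hα : 0 < α) (col : Fin n → ℕ)
    (hbal : ∀ i, (n : ℝ) ≤ 2 * (((Finset.univ.image col).card : ℝ) *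
      ((Finset.univ.filter fun i' => col i' = col i).card : ℝ)))
    {c μ₀ : ℝ} (hc : c = (Real.exp ε + 1) / (Real.exp ε - 1))
    (hcoh : ∀ x x' : Fin k, x ≠ x' → |∑ j ∈ Finset.univ.image col,
      hadamard (hadamardLog k) x j * hadamard (hadamardLog k) x' j| ≤
        μ₀ * (Finset.univ.image col).card)
    (hμ : 0 ≤ μ₀)
    (hrate : 8 * s ^ 2 * μ₀ ^ 2 + 768 * c ^ 2 * (s ^ 2 * max (Real.log ((k : ℝ) / s)) 1) / n ≤
      α ^ 2)
    (est : (Fin n → Bool) → PMF (Fin k))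
    (hest : ∀ y, IsSparseProjection s (hrEstimate k ε col y) (est y)) (p : PMF (Fin k))
    (hp : IsSparse s p) :
    (9 / 10 : ℝ≥0∞) ≤ successProb (fun i => hrChannel k ε (col i)) est α p := by
  have hs0 : (0 : ℝ) < s := by exact_mod_cast hs
  have hk0 : (0 : ℝ) < k := by exact_mod_cast hs.trans hsk
  have hn0 : (0 : ℝ) < n := by exact_mod_cast hn
  have he1 : 0 < Real.exp ε - 1 := sub_pos.2 (Real.one_lt_exp_iff.2 hε)
  have he2 : 0 < Real.exp ε + 1 := by positivity
  have hc0 : 0 < c := hc ▸ div_pos he2 he1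
  set ℓ := max (Real.log ((k : ℝ) / s)) 1 with hℓ
  set J := ((Finset.univ.image col).card : ℝ) with hJ
  set N : Fin n → ℝ := fun i => ((Finset.univ.filter fun i' => col i' = col i).card : ℝ) with hN
  have hJ0 : 0 < J := by
    have := Finset.card_pos.2 ⟨_, Finset.mem_image_of_mem col (Finset.mem_univ ⟨0, hn⟩)⟩
    rw [hJ]
    exact_mod_cast this
  have hN0 : ∀ i, 0 < N i := fun i =>
    fiber_card_pos col (Finset.mem_image_of_mem _ (Finset.mem_univ i))
  set H : ℕ → ℕ → ℝ := hadamard (hadamardLog k) with hH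
  set ν : Fin n → Measure Bool := fun i => (p.bind (hrChannel k ε (col i))).toMeasure with hν
  set w : Fin k → Fin n → ℝ := fun x i => c / (J * N i) * H x (col i) with hw
  set E : Fin k → ℝ := fun x => ∑ i, w x i * ∫ b, bitSign b ∂ν i with hE
  set g : Fin k → (Fin n → Bool) → ℝ := fun x y => hrEstimate k ε col y x - E x with hg
  have hgsum : ∀ x y, g x y = ∑ i, w x i * (bitSign (y i) - ∫ b, bitSign b ∂ν i) := by
    intro x y
    simp only [mul_sub, Finset.sum_sub_distrib]
    refine congrArg (· - E x) ?_
    rw [hrEstimate_eq, ← hc]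
  -- the bias
  have hbias : ∀ x, |E x - (p x).toReal| ≤ μ₀ := by
    intro x
    have h1 : E x = (∑ i, H x (col i) * (∑ x', (p x').toReal * H x' (col i)) / N i) / J := by
      simp only [hE, hw, hν, integral_bitSign, Finset.sum_div]
      refine Finset.sum_congr rfl fun i _ => ?_
      have := hN0 i
      rw [hc]
      field_simp
      rfl
    have h2 : ∑ i, H x (col i) * (∑ x', (p x').toReal * H x' (col i)) / N i =
        ∑ j ∈ Finset.univ.image col, H x j * ∑ x', (p x').toReal * H x' j := by
      rw [← sum_div_fiber_card col fun i => H x (col i) * ∑ x', (p x').toReal * H x' (col i)]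
      refine Finset.sum_congr rfl fun j hj => ?_
      have h0 := fiber_card_pos col hj
      rw [div_eq_iff h0.ne', mul_comm _ ((Finset.card _ : ℕ) : ℝ), ← nsmul_eq_mul,
        ← Finset.sum_const]
      exact Finset.sum_congr rfl fun i hi => by rw [(Finset.mem_filter.1 hi).2]
    have h3 : ∑ j ∈ Finset.univ.image col, H x j * ∑ x', (p x').toReal * H x' j =
        ∑ x', (p x').toReal * ∑ j ∈ Finset.univ.image col, H x j * H x' j := by
      simp only [Finset.mul_sum]
      rw [Finset.sum_comm]
      exact Finset.sum_congr rfl fun _ _ => Finset.sum_congr rfl fun _ _ => by ring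
    -- The bias is a `p`-average of normalized correlations of distinct rows, hence at most the
    -- coherence `μ₀`.
    have h4 : E x - (p x).toReal = ∑ x', (p x').toReal *
        ((∑ j ∈ Finset.univ.image col, H x j * H x' j) / J - if x' = x then 1 else 0) := by
      simp only [mul_sub, Finset.sum_sub_distrib, mul_ite, mul_one, mul_zero,
        Finset.sum_ite_eq', Finset.mem_univ, if_true]
      rw [h1, h2, h3, Finset.sum_div]
      simp only [mul_div_assoc]
    rw [h4]
    calc _ ≤ ∑ x', |(p x').toReal *
        ((∑ j ∈ Finset.univ.image col, H x j * H x' j) / J - if x' = x then 1 else 0)| :=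
          Finset.abs_sum_le_sum_abs _ _
      _ ≤ ∑ x', (p x').toReal * μ₀ := by
          refine Finset.sum_le_sum fun x' _ => ?_
          rw [abs_mul, abs_of_nonneg ENNReal.toReal_nonneg]
          refine mul_le_mul_of_nonneg_left ?_ ENNReal.toReal_nonneg
          by_cases hxx : x' = x
          · subst hxx
            simp only [hH, hadamard_mul_self, if_true]
            rw [Finset.sum_const, nsmul_eq_mul, mul_one, ← hJ, div_self hJ0.ne', sub_self,
              abs_zero]
            exact hμ
          · rw [if_neg hxx, sub_zero, abs_div, abs_of_pos hJ0, div_le_iff₀ hJ0]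
            exact hcoh x x' (Ne.symm hxx)
      _ = μ₀ := by rw [← Finset.sum_mul, sum_toReal_pmf, one_mul]
  -- the noise
  set v : ℝ := 4 * c ^ 2 / n with hv
  have hv0 : 0 < v := by positivity
  have hwi : ∀ x i, w x i ^ 2 ≤ (2 * c / n) ^ 2 := by
    intro x i
    have h0 := hN0 i
    rw [hw]
    simp only
    rw [mul_pow, sq (H _ _), hH, hadamard_mul_self, mul_one]
    have : c / (J * N i) ≤ 2 * c / n := by
      rw [div_le_div_iff₀ (by positivity) hn0]
      have := hbal i
      nlinarith
    gcongr
  have hmgf : ∀ x (t : ℝ), ∫ y, Real.exp (t * g x y) ∂Measure.pi ν ≤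
      Real.exp (t ^ 2 * v / 2) := by
    intro x t
    have h := integral_exp_sum_le ν (fun _ => bitSign) (fun _ => bitSign_mem) fun i => t * w x i
    have h2 : ∀ y : Fin n → Bool, t * g x y =
        ∑ i, t * w x i * (bitSign (y i) - ∫ b, bitSign b ∂ν i) := by
      intro y
      rw [hgsum, Finset.mul_sum]
      exact Finset.sum_congr rfl fun _ _ => by ring
    simp only [h2]
    refine h.trans (Real.exp_le_exp.2 ?_)
    calc ∑ i, (t * w x i) ^ 2 / 2 ≤ ∑ _i : Fin n, t ^ 2 * (2 * c / n) ^ 2 / 2 := by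
          refine Finset.sum_le_sum fun i _ => ?_
          rw [mul_pow]
          have := hwi x i
          gcongr
      _ = t ^ 2 * v / 2 := by
          rw [Finset.sum_const, Finset.card_univ, Fintype.card_fin, nsmul_eq_mul, hv]
          field_simp
          norm_num
  set lam := 1 / (4 * v) with hlam
  set Z : (Fin n → Bool) → ℝ := fun y => ∑ x, Real.exp (lam * g x y ^ 2) with hZ
  have hZint : ∫ y, Z y ∂Measure.pi ν ≤ 2 * k := by
    simp only [hZ]
    rw [integral_finsetSum _ fun x _ => Integrable.of_finite]
    refine (Finset.sum_le_sum (g := fun _ => (2 : ℝ)) fun x _ => ?_).trans (le_of_eq ?_)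
    · have := integral_exp_sq_le (Measure.pi ν) (g x) hv0 (hmgf x)
      simpa [hlam, div_eq_inv_mul] using this
    · simp [mul_comm]
  -- Markov's inequality at ten times the bound on the mean gives the failure probability 1/10.
  have hmarkov : (Measure.pi ν).real {y | 20 * (k : ℝ) ≤ Z y} ≤ 1 / 10 := by
    have := mul_meas_ge_le_integral_of_nonneg (μ := Measure.pi ν) (f := Z)
      (ae_of_all _ fun y => Finset.sum_nonneg fun x _ => (Real.exp_pos _).le)
      Integrable.of_finite (20 * (k : ℝ))
    have h2 : 20 * (k : ℝ) * (Measure.pi ν).real {y | 20 * (k : ℝ) ≤ Z y} ≤ 2 * k :=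
      this.trans hZint
    have : (k : ℝ) * (20 * (Measure.pi ν).real {y | 20 * (k : ℝ) ≤ Z y}) ≤ k * 2 := by linarith
    have := le_of_mul_le_mul_left this hk0
    linarith
  have hgood : {y | 20 * (k : ℝ) ≤ Z y}ᶜ ⊆ {y | tv p (est y) ≤ α} := by
    intro y hy
    have hy' : Z y ≤ 20 * k := (not_le.1 (show ¬ 20 * (k : ℝ) ≤ Z y from hy)).le
    obtain ⟨T, hTc, hT⟩ := tv_sq_le hp (hest y)
    have hgT := sum_sq_le_of_sum_exp_le hs hsk (g := fun x => g x y) hy' T hTc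
    have hTc' : (T.card : ℝ) ≤ 2 * s := by exact_mod_cast hTc
    have h1 : ∑ x ∈ T, (hrEstimate k ε col y x - (p x).toReal) ^ 2 ≤
        2 * (2 * s * μ₀ ^ 2) + 2 * ∑ x ∈ T, g x y ^ 2 := by
      calc _ ≤ ∑ x ∈ T, (2 * μ₀ ^ 2 + 2 * g x y ^ 2) := by
            refine Finset.sum_le_sum fun x _ => ?_
            have hb := sq_le_sq' (abs_le.1 (hbias x)).1 (abs_le.1 (hbias x)).2
            simp only [hg]
            nlinarith [sq_nonneg ((E x - (p x).toReal) - (hrEstimate k ε col y x - E x))]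
        _ = T.card * (2 * μ₀ ^ 2) + 2 * ∑ x ∈ T, g x y ^ 2 := by
            rw [Finset.sum_add_distrib, Finset.sum_const, nsmul_eq_mul, ← Finset.mul_sum]
        _ ≤ 2 * s * (2 * μ₀ ^ 2) + 2 * ∑ x ∈ T, g x y ^ 2 := by gcongr
        _ = _ := by ring
    have h2 : ∑ x ∈ T, g x y ^ 2 ≤ 192 * c ^ 2 * (s * ℓ) / n := by
      have : lam * ∑ x ∈ T, g x y ^ 2 ≤ lam * (192 * c ^ 2 * (s * ℓ) / n) := by
        refine hgT.trans (le_of_eq ?_)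
        rw [← hℓ, hlam, hv]
        field_simp
        ring
      exact le_of_mul_le_mul_left this (by positivity)
    have h3 : tv p (est y) ^ 2 ≤ α ^ 2 := by
      refine hT.trans (le_trans ?_ hrate)
      calc 2 * (s : ℝ) * ∑ x ∈ T, (hrEstimate k ε col y x - (p x).toReal) ^ 2
          ≤ 2 * s * (2 * (2 * s * μ₀ ^ 2) + 2 * (192 * c ^ 2 * (s * ℓ) / n)) := by
            gcongr
            linarith
        _ = _ := by ring
    exact abs_le_of_sq_le_sq' h3 hα.le |>.2
  have hmeas : MeasurableSet {y | 20 * (k : ℝ) ≤ Z y} := Set.Finite.measurableSet (Set.toFinite _)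
  have hcompl := probReal_compl_eq_one_sub (μ := Measure.pi ν) hmeas
  have h9 : (9 / 10 : ℝ) ≤ (Measure.pi ν).real {y | 20 * (k : ℝ) ≤ Z y}ᶜ := by
    rw [hcompl]; linarith
  calc (9 / 10 : ℝ≥0∞) = ENNReal.ofReal (9 / 10) := by
        rw [ENNReal.ofReal_div_of_pos (by norm_num)]; simp
    _ ≤ Measure.pi ν {y | 20 * (k : ℝ) ≤ Z y}ᶜ :=
        ENNReal.ofReal_le_of_le_toReal h9
    _ ≤ _ := measure_mono hgood

end SparseLDP
end

noncomputable section

namespace SparseLDP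

/-! ### Assignment of columns -/

theorem image_mod {n n' : ℕ} (h0 : 0 < n') (hn : n' ≤ n) (c : ℕ → ℕ) :
    (Finset.univ.image fun i : Fin n => c (i % n')) = (Finset.range n').image c := by
  ext j
  simp only [Finset.mem_image, Finset.mem_univ, true_and, Finset.mem_range]
  constructor
  · rintro ⟨i, rfl⟩
    exact ⟨i % n', Nat.mod_lt _ h0, rfl⟩
  · rintro ⟨a, ha, rfl⟩
    exact ⟨⟨a, by omega⟩, by simp [Nat.mod_eq_of_lt ha]⟩

/-- A residue class modulo `n'` contains at least `n / n'` users, and rounding down a quotient that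
is at least 1 loses less than a factor 2. -/
theorem le_fiber_card_mod {n n' : ℕ} (h0 : 0 < n') (hn : n' ≤ n) (c : ℕ → ℕ) (i : Fin n) :
    n ≤ 2 * (n' * (Finset.univ.filter fun i' : Fin n => c (i' % n') = c (i % n')).card) := by
  have h1 : n / n' ≤ (Finset.univ.filter fun i' : Fin n => c (i' % n') = c (i % n')).card := by
    rw [← colCount_eq (fun i' : Fin n => c (i' % n')) (c := fun a => c (a % n')) (fun _ => rfl),
      colCount]
    have h2 := Nat.count_modEq_card (b := n) h0 i
    rw [Nat.count_eq_card_filter_range, Finset.card_filter] at h2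
    refine le_trans ?_ (Finset.sum_le_sum (f := fun a => if a ≡ i [MOD n'] then 1 else 0)
      fun a _ => ?_)
    · rw [h2]; exact Nat.le_add_right _ _
    · split_ifs with h3 h4
      · exact le_rfl
      · exact absurd (congrArg c h3) h4
      · omega
      · exact le_rfl
  have h3 : 1 ≤ n / n' := Nat.div_pos hn h0
  have h4 := Nat.div_add_mod n n'
  have h5 := Nat.mod_lt n h0
  have h6 : n' * 1 ≤ n' * (n / n') := Nat.mul_le_mul_left _ h3
  have h7 := Nat.mul_le_mul_left n' h1
  omega

theorem sum_blocks (n' L : ℕ) (F : ℕ → ℝ) :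
    ∑ i : Fin n', ∑ r : Fin L, F (r + L * i) = ∑ j ∈ Finset.range (n' * L), F j := by
  rw [← Fintype.sum_prod_type', Finset.sum_range]
  exact Fintype.sum_equiv finProdFinEquiv _ _ fun _ => rfl

/-- Some choice of one element from each of `n'` blocks of length `L` nearly balances finitely many
functions that are balanced over all the blocks. -/
theorem exists_balanced_choice {A : Type*} [Fintype A] [Nonempty A] {n' L : ℕ} (hn : 0 < n')
    (hL : 0 < L) (F : A → ℕ → ℝ) (hF : ∀ a j, F a j ∈ Set.Icc (-1 : ℝ) 1)
    (hsum : ∀ a, ∑ j ∈ Finset.range (n' * L), F a j = 0) :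
    ∃ r : Fin n' → Fin L, ∀ a, |∑ i, F a (r i + L * i)| ≤
      √(2 * n' * Real.log (2 * Fintype.card A)) := by
  have : Nonempty (Fin L) := ⟨⟨0, hL⟩⟩
  have hA : (1 : ℝ) ≤ Fintype.card A := by exact_mod_cast Fintype.card_pos
  have hn0 : (0 : ℝ) < n' := by exact_mod_cast hn
  have hL0 : (0 : ℝ) < L := by exact_mod_cast hL
  set ℓ := Real.log (2 * Fintype.card A) with hℓ
  have hℓ0 : 0 < ℓ := Real.log_pos (by linarith)
  set ν : Fin n' → Measure (Fin L) := fun _ => (PMF.uniformOfFintype (Fin L)).toMeasure with hν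
  set S : A → (Fin n' → Fin L) → ℝ := fun a r => ∑ i, F a (r i + L * i) with hS
  -- The mean over a single block need not vanish; only the sum over all blocks does.
  have hmean : ∀ a, ∑ i : Fin n', ∫ r, F a (r + L * i) ∂ν i = 0 := by
    intro a
    have : ∀ i : Fin n', ∫ r, F a (r + L * i) ∂ν i = (L : ℝ)⁻¹ * ∑ r : Fin L, F a (r + L * i) := by
      intro i
      simp [hν, PMF.integral_eq_sum, Finset.mul_sum]
    simp only [this]
    rw [← Finset.mul_sum, sum_blocks, hsum, mul_zero]
  have hmgf : ∀ a (t : ℝ), ∫ r, Real.exp (t * S a r) ∂Measure.pi ν ≤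
      Real.exp (t ^ 2 * n' / 2) := by
    intro a t
    have h := integral_exp_sum_le ν (fun i r => F a (r + L * i)) (fun i r => hF a _) fun _ => t
    have h2 : ∀ y : Fin n' → Fin L, ∑ i, t * (F a (y i + L * i) - ∫ r, F a (r + L * i) ∂ν i) =
        t * S a y := by
      intro y
      rw [← Finset.mul_sum, Finset.sum_sub_distrib, hmean, sub_zero]
    simp only [h2] at h
    refine h.trans (le_of_eq ?_)
    congr 1
    rw [Finset.sum_const, Finset.card_univ, Fintype.card_fin, nsmul_eq_mul]
    ring
  -- This choice balances the two parts of the exponent: `θ ^ 2 * n' / 2` equals `ℓ`, the logarithm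
  -- of the number of one-sided constraints.
  set θ := √(2 * ℓ / n') with hθ
  have hθ0 : 0 < θ := by positivity
  have hθ2 : θ ^ 2 = 2 * ℓ / n' := Real.sq_sqrt (by positivity)
  set G : (Fin n' → Fin L) → ℝ := fun r => ∑ a, (Real.exp (θ * S a r) + Real.exp (-θ * S a r))
  have hG : ∫ r, G r ∂Measure.pi ν ≤ 2 * Fintype.card A * Real.exp (θ ^ 2 * n' / 2) := by
    simp only [G]
    rw [integral_finsetSum _ fun a _ => Integrable.of_finite]
    refine (Finset.sum_le_sum (g := fun _ => 2 * Real.exp (θ ^ 2 * n' / 2)) fun a _ => ?_).trans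
      (le_of_eq ?_)
    · rw [integral_add Integrable.of_finite Integrable.of_finite]
      have h1 := hmgf a θ
      have h2 := hmgf a (-θ)
      rw [neg_sq] at h2
      linarith
    · rw [Finset.sum_const, Finset.card_univ, nsmul_eq_mul]
      ring
  -- Probabilistic method: some choice is no worse than the average, and each term of `G` is bounded
  -- by the whole sum.
  obtain ⟨r, hr⟩ := exists_le_integral (μ := Measure.pi ν) (f := G) Integrable.of_finite
  refine ⟨r, fun a => ?_⟩
  have hval : 2 * Fintype.card A * Real.exp (θ ^ 2 * n' / 2) = Real.exp (2 * ℓ) := by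
    rw [hθ2, show 2 * ℓ / n' * n' / 2 = ℓ by field_simp, two_mul ℓ, Real.exp_add, hℓ,
      Real.exp_log (by positivity)]
  have hle : Real.exp (θ * S a r) + Real.exp (-θ * S a r) ≤ Real.exp (2 * ℓ) := by
    refine le_trans ?_ ((hr.trans hG).trans_eq hval)
    exact Finset.single_le_sum
      (f := fun a => Real.exp (θ * S a r) + Real.exp (-θ * S a r))
      (fun a _ => by positivity) (Finset.mem_univ a)
  have h1 : θ * S a r ≤ 2 * ℓ := Real.exp_le_exp.1 (by linarith [Real.exp_pos (-θ * S a r)])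
  have h2 : -θ * S a r ≤ 2 * ℓ := Real.exp_le_exp.1 (by linarith [Real.exp_pos (θ * S a r)])
  have h3 : θ * |S a r| ≤ 2 * ℓ := by
    rcases abs_cases (S a r) with h | h <;> rw [h.1] <;> linarith
  have h4 : 2 * ℓ = θ * √(2 * n' * ℓ) := by
    rw [hθ, ← Real.sqrt_mul (by positivity),
      show 2 * ℓ / n' * (2 * n' * ℓ) = (2 * ℓ) ^ 2 by field_simp, Real.sqrt_sq (by positivity)]
  exact le_of_mul_le_mul_left (h3.trans_eq h4) hθ0

/-- Columns of small coherence; for `n ≥ K` the cyclic assignment has coherence zero. -/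
theorem exists_columns {k n : ℕ} (hk : 1 ≤ k) (hn : 1 ≤ n) :
    ∃ col : Fin n → ℕ, (∀ i, col i < hadamardDim k) ∧
      (hadamardDim k ≤ n → ∀ i, col i = (i : ℕ) % hadamardDim k) ∧
      (∀ i, (n : ℝ) ≤ 2 * (((Finset.univ.image col).card : ℝ) *
        ((Finset.univ.filter fun i' => col i' = col i).card : ℝ))) ∧
      ∃ μ₀ : ℝ, 0 ≤ μ₀ ∧
        μ₀ ^ 2 ≤ (if hadamardDim k ≤ n then 0 else 4 * Real.log (2 * (k : ℝ) ^ 2) / n) ∧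
        ∀ x x' : Fin k, x ≠ x' → |∑ j ∈ Finset.univ.image col,
          hadamard (hadamardLog k) x j * hadamard (hadamardLog k) x' j| ≤
            μ₀ * (Finset.univ.image col).card := by
  have hkK := lt_hadamardDim k
  have hn0 : (0 : ℝ) < n := by exact_mod_cast hn
  by_cases hK : hadamardDim k ≤ n
  · have himg := image_mod (by omega) hK id
    have hcard : ((Finset.univ.image fun i : Fin n => id ((i : ℕ) % hadamardDim k)).card) =
      hadamardDim k := by rw [himg]; simp
    refine ⟨fun i => id (i % hadamardDim k), fun i => Nat.mod_lt _ (by omega), fun _ _ => rfl,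
      fun i => ?_, 0, le_rfl, by simp [hK], fun x x' hx => ?_⟩
    · rw [hcard]
      exact_mod_cast le_fiber_card_mod (by omega) hK id i
    · rw [himg, Finset.image_id, hadamardDim, sum_hadamard_mul_of_ne]
      · simp
      · exact x.2.trans hkK
      · exact x'.2.trans hkK
      · exact fun h => hx (Fin.ext h)
  · rw [not_le] at hK
    -- The largest power of two `n' ≤ n` divides `K`. One column is chosen from each of the `n'`
    -- consecutive blocks of length `L`, and the users cycle through the chosen columns.
    set a := Nat.log 2 n with ha
    have ha1 : 2 ^ a ≤ n := Nat.pow_log_le_self 2 (by omega)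
    have ha2 : n < 2 ^ (a + 1) := Nat.lt_pow_succ_log_self (by norm_num) n
    have ham : a ≤ hadamardLog k := by
      have : 2 ^ a < 2 ^ hadamardLog k := ha1.trans_lt hK
      exact ((Nat.pow_lt_pow_iff_right (by norm_num)).1 this).le
    set n' := 2 ^ a with hn'
    set L := 2 ^ (hadamardLog k - a) with hL
    have hn'0 : 0 < n' := by positivity
    have hL0 : 0 < L := by positivity
    have hnL : n' * L = 2 ^ hadamardLog k := by
      rw [hn', hL, ← pow_add]
      congr 1
      omega
    have : Nonempty (Fin k) := ⟨⟨0, hk⟩⟩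
    set H : ℕ → ℕ → ℝ := hadamard (hadamardLog k) with hH
    obtain ⟨r, hr⟩ := exists_balanced_choice (A := Fin k × Fin k) hn'0 hL0
      (fun q j => if q.1 = q.2 then 0 else H q.1 j * H q.2 j) (fun q j => by
        split_ifs
        · simp
        · rw [Set.mem_Icc, ← abs_le, abs_mul, abs_hadamard, abs_hadamard, one_mul])
      (fun q => by
        by_cases hq : q.1 = q.2
        · simp [hq]
        · simp only [hq, if_false]
          rw [hnL, sum_hadamard_mul_of_ne (q.1.2.trans hkK) (q.2.2.trans hkK)
            fun h => hq (Fin.ext h)])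
    set c : ℕ → ℕ := fun i => if h : i < n' then r ⟨i, h⟩ + L * i else 0 with hc
    have hcv : ∀ i : Fin n', c i = r i + L * i := fun i => by simp [hc]
    -- The block can be recovered from the column, so the chosen columns are distinct.
    have hdiv : ∀ i : Fin n', c i / L = i := fun i => by
      rw [hcv, Nat.add_mul_div_left _ _ hL0, Nat.div_eq_of_lt (r i).2, zero_add]
    have hinj : Set.InjOn c (Finset.range n') := by
      intro i hi j hj hij
      have h1 := hdiv ⟨i, Finset.mem_range.1 hi⟩
      have h2 := hdiv ⟨j, Finset.mem_range.1 hj⟩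
      simp only at h1 h2
      rw [← h1, ← h2, hij]
    have himg := image_mod (n := n) hn'0 ha1 c
    have hcard : ((Finset.univ.image fun i : Fin n => c ((i : ℕ) % n')).card) = n' := by
      rw [himg, Finset.card_image_of_injOn hinj, Finset.card_range]
    have hn'R : (0 : ℝ) < n' := by exact_mod_cast hn'0
    have hnn' : (n : ℝ) ≤ 2 * n' := by
      have : n ≤ 2 * n' := by rw [hn', ← pow_succ']; exact ha2.le
      exact_mod_cast this
    have hlog : 0 ≤ Real.log (2 * (k : ℝ) ^ 2) := by
      have : (1 : ℝ) ≤ k := by exact_mod_cast hk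
      exact Real.log_nonneg (by nlinarith)
    refine ⟨fun i => c (i % n'), fun i => ?_, fun h => absurd h (not_le.2 hK), fun i => ?_,
      √(2 * Real.log (2 * (k : ℝ) ^ 2) / n'), Real.sqrt_nonneg _, ?_, fun x x' hx => ?_⟩
    · have h1 := hcv ⟨i % n', Nat.mod_lt _ hn'0⟩
      have h2 := (r ⟨i % n', Nat.mod_lt _ hn'0⟩).2
      have h3 : (i : ℕ) % n' + 1 ≤ n' := Nat.mod_lt _ hn'0
      have h4 := Nat.mul_le_mul_left L h3
      simp only at h1
      show c (i % n') < 2 ^ hadamardLog k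
      rw [h1, ← hnL, mul_comm n' L]
      rw [mul_add] at h4
      omega
    · rw [hcard]
      exact_mod_cast le_fiber_card_mod hn'0 ha1 c i
    · rw [if_neg (not_le.2 hK), Real.sq_sqrt (by positivity), div_le_div_iff₀ hn'R hn0]
      nlinarith
    · have h := hr (x, x')
      simp only [hx, if_false, Fintype.card_prod, Fintype.card_fin] at h
      rw [hcard, himg, Finset.sum_image hinj, Finset.sum_range]
      simp only [hcv]
      refine h.trans (le_of_eq ?_)
      push_cast
      rw [← pow_two, ← Real.sqrt_sq hn'R.le, ← Real.sqrt_mul (by positivity),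
        Real.sqrt_sq hn'R.le]
      congr 1
      field_simp

/-! ### Upper bounds -/

theorem rate_pos {k s : ℕ} (hs : 1 ≤ s) {ε α : ℝ} (hε : 0 < ε) (hα : 0 < α) :
    0 < rate k s ε α := by
  have : (0 : ℝ) < s := by exact_mod_cast hs
  have : 0 < max (Real.log ((k : ℝ) / s)) 1 := lt_max_of_lt_right one_pos
  unfold rate
  positivity

theorem isLDP_hrChannel {k : ℕ} {ε : ℝ} (hε : 0 < ε) (j : ℕ) : IsLDP ε (hrChannel k ε j) := by
  classical
  have key : ∀ b b' : Bool, responseProb ε b ≤ Real.exp ε * responseProb ε b' := by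
    intro b b'
    have h1 : 1 < Real.exp ε := Real.one_lt_exp_iff.2 hε
    have h0 : 0 < Real.exp ε + 1 := by positivity
    unfold responseProb
    split_ifs <;> rw [← mul_div_assoc] <;> gcongr <;> nlinarith
  intro x x' y
  simp only [hrChannel, randomizedResponse, PMF.ofFintype_apply]
  rw [← ENNReal.ofReal_mul (Real.exp_pos _).le]
  exact ENNReal.ofReal_le_ofReal (key _ _)

/-- The Hadamard Response protocol with sparse projection. -/
theorem hadamard_response_protocol {E : ℝ} (hE : 0 < E) : ∃ C : ℝ, 0 < C ∧
    ∀ (k s n : ℕ) (ε α : ℝ), 1 ≤ s → s ≤ k → 0 < ε → ε ≤ E → 0 < α → α < 1 →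
      C * rate k s ε α ≤ n →
      1 ≤ n ∧ ∃ col : Fin n → ℕ, (∀ i, col i < hadamardDim k) ∧
        (hadamardDim k ≤ n → ∀ i, col i = (i : ℕ) % hadamardDim k) ∧
        ∀ est : (Fin n → Bool) → PMF (Fin k),
          (∀ y, IsSparseProjection s (hrEstimate k ε col y) (est y)) →
          ∀ p : PMF (Fin k), IsSparse s p →
            (9 / 10 : ℝ≥0∞) ≤ successProb (fun i => hrChannel k ε (col i)) est α p := by
  set M := Real.exp E + 1 with hM
  have hM0 : 0 < M := by positivity
  -- The first term makes the noise contribute at most `α ^ 2 / 2`, using `c ≤ M / ε`; the second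
  -- does the same for the bias.
  refine ⟨1536 * M ^ 2 + 320 * E ^ 2, by positivity, ?_⟩
  intro k s n ε α hs hsk hε hεE hα hα1 hn
  have hrp := rate_pos (k := k) hs hε hα
  have hn0 : (0 : ℝ) < n := lt_of_lt_of_le (by positivity) hn
  have hn1 : 1 ≤ n := by exact_mod_cast hn0
  have hk1 : 1 ≤ k := hs.trans hsk
  have hs0 : (1 : ℝ) ≤ s := by exact_mod_cast hs
  have hk0 : (1 : ℝ) ≤ k := by exact_mod_cast hk1
  obtain ⟨col, hcol, hcyc, hbal, μ₀, hμ, hμ2, hcoh⟩ := exists_columns hk1 hn1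
  refine ⟨hn1, col, hcol, hcyc, fun est hest p hp =>
    successProb_hr hs hsk hn1 hε hα col hbal rfl hcoh hμ ?_ est hest p hp⟩
  set ℓ := max (Real.log ((k : ℝ) / s)) 1 with hℓ
  have hℓ1 : 1 ≤ ℓ := le_max_right _ _
  have hrate : rate k s ε α * (α ^ 2 * ε ^ 2) = s ^ 2 * ℓ := by
    unfold rate
    rw [div_mul_cancel₀ _ (by positivity)]
  have he1 : ε ≤ Real.exp ε - 1 := by linarith [Real.add_one_le_exp ε]
  have hcM : (Real.exp ε + 1) / (Real.exp ε - 1) ≤ M / ε := by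
    have : Real.exp ε ≤ Real.exp E := Real.exp_le_exp.2 hεE
    rw [hM]
    gcongr
  have hc0 : 0 ≤ (Real.exp ε + 1) / (Real.exp ε - 1) := by
    have : 0 < Real.exp ε - 1 := lt_of_lt_of_le hε he1
    positivity
  set c := (Real.exp ε + 1) / (Real.exp ε - 1) with hc
  have hsq : (1536 * M ^ 2 + 320 * E ^ 2) * (s ^ 2 * ℓ) ≤ n * (α ^ 2 * ε ^ 2) := by
    rw [← hrate, ← mul_assoc]
    gcongr
  have hS0 : 0 ≤ (s : ℝ) ^ 2 * ℓ := by positivity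
  have h1 : 768 * c ^ 2 * (s ^ 2 * ℓ) / n ≤ α ^ 2 / 2 := by
    have h2 : 768 * c ^ 2 * (s ^ 2 * ℓ) ≤ 768 * (M / ε) ^ 2 * (s ^ 2 * ℓ) := by gcongr
    rw [div_le_iff₀ hn0]
    refine h2.trans ?_
    rw [div_pow, mul_div_assoc', div_mul_eq_mul_div, div_le_iff₀ (by positivity)]
    nlinarith [mul_nonneg (sq_nonneg E) hS0]
  have h2 : 8 * (s : ℝ) ^ 2 * μ₀ ^ 2 ≤ α ^ 2 / 2 := by
    by_cases hK : hadamardDim k ≤ n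
    · rw [if_pos hK] at hμ2
      have : μ₀ ^ 2 = 0 := le_antisymm hμ2 (sq_nonneg _)
      rw [this, mul_zero]
      positivity
    · rw [if_neg hK] at hμ2
      have hE2 : ε ^ 2 ≤ E ^ 2 := by gcongr
      have hb : 320 * (s ^ 2 * ℓ) ≤ n * α ^ 2 := by
        have h3 : 320 * E ^ 2 * (s ^ 2 * ℓ) ≤ n * (α ^ 2 * E ^ 2) := by
          calc 320 * E ^ 2 * (s ^ 2 * ℓ) ≤ (1536 * M ^ 2 + 320 * E ^ 2) * (s ^ 2 * ℓ) := by
                gcongr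
                nlinarith [sq_nonneg M]
            _ ≤ n * (α ^ 2 * ε ^ 2) := hsq
            _ ≤ n * (α ^ 2 * E ^ 2) := by gcongr
        have hEp : 0 < E ^ 2 := by positivity
        nlinarith
      have hnk : (n : ℝ) ≤ 2 * k := by
        have := hadamardDim_le hk1
        have : n ≤ 2 * k := by omega
        exact_mod_cast this
      -- With fewer users than columns, `320 * (s ^ 2 * ℓ) ≤ n * α ^ 2 ≤ 2 * k`. Then `s ≤ √k`, and
      -- `log k ≤ 2 * ℓ`.
      have hsk2 : (s : ℝ) ^ 2 ≤ k := by
        have h4 : (s : ℝ) ^ 2 ≤ s ^ 2 * ℓ := le_mul_of_one_le_right (by positivity) hℓ1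
        have h5 : n * α ^ 2 ≤ n := mul_le_of_le_one_right hn0.le (pow_le_one₀ hα.le hα1.le)
        linarith
      have hlogk : Real.log k ≤ 2 * ℓ := by
        have h4 : Real.log ((s : ℝ) ^ 2) ≤ Real.log k := Real.log_le_log (by positivity) hsk2
        rw [Real.log_pow] at h4
        have h5 : Real.log ((k : ℝ) / s) ≤ ℓ := le_max_left _ _
        rw [Real.log_div (by positivity) (by positivity)] at h5
        push_cast at h4
        linarith
      have hlog2 : Real.log (2 * (k : ℝ) ^ 2) ≤ 5 * ℓ := by
        rw [Real.log_mul (by norm_num) (by positivity), Real.log_pow]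
        push_cast
        linarith [Real.log_two_lt_d9]
      have h6 : μ₀ ^ 2 ≤ 20 * ℓ / n := hμ2.trans (div_le_div_of_nonneg_right (by linarith) hn0.le)
      calc 8 * (s : ℝ) ^ 2 * μ₀ ^ 2 ≤ 8 * (s : ℝ) ^ 2 * (20 * ℓ / n) := by gcongr
        _ = 160 * (s ^ 2 * ℓ) / n := by ring
        _ ≤ α ^ 2 / 2 := by
          rw [div_le_iff₀ hn0]
          linarith
  linarith

end SparseLDP
end

noncomputable section

namespace SparseLDP

/-! ### Change of measure -/

theorem integrable_of_bounded {Ω : Type*} [Countable Ω] [MeasurableSpace Ω]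
    [MeasurableSingletonClass Ω] (μ : Measure Ω) [IsProbabilityMeasure μ] {f : Ω → ℝ} {C : ℝ}
    (hf : ∀ y, |f y| ≤ C) : Integrable f μ :=
  Integrable.of_bound (measurable_of_countable f).aestronglyMeasurable C (ae_of_all _ hf)

theorem ofReal_div_mul_le (p q : ℝ≥0∞) (hp : p ≠ ⊤) (hq : q ≠ ⊤) :
    ENNReal.ofReal (q.toReal / p.toReal) * p ≤ q := by
  rcases eq_or_ne p 0 with rfl | h
  · simp
  · nth_rewrite 2 [← ENNReal.ofReal_toReal hp]
    rw [← ENNReal.ofReal_mul (by positivity), div_mul_cancel₀ _ (ENNReal.toReal_ne_zero.2 ⟨h, hp⟩),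
      ENNReal.ofReal_toReal hq]

theorem div_le_of_le_mul_of_nonneg {a b D : ℝ} (hb : 0 ≤ b) (hD : 0 ≤ D) (h : a ≤ D * b) :
    a / b ≤ D :=
  div_le_of_le_mul₀ hb hD h

theorem abs_indicator_one_le {Ω : Type*} (s : Set Ω) (y : Ω) :
    |s.indicator (fun _ => (1 : ℝ)) y| ≤ 1 := by
  classical
  rw [Set.indicator_apply]
  split_ifs <;> simp

/-- If no outcome belongs to more than a fraction `π` of the events `Ev z`, then the average
probability of `Ev z` under product measures `P z` is controlled by the `χ²`-divergences to a
common product measure. -/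
theorem change_of_measure {Z ι M : Type*} [Fintype Z] [Fintype ι] [Countable M]
    [MeasurableSpace M] [MeasurableSingletonClass M] (P : Z → ι → PMF M) (Q : ι → PMF M) {D : ℝ}
    (hD : 0 ≤ D) (hPQ : ∀ z i y, (P z i y).toReal ≤ D * (Q i y).toReal)
    (hQP : ∀ z i y, (Q i y).toReal ≤ D * (P z i y).toReal) (Ev : Z → Set (ι → M)) {π lam : ℝ}
    (hlam : 0 ≤ lam)
    (hEv : ∀ y, ∑ z, (Ev z).indicator (fun _ => (1 : ℝ)) y ≤ Fintype.card Z * π) (a : ℝ) :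
    ∑ z, (1 - a + lam * (Measure.pi fun i => (P z i).toMeasure).real (Ev z) -
      ∑ i, ∫ y, ((P z i y).toReal / (Q i y).toReal - 1) ∂(P z i).toMeasure) ≤
    Real.exp (-a) * (Fintype.card Z * (1 + (Real.exp lam - 1) * π)) := by
  classical
  set μ : Z → Measure (ι → M) := fun z => Measure.pi fun i => (P z i).toMeasure with hμ
  set χ : Z → ι → M → ℝ := fun z i y => (P z i y).toReal / (Q i y).toReal - 1 with hχ
  set I : Z → (ι → M) → ℝ := fun z => (Ev z).indicator fun _ => (1 : ℝ) with hI
  -- The likelihood ratio `Q / P z` makes the `P z`-integral of `f z` at most the `Q`-mean of `exp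
  -- (lam * I z - a)`. From below, `1 + w ≤ exp w` is used, and `log` of `P z / Q` is bounded by
  -- `χ`.
  set f : Z → (ι → M) → ℝ := fun z y => Real.exp (lam * I z y - a) *
    ∏ i, ((Q i (y i)).toReal / (P z i (y i)).toReal) with hf
  have hI1 : ∀ z y, |I z y| ≤ 1 := fun z y => abs_indicator_one_le _ _
  have hsing : ∀ z y, μ z {y} = ∏ i, P z i (y i) := by
    intro z y
    simp only [hμ]
    rw [Measure.pi_singleton]
    exact Finset.prod_congr rfl fun i _ => PMF.toMeasure_apply_singleton _ _
      (measurableSet_singleton _)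
  have hf0 : ∀ z y, 0 ≤ f z y := fun z y => by
    simp only [hf]
    exact mul_nonneg (Real.exp_pos _).le (Finset.prod_nonneg fun i _ => by positivity)
  have hfb : ∀ z y, |f z y| ≤ Real.exp (lam - a) * ∏ _i : ι, D := by
    intro z y
    rw [abs_of_nonneg (hf0 z y)]
    simp only [hf]
    refine mul_le_mul ?_ (Finset.prod_le_prod (fun i _ => by positivity) fun i _ =>
      div_le_of_le_mul_of_nonneg ENNReal.toReal_nonneg hD (hQP z i (y i)))
      (Finset.prod_nonneg fun i _ => by positivity) (Real.exp_pos _).le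
    refine Real.exp_le_exp.2 ?_
    have := (abs_le.1 (hI1 z y)).2
    nlinarith
  have hχb : ∀ z i y, |χ z i y| ≤ D + 1 := by
    intro z i y
    have h1 := div_le_of_le_mul_of_nonneg ENNReal.toReal_nonneg hD (hPQ z i y)
    have h2 : 0 ≤ (P z i y).toReal / (Q i y).toReal := by positivity
    simp only [hχ]
    rw [abs_le]
    constructor <;> linarith
  -- pointwise comparison
  have hpt : ∀ z, ∀ᵐ y ∂μ z, 1 - a + lam * I z y - ∑ i, χ z i (y i) ≤ f z y := by
    intro z
    rw [ae_iff_of_countable]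
    intro y hy
    rw [hsing, Finset.prod_ne_zero_iff] at hy
    have hP : ∀ i, 0 < (P z i (y i)).toReal := fun i =>
      ENNReal.toReal_pos (hy i (Finset.mem_univ i)) (PMF.apply_ne_top _ _)
    have hQ : ∀ i, 0 < (Q i (y i)).toReal := by
      intro i
      refine lt_of_le_of_ne ENNReal.toReal_nonneg fun h0 => ?_
      have := hPQ z i (y i)
      rw [← h0, mul_zero] at this
      exact absurd (hP i) (not_lt.2 this)
    have hprod : ∏ i, ((Q i (y i)).toReal / (P z i (y i)).toReal) =
        Real.exp (-∑ i, Real.log ((P z i (y i)).toReal / (Q i (y i)).toReal)) := by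
      rw [← Finset.sum_neg_distrib, Real.exp_sum]
      refine Finset.prod_congr rfl fun i _ => ?_
      rw [Real.exp_neg, Real.exp_log (div_pos (hP i) (hQ i)), inv_div]
    have hlog : ∑ i, Real.log ((P z i (y i)).toReal / (Q i (y i)).toReal) ≤ ∑ i, χ z i (y i) :=
      Finset.sum_le_sum fun i _ => Real.log_le_sub_one_of_pos (div_pos (hP i) (hQ i))
    simp only [hf]
    rw [hprod, ← Real.exp_add]
    refine le_trans ?_ (Real.add_one_le_exp _)
    linarith
  have hint : ∀ z, 1 - a + lam * (μ z).real (Ev z) - ∑ i, ∫ y, χ z i y ∂(P z i).toMeasure ≤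
      ∫ y, f z y ∂μ z := by
    intro z
    have hi1 : Integrable (I z) (μ z) := integrable_of_bounded _ (hI1 z)
    have hi2 : ∀ i, Integrable (fun y : ι → M => χ z i (y i)) (μ z) := fun i =>
      integrable_of_bounded _ fun y => hχb z i (y i)
    have hi3 : Integrable (fun y : ι → M => ∑ i, χ z i (y i)) (μ z) :=
      integrable_finsetSum _ fun i _ => hi2 i
    have hi4 : Integrable (fun y => 1 - a + lam * I z y) (μ z) :=
      (integrable_const _).add (hi1.const_mul _)
    have h1 : ∫ y, I z y ∂μ z = (μ z).real (Ev z) := by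
      simp only [hI]
      exact integral_indicator_one (Set.to_countable _).measurableSet
    have h2 : ∀ i, ∫ y, χ z i (y i) ∂μ z = ∫ y, χ z i y ∂(P z i).toMeasure := fun i =>
      integral_comp_eval (μ := fun i => (P z i).toMeasure)
        (measurable_of_countable (χ z i)).aestronglyMeasurable
    have h3 : ∫ y, (1 - a + lam * I z y - ∑ i, χ z i (y i)) ∂μ z =
        1 - a + lam * (μ z).real (Ev z) - ∑ i, ∫ y, χ z i y ∂(P z i).toMeasure := by
      rw [integral_sub hi4 hi3,
        integral_add (integrable_const _) (hi1.const_mul _), integral_const_mul, h1,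
        integral_finsetSum _ fun i _ => hi2 i]
      simp [h2]
    rw [← h3]
    exact integral_mono_ae (hi4.sub hi3)
      (integrable_of_bounded _ (hfb z)) (hpt z)
  -- change of measure
  have hcm : ∀ z, ENNReal.ofReal (∫ y, f z y ∂μ z) ≤
      ∑' y : ι → M, ENNReal.ofReal (Real.exp (lam * I z y - a)) * ∏ i, Q i (y i) := by
    intro z
    rw [ofReal_integral_eq_lintegral_ofReal (integrable_of_bounded _ (hfb z))
      (ae_of_all _ (hf0 z)), lintegral_countable']
    refine ENNReal.tsum_le_tsum fun y => ?_
    simp only [hf]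
    rw [hsing, ENNReal.ofReal_mul (Real.exp_pos _).le, mul_assoc,
      ENNReal.ofReal_prod_of_nonneg fun i _ => by positivity, ← Finset.prod_mul_distrib]
    gcongr with i _
    exact ofReal_div_mul_le _ _ (PMF.apply_ne_top _ _) (PMF.apply_ne_top _ _)
  set R := Real.exp (-a) * (Fintype.card Z * (1 + (Real.exp lam - 1) * π)) with hR
  have hexpI : ∀ z y, Real.exp (lam * I z y - a) =
      Real.exp (-a) * (1 + (Real.exp lam - 1) * I z y) := by
    intro z y
    rw [sub_eq_neg_add, Real.exp_add]
    congr 1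
    simp only [hI, Set.indicator_apply]
    split_ifs <;> simp
  have hsumI : ∀ y, ∑ z, ENNReal.ofReal (Real.exp (lam * I z y - a)) ≤ ENNReal.ofReal R := by
    intro y
    rw [← ENNReal.ofReal_sum_of_nonneg fun z _ => (Real.exp_pos _).le]
    refine ENNReal.ofReal_le_ofReal ?_
    simp only [hexpI]
    rw [← Finset.mul_sum, Finset.sum_add_distrib, ← Finset.mul_sum, Finset.sum_const,
      Finset.card_univ, nsmul_eq_mul, mul_one, hR]
    have h1 : 0 ≤ Real.exp lam - 1 := by linarith [Real.add_one_le_exp lam]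
    have h2 := mul_le_mul_of_nonneg_left (hEv y) h1
    gcongr
    linarith
  have hQ1 : ∑' y : ι → M, ∏ i, Q i (y i) = 1 := by
    have h : ∫⁻ _ : ι → M, 1 ∂Measure.pi (fun i => (Q i).toMeasure) = 1 := by simp
    rw [lintegral_countable'] at h
    simpa [Measure.pi_singleton, PMF.toMeasure_apply_singleton] using h
  have htot : ENNReal.ofReal (∑ z, ∫ y, f z y ∂μ z) ≤ ENNReal.ofReal R := by
    rw [ENNReal.ofReal_sum_of_nonneg fun z _ => integral_nonneg (hf0 z)]
    calc ∑ z, ENNReal.ofReal (∫ y, f z y ∂μ z)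
        ≤ ∑ z, ∑' y : ι → M, ENNReal.ofReal (Real.exp (lam * I z y - a)) * ∏ i, Q i (y i) :=
          Finset.sum_le_sum fun z _ => hcm z
      _ = ∑' y : ι → M, (∑ z, ENNReal.ofReal (Real.exp (lam * I z y - a))) * ∏ i, Q i (y i) := by
          simp only [Finset.sum_mul]
          exact (Summable.tsum_finsetSum fun _ _ => ENNReal.summable).symm
      _ ≤ ∑' y : ι → M, ENNReal.ofReal R * ∏ i, Q i (y i) :=
          ENNReal.tsum_le_tsum fun y => mul_le_mul_left (hsumI y) _
      _ = ENNReal.ofReal R := by rw [ENNReal.tsum_mul_left, hQ1, mul_one]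
  refine (Finset.sum_le_sum fun z _ => hint z).trans ?_
  by_cases hZ : IsEmpty Z
  · simp [hR]
  · have hZ' : Nonempty Z := not_isEmpty_iff.1 hZ
    -- No sign of `π` is assumed; a negative `R` would contradict `hsumI`, whose left side is
    -- positive.
    have hR0 : 0 ≤ R := by
      by_contra hneg
      have hM : Nonempty (ι → M) := ⟨fun i => (Q i).support_nonempty.some⟩
      have h1 := hsumI hM.some
      rw [ENNReal.ofReal_of_nonpos (not_le.1 hneg).le, nonpos_iff_eq_zero,
        Finset.sum_eq_zero_iff] at h1
      have h2 := h1 hZ'.some (Finset.mem_univ _)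
      rw [ENNReal.ofReal_eq_zero] at h2
      exact absurd (Real.exp_pos _) (not_lt.2 h2)
    exact (ENNReal.ofReal_le_ofReal_iff hR0).1 htot

/-- Average `χ²`-divergence to the mixture. -/
theorem sum_chi_le {Z M : Type*} [Fintype Z] [Countable M] [MeasurableSpace M]
    [MeasurableSingletonClass M] (P : Z → PMF M) (Q : PMF M) {D V : ℝ} (hD : 0 ≤ D)
    (hPQ : ∀ z y, (P z y).toReal ≤ D * (Q y).toReal)
    (hmix : ∀ y, ∑ z, (P z y).toReal = Fintype.card Z * (Q y).toReal)
    (hV : ∀ y, ∑ z, ((P z y).toReal - (Q y).toReal) ^ 2 ≤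
      Fintype.card Z * (V * (Q y).toReal ^ 2)) :
    ∑ z, ∫ y, ((P z y).toReal / (Q y).toReal - 1) ∂(P z).toMeasure ≤ Fintype.card Z * V := by
  have hsP : ∀ z, Summable fun y => (P z y).toReal := fun z =>
    ENNReal.summable_toReal (P z).tsum_coe_ne_top
  have hsQ : Summable fun y => (Q y).toReal := ENNReal.summable_toReal Q.tsum_coe_ne_top
  have hQ1 : ∑' y, (Q y).toReal = 1 := by
    rw [← ENNReal.tsum_toReal_eq fun y => Q.apply_ne_top y, Q.tsum_coe, ENNReal.toReal_one]
  have hb : ∀ z y, |(P z y).toReal / (Q y).toReal - 1| ≤ D + 1 := by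
    intro z y
    have h1 := div_le_of_le_mul_of_nonneg ENNReal.toReal_nonneg hD (hPQ z y)
    have h2 : 0 ≤ (P z y).toReal / (Q y).toReal := by positivity
    rw [abs_le]
    constructor <;> linarith
  have hsum : ∀ z, Summable fun y => (P z y).toReal • ((P z y).toReal / (Q y).toReal - 1) := by
    intro z
    refine Summable.of_norm_bounded ((hsP z).mul_right (D + 1)) fun y => ?_
    rw [smul_eq_mul, norm_mul, Real.norm_eq_abs, Real.norm_eq_abs,
      abs_of_nonneg ENNReal.toReal_nonneg]
    exact mul_le_mul_of_nonneg_left (hb z y) ENNReal.toReal_nonneg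
  simp only [fun z => PMF.integral_eq_tsum (P z) _ (integrable_of_bounded (P z).toMeasure (hb z))]
  rw [← Summable.tsum_finsetSum fun z _ => hsum z]
  have hpt : ∀ y, ∑ z, (P z y).toReal • ((P z y).toReal / (Q y).toReal - 1) ≤
      Fintype.card Z * V * (Q y).toReal := by
    intro y
    have hq0 : 0 ≤ (Q y).toReal := ENNReal.toReal_nonneg
    rcases hq0.eq_or_lt with hq | hq
    · have : ∀ z, (P z y).toReal = 0 := fun z =>
        le_antisymm (by simpa [← hq] using hPQ z y) ENNReal.toReal_nonneg
      simp [this, ← hq]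
    · set q := (Q y).toReal with hqd
      -- Since `q` is the average of the `P z y`, the second moment turns into a variance.
      have h1 : ∑ z, (P z y).toReal • ((P z y).toReal / q - 1) =
          (∑ z, ((P z y).toReal - q) ^ 2) / q := by
        have h2 : ∑ z, ((P z y).toReal - q) ^ 2 =
            ∑ z, (P z y).toReal ^ 2 - Fintype.card Z * q ^ 2 := by
          have : ∀ z, ((P z y).toReal - q) ^ 2 =
              (P z y).toReal ^ 2 - 2 * q * (P z y).toReal + q ^ 2 := fun z => by ring
          simp only [this, Finset.sum_add_distrib, Finset.sum_sub_distrib, ← Finset.mul_sum, hmix]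
          simp
          ring
        rw [h2]
        have h3 : ∀ z, (P z y).toReal • ((P z y).toReal / q - 1) =
            (P z y).toReal ^ 2 / q - (P z y).toReal := fun z => by rw [smul_eq_mul]; ring
        simp only [h3, Finset.sum_sub_distrib, hmix, ← Finset.sum_div, ← hqd]
        field_simp
      rw [h1, div_le_iff₀ hq]
      refine (hV y).trans (le_of_eq ?_)
      ring
  calc _ ≤ ∑' y, Fintype.card Z * V * (Q y).toReal :=
        Summable.tsum_le_tsum hpt (summable_sum fun z _ => hsum z) (hsQ.mul_left _)
    _ = Fintype.card Z * V := by rw [tsum_mul_left, hQ1, mul_one]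

end SparseLDP
end

noncomputable section

namespace SparseLDP

instance instDiscreteMeasurableSpaceListBool : DiscreteMeasurableSpace (List Bool) :=
  ⟨fun _ => trivial⟩

/-! ### Independent uniform choices -/

theorem integral_pi_uniform {t L : ℕ} [Nonempty (Fin L)] (f : (Fin t → Fin L) → ℝ) :
    ∫ z, f z ∂Measure.pi (fun _ => (PMF.uniformOfFintype (Fin L)).toMeasure) =
      (∑ z, f z) / Fintype.card (Fin t → Fin L) := by
  rw [integral_fintype Integrable.of_finite, Finset.sum_div]
  refine Finset.sum_congr rfl fun z _ => ?_
  rw [measureReal_def, Measure.pi_singleton]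
  simp [div_eq_inv_mul]

theorem card_pos_of_nonempty {t L : ℕ} [Nonempty (Fin L)] :
    (0 : ℝ) < Fintype.card (Fin t → Fin L) := by
  exact_mod_cast Fintype.card_pos

/-- Variances of independent terms add, so the bound grows with `t`, not `t ^ 2`; this is what makes
the lower bound quadratic in `s`. -/
theorem sum_sq_dev_le {t L : ℕ} [Nonempty (Fin L)] (h : Fin t → Fin L → ℝ) {m G A : ℝ}
    (hh : ∀ b c, h b c ∈ Set.Icc m (m + G))
    (hA : ∑ z : Fin t → Fin L, ∑ b, h b (z b) = Fintype.card (Fin t → Fin L) * A) :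
    ∑ z : Fin t → Fin L, (∑ b, h b (z b) - A) ^ 2 ≤
      Fintype.card (Fin t → Fin L) * (t * G ^ 2) := by
  have hc := card_pos_of_nonempty (t := t) (L := L)
  set κ : Fin t → Measure (Fin L) := fun _ => (PMF.uniformOfFintype (Fin L)).toMeasure with hκ
  have hvar := ProbabilityTheory.variance_sum_pi (μ := κ) (X := h) fun i => MemLp.of_discrete
  rw [ProbabilityTheory.variance_eq_integral (measurable_of_finite _).aemeasurable] at hvar
  have hmean : ∫ z, (∑ i, fun ω : Fin t → Fin L => h i (ω i)) z ∂Measure.pi κ = A := by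
    rw [integral_pi_uniform, div_eq_iff hc.ne', mul_comm A, ← hA]
    simp
  rw [hmean, integral_pi_uniform, div_eq_iff hc.ne'] at hvar
  have hb : ∀ b, ProbabilityTheory.variance (h b) (κ b) ≤ G ^ 2 := by
    intro b
    refine (ProbabilityTheory.variance_le_sq_of_bounded (ae_of_all _ (hh b))
      (measurable_of_finite _).aemeasurable).trans ?_
    rw [add_sub_cancel_left]
    nlinarith [sq_nonneg G]
  have hs : ∑ b, ProbabilityTheory.variance (h b) (κ b) ≤ t * G ^ 2 := by
    refine (Finset.sum_le_sum fun b _ => hb b).trans ?_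
    simp
  calc _ = (∑ b, ProbabilityTheory.variance (h b) (κ b)) * Fintype.card (Fin t → Fin L) := by
        rw [← hvar]
        simp
    _ ≤ t * G ^ 2 * Fintype.card (Fin t → Fin L) := by gcongr
    _ = _ := mul_comm _ _

/-! ### The hard family of sparse distributions -/

variable {k t L : ℕ}

/-- Weight `1 - γ` at `x₀`, and weight `γ / t` at each of the points `pt b (z b)`. -/
def spikeWeight (γ : ℝ) (x₀ : Fin k) (pt : Fin t → Fin L → Fin k) (z : Fin t → Fin L)
    (x : Fin k) : ℝ :=
  (if x = x₀ then 1 - γ else 0) + ∑ b, if x = pt b (z b) then γ / t else 0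

theorem spikeWeight_nonneg {γ : ℝ} (h0 : 0 ≤ γ) (h1 : γ ≤ 1) (x₀ : Fin k)
    (pt : Fin t → Fin L → Fin k) (z : Fin t → Fin L) (x : Fin k) :
    0 ≤ spikeWeight γ x₀ pt z x := by
  refine add_nonneg ?_ (Finset.sum_nonneg fun b _ => ?_)
  · split_ifs <;> linarith
  · split_ifs
    · positivity
    · exact le_rfl

theorem sum_spikeWeight_mul (γ : ℝ) (x₀ : Fin k) (pt : Fin t → Fin L → Fin k)
    (z : Fin t → Fin L) (F : Fin k → ℝ) :
    ∑ x, spikeWeight γ x₀ pt z x * F x = (1 - γ) * F x₀ + γ / t * ∑ b, F (pt b (z b)) := by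
  simp only [spikeWeight, add_mul, Finset.sum_add_distrib, Finset.sum_mul, ite_mul, zero_mul]
  rw [Finset.sum_comm]
  simp [Finset.mul_sum]

theorem sum_spikeWeight {γ : ℝ} (ht : 0 < t) (x₀ : Fin k) (pt : Fin t → Fin L → Fin k)
    (z : Fin t → Fin L) : ∑ x, spikeWeight γ x₀ pt z x = 1 := by
  have h := sum_spikeWeight_mul γ x₀ pt z fun _ => 1
  have ht' : (t : ℝ) ≠ 0 := by exact_mod_cast ht.ne'
  simp only [mul_one, Finset.sum_const, Finset.card_univ, Fintype.card_fin, nsmul_eq_mul] at h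
  rw [h]
  field_simp
  ring

/-- The distribution with weights `spikeWeight`. -/
def spikePMF {γ : ℝ} (h0 : 0 ≤ γ) (h1 : γ ≤ 1) (ht : 0 < t) (x₀ : Fin k)
    (pt : Fin t → Fin L → Fin k) (z : Fin t → Fin L) : PMF (Fin k) :=
  PMF.ofFintype (fun x => ENNReal.ofReal (spikeWeight γ x₀ pt z x)) (by
    rw [← ENNReal.ofReal_sum_of_nonneg fun x _ => spikeWeight_nonneg h0 h1 x₀ pt z x,
      sum_spikeWeight ht, ENNReal.ofReal_one])

theorem spikePMF_toReal {γ : ℝ} (h0 : 0 ≤ γ) (h1 : γ ≤ 1) (ht : 0 < t) (x₀ : Fin k)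
    (pt : Fin t → Fin L → Fin k) (z : Fin t → Fin L) (x : Fin k) :
    (spikePMF h0 h1 ht x₀ pt z x).toReal = spikeWeight γ x₀ pt z x := by
  rw [spikePMF, PMF.ofFintype_apply, ENNReal.toReal_ofReal (spikeWeight_nonneg h0 h1 x₀ pt z x)]

theorem bind_toReal {M : Type} (p : PMF (Fin k)) (W : Channel k M) (y : M) :
    ((p.bind W) y).toReal = ∑ x, (p x).toReal * (W x y).toReal := by
  rw [PMF.bind_apply, tsum_fintype, ENNReal.toReal_sum]
  · simp [ENNReal.toReal_mul]
  · exact fun x _ => ENNReal.mul_ne_top (p.apply_ne_top _) (PMF.apply_ne_top _ _)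

theorem IsLDP.toReal_le {M : Type} {ε : ℝ} {W : Channel k M} (h : IsLDP ε W) (x x' : Fin k)
    (y : M) : (W x y).toReal ≤ Real.exp ε * (W x' y).toReal := by
  have := ENNReal.toReal_mono (ENNReal.mul_ne_top ENNReal.ofReal_ne_top (PMF.apply_ne_top _ _))
    (h x x' y)
  rwa [ENNReal.toReal_mul, ENNReal.toReal_ofReal (Real.exp_pos ε).le] at this

/-- Message distributions of the hard family under one private channel: they are within a factor
`e^ε` of their mixture, and have small average `χ²`-divergence to it. -/
theorem spike_channel_bounds {M : Type} [Countable M] [MeasurableSpace M]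
    [MeasurableSingletonClass M] [Nonempty (Fin L)] {γ ε : ℝ} (hε : 0 < ε) (h0 : 0 ≤ γ)
    (h1 : γ ≤ 1) (ht : 0 < t) (x₀ : Fin k) (pt : Fin t → Fin L → Fin k) (W : Channel k M)
    (hW : IsLDP ε W) :
    ∃ Q : PMF M,
      (∀ z y, (((spikePMF h0 h1 ht x₀ pt z).bind W) y).toReal ≤ Real.exp ε * (Q y).toReal) ∧
      (∀ z y, (Q y).toReal ≤ Real.exp ε * (((spikePMF h0 h1 ht x₀ pt z).bind W) y).toReal) ∧
      ∑ z, ∫ y, ((((spikePMF h0 h1 ht x₀ pt z).bind W) y).toReal / (Q y).toReal - 1)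
          ∂((spikePMF h0 h1 ht x₀ pt z).bind W).toMeasure ≤
        Fintype.card (Fin t → Fin L) * (γ ^ 2 / t * (Real.exp ε - 1) ^ 2) := by
  have hc := card_pos_of_nonempty (t := t) (L := L)
  have ht0 : (0 : ℝ) < t := by exact_mod_cast ht
  set P : (Fin t → Fin L) → PMF M := fun z => (spikePMF h0 h1 ht x₀ pt z).bind W with hP
  set Q : PMF M := (PMF.uniformOfFintype (Fin t → Fin L)).bind P with hQ
  have hmix : ∀ y, ∑ z, (P z y).toReal = Fintype.card (Fin t → Fin L) * (Q y).toReal := by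
    intro y
    rw [hQ, PMF.bind_apply, tsum_fintype, ENNReal.toReal_sum fun z _ =>
      ENNReal.mul_ne_top (PMF.apply_ne_top _ _) (PMF.apply_ne_top _ _), Finset.mul_sum]
    refine Finset.sum_congr rfl fun z _ => ?_
    rw [PMF.uniformOfFintype_apply, ENNReal.toReal_mul, ENNReal.toReal_inv, ENNReal.toReal_natCast,
      mul_inv_cancel_left₀ hc.ne']
  have : Nonempty (Fin k) := ⟨x₀⟩
  -- the range of the channel at a fixed message
  have key : ∀ y, ∃ m : ℝ, 0 ≤ m ∧ (∀ x, (W x y).toReal ∈ Set.Icc m (Real.exp ε * m)) ∧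
      (∀ z, (P z y).toReal ∈ Set.Icc m (Real.exp ε * m)) ∧
      (Q y).toReal ∈ Set.Icc m (Real.exp ε * m) := by
    intro y
    obtain ⟨x₁, hx₁⟩ := Finite.exists_min fun x => (W x y).toReal
    have hWx : ∀ x, (W x y).toReal ∈ Set.Icc (W x₁ y).toReal (Real.exp ε * (W x₁ y).toReal) :=
      fun x => ⟨hx₁ x, hW.toReal_le x x₁ y⟩
    have hPz : ∀ z, (P z y).toReal ∈ Set.Icc (W x₁ y).toReal (Real.exp ε * (W x₁ y).toReal) := by
      intro z
      simp only [hP]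
      rw [bind_toReal]
      have hs := sum_toReal_pmf (spikePMF h0 h1 ht x₀ pt z)
      constructor
      · calc (W x₁ y).toReal = ∑ x, (spikePMF h0 h1 ht x₀ pt z x).toReal * (W x₁ y).toReal := by
              rw [← Finset.sum_mul, hs, one_mul]
          _ ≤ _ := Finset.sum_le_sum fun x _ =>
              mul_le_mul_of_nonneg_left (hWx x).1 ENNReal.toReal_nonneg
      · calc _ ≤ ∑ x, (spikePMF h0 h1 ht x₀ pt z x).toReal * (Real.exp ε * (W x₁ y).toReal) :=
              Finset.sum_le_sum fun x _ =>
                mul_le_mul_of_nonneg_left (hWx x).2 ENNReal.toReal_nonneg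
          _ = _ := by rw [← Finset.sum_mul, hs, one_mul]
    refine ⟨(W x₁ y).toReal, ENNReal.toReal_nonneg, hWx, hPz, ?_⟩
    have hm := hmix y
    constructor
    · have h2 := Finset.sum_le_sum fun z (_ : z ∈ Finset.univ) => (hPz z).1
      rw [hm, Finset.sum_const, Finset.card_univ, nsmul_eq_mul] at h2
      exact le_of_mul_le_mul_left h2 hc
    · have h2 := Finset.sum_le_sum fun z (_ : z ∈ Finset.univ) => (hPz z).2
      rw [hm, Finset.sum_const, Finset.card_univ, nsmul_eq_mul] at h2
      exact le_of_mul_le_mul_left h2 hc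
  have hPQ : ∀ z y, (P z y).toReal ≤ Real.exp ε * (Q y).toReal := by
    intro z y
    obtain ⟨m, -, -, h2, h3⟩ := key y
    exact (h2 z).2.trans (mul_le_mul_of_nonneg_left h3.1 (Real.exp_pos _).le)
  refine ⟨Q, hPQ, ?_, ?_⟩
  · intro z y
    obtain ⟨m, -, -, h2, h3⟩ := key y
    exact h3.2.trans (mul_le_mul_of_nonneg_left (h2 z).1 (Real.exp_pos _).le)
  · refine sum_chi_le P Q (Real.exp_pos ε).le hPQ hmix fun y => ?_
    obtain ⟨m, hm, h2, h3, h4⟩ := key y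
    have hexp : 0 ≤ Real.exp ε - 1 := by linarith [Real.add_one_le_exp ε]
    set q := (Q y).toReal with hq
    set h : Fin t → Fin L → ℝ := fun b c => (W (pt b c) y).toReal with hh
    -- At a fixed message the probability is affine in a sum of independent choices; `x₀`
    -- contributes nothing to the deviation.
    have hPh : ∀ z, (P z y).toReal = (1 - γ) * (W x₀ y).toReal + γ / t * ∑ b, h b (z b) := by
      intro z
      simp only [hP, bind_toReal, spikePMF_toReal]
      exact sum_spikeWeight_mul γ x₀ pt z fun x => (W x y).toReal
    set A := (∑ z : Fin t → Fin L, ∑ b, h b (z b)) / Fintype.card (Fin t → Fin L) with hA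
    have hA' : ∑ z : Fin t → Fin L, ∑ b, h b (z b) = Fintype.card (Fin t → Fin L) * A := by
      rw [hA, mul_div_cancel₀ _ hc.ne']
    have hqA : q = (1 - γ) * (W x₀ y).toReal + γ / t * A := by
      have := hmix y
      simp only [hPh, Finset.sum_add_distrib, ← Finset.mul_sum, hA'] at this
      rw [Finset.sum_const, Finset.card_univ, nsmul_eq_mul] at this
      refine mul_left_cancel₀ hc.ne' ?_
      rw [← this]
      ring
    -- Privacy confines the channel probabilities to an interval of length `(exp ε - 1) * m`, and `m
    -- ≤ q`.
    have hdev := sum_sq_dev_le h (m := m) (G := (Real.exp ε - 1) * q) (fun b c => ⟨(h2 _).1,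
      (h2 _).2.trans (by nlinarith [h4.1])⟩) hA'
    calc ∑ z, ((P z y).toReal - q) ^ 2
        = (γ / t) ^ 2 * ∑ z : Fin t → Fin L, (∑ b, h b (z b) - A) ^ 2 := by
          rw [Finset.mul_sum]
          refine Finset.sum_congr rfl fun z _ => ?_
          rw [hPh, hqA]
          ring
      _ ≤ (γ / t) ^ 2 * (Fintype.card (Fin t → Fin L) * (t * ((Real.exp ε - 1) * q) ^ 2)) := by
          gcongr
      _ = _ := by field_simp

/-- The numerical slack of the lower bound: 0.81 is below the success probability 0.9. It follows
from `2 - exp (-lam) ≤ 1 + lam` and the quadratic lower bound for `exp (0.81 * lam)`, which need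
`lam` to be at least about 0.58. -/
theorem log_two_sub_exp_neg_le {lam : ℝ} (h : 0.6 ≤ lam) :
    Real.log (2 - Real.exp (-lam)) ≤ 0.81 * lam := by
  have h1 : 0 < 2 - Real.exp (-lam) := by
    have : Real.exp (-lam) ≤ 1 := Real.exp_le_one_iff.2 (by linarith)
    linarith
  rw [Real.log_le_iff_le_exp h1]
  have h2 := Real.quadratic_le_exp_of_nonneg (x := 0.81 * lam) (by linarith)
  have h3 := Real.add_one_le_exp (-lam)
  nlinarith

/-- Success of a protocol averaged over the hard family. -/
theorem sum_successProb_spike_le {n : ℕ} [Nonempty (Fin L)] {γ ε α lam : ℝ} (hε : 0 < ε)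
    (h0 : 0 ≤ γ) (h1 : γ ≤ 1) (ht : 0 < t) (x₀ : Fin k) (pt : Fin t → Fin L → Fin k)
    (W : Fin n → Channel k (List Bool)) (hW : ∀ i, IsLDP ε (W i))
    (est : (Fin n → List Bool) → PMF (Fin k)) (hlam : 0.6 ≤ lam)
    (hsep : ∀ q : PMF (Fin k),
      ∑ z, {z | tv (spikePMF h0 h1 ht x₀ pt z) q ≤ α}.indicator (fun _ => (1 : ℝ)) z ≤
        Fintype.card (Fin t → Fin L) * Real.exp (-lam)) :
    lam * ∑ z, (successProb W est α (spikePMF h0 h1 ht x₀ pt z)).toReal ≤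
      Fintype.card (Fin t → Fin L) * (n * (γ ^ 2 / t * (Real.exp ε - 1) ^ 2) + 0.81 * lam) := by
  choose Q hPQ hQP hchi using fun i =>
    spike_channel_bounds hε h0 h1 ht x₀ pt (W i) (hW i)
  set V := γ ^ 2 / t * (Real.exp ε - 1) ^ 2 with hV
  set N := (Fintype.card (Fin t → Fin L) : ℝ) with hN
  set b := 2 - Real.exp (-lam) with hb
  have hb0 : 0 < b := by
    have : Real.exp (-lam) ≤ 1 := Real.exp_le_one_iff.2 (by linarith)
    linarith
  -- The shift `a = log b` normalizes the right side to the size of the family.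
  have h := change_of_measure (fun z i => (spikePMF h0 h1 ht x₀ pt z).bind (W i)) Q
    (Real.exp_pos ε).le (fun z i y => hPQ i z y) (fun z i y => hQP i z y)
    (fun z => {y | tv (spikePMF h0 h1 ht x₀ pt z) (est y) ≤ α}) (lam := lam) (by linarith)
    (fun y => hsep (est y)) (Real.log b)
  have hR : Real.exp (-Real.log b) * (N * (1 + (Real.exp lam - 1) * Real.exp (-lam))) = N := by
    have : 1 + (Real.exp lam - 1) * Real.exp (-lam) = b := by
      rw [sub_mul, ← Real.exp_add, add_neg_cancel, Real.exp_zero, hb]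
      ring
    rw [this, Real.exp_neg, Real.exp_log hb0]
    field_simp
  rw [hR, Finset.sum_sub_distrib, Finset.sum_add_distrib, ← Finset.mul_sum, Finset.sum_const,
    Finset.card_univ, nsmul_eq_mul, ← hN, Finset.sum_comm] at h
  have h2 : ∑ i, ∑ z, ∫ y, ((((spikePMF h0 h1 ht x₀ pt z).bind (W i)) y).toReal /
      (Q i y).toReal - 1) ∂((spikePMF h0 h1 ht x₀ pt z).bind (W i)).toMeasure ≤ n * (N * V) := by
    refine (Finset.sum_le_sum fun i _ => hchi i).trans ?_
    simp [hN]
  have h3 := log_two_sub_exp_neg_le hlam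
  have hN0 : 0 ≤ N := by positivity
  have h4 : N * Real.log b ≤ N * (0.81 * lam) := mul_le_mul_of_nonneg_left h3 hN0
  have h5 : ∑ z, (successProb W est α (spikePMF h0 h1 ht x₀ pt z)).toReal =
      ∑ z, (Measure.pi fun i => ((spikePMF h0 h1 ht x₀ pt z).bind (W i)).toMeasure).real
        {y | tv (spikePMF h0 h1 ht x₀ pt z) (est y) ≤ α} := rfl
  rw [h5]
  linarith

end SparseLDP
end

noncomputable section

namespace SparseLDP

/-! ### Large deviations of a sum of independent choices -/

theorem sum_pi_prod {t L : ℕ} (f : Fin t → Fin L → ℝ) :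
    ∑ z : Fin t → Fin L, ∏ b, f b (z b) = ∏ b, ∑ c, f b c := by
  rw [Finset.prod_univ_sum, Fintype.piFinset_univ]

theorem sum_pi_sum {t L : ℕ} (hL : 0 < L) (f : Fin t → Fin L → ℝ) :
    ∑ z : Fin t → Fin L, ∑ b, f b (z b) =
      Fintype.card (Fin t → Fin L) * ((∑ b, ∑ c, f b c) / L) := by
  have hL' : (L : ℝ) ≠ 0 := by exact_mod_cast hL.ne'
  rw [Finset.sum_comm, Finset.sum_div, Finset.mul_sum]
  refine Finset.sum_congr rfl fun b _ => ?_
  -- A function of one coordinate is a product with all other factors 1.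
  have h := sum_pi_prod fun b' c => if b' = b then f b' c else (1 : ℝ)
  simp only [Finset.prod_ite_eq', Finset.mem_univ, if_true] at h
  rw [h, ← Finset.mul_prod_erase _ _ (Finset.mem_univ b)]
  have h2 : ∏ b' ∈ Finset.univ.erase b, ∑ c : Fin L, (if b' = b then f b' c else (1 : ℝ)) =
      (L : ℝ) ^ (t - 1) := by
    rw [Finset.prod_congr rfl fun b' hb' => by
      simp only [if_neg (Finset.ne_of_mem_erase hb')]
      rfl]
    simp [Finset.card_erase_of_mem]
  have ht : t ≠ 0 := by
    rintro rfl
    exact b.elim0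
  simp only [if_true, h2, Fintype.card_fun, Fintype.card_fin, Nat.cast_pow]
  rw [← mul_pow_sub_one ht (L : ℝ)]
  field_simp

theorem exp_mul_le_one_add {u x : ℝ} (h0 : 0 ≤ x) (h1 : x ≤ 1) :
    Real.exp (u * x) ≤ 1 + (Real.exp u - 1) * x := by
  have h := convexOn_exp.2 (Set.mem_univ 0) (Set.mem_univ u) (sub_nonneg.2 h1) h0 (by ring)
  simp only [smul_eq_mul, mul_zero, zero_add, Real.exp_zero, mul_one] at h
  rw [mul_comm]
  linarith

theorem log_sub_one_add_inv_ge {r : ℝ} (hr : 1.98 ≤ r) :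
    0.2 * Real.log r ≤ Real.log r - 1 + 1 / r := by
  have h := Real.le_log_one_add_of_nonneg (x := r - 1) (by linarith)
  rw [add_sub_cancel] at h
  have h2 : 1 - 1 / r ≤ 0.8 * (2 * (r - 1) / (r - 1 + 2)) := by
    rw [one_sub_div (by linarith), ← mul_div_assoc, div_le_div_iff₀ (by linarith) (by linarith)]
    nlinarith
  linarith

/-- The sum has mean at most `t * M / L`, smaller than `t * β` by the factor `r = β * L / M`. Markov
gives `1 / r ≤ exp (-0.6)`, which covers small exponents. Otherwise Chernoff with parameter `log r`
gives the exponent `t * β * (log r - 1 + 1 / r)`, and `log_sub_one_add_inv_ge` simplifies it. -/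
theorem card_large_sum_le {t L : ℕ} {M β : ℝ} (hL : 0 < L) (ht : 0 < t) (hβ : 0 < β)
    (hM : 0 < M) (hr : 1.98 ≤ β * L / M) (X : Fin t → Fin L → ℝ)
    (hX : ∀ b c, X b c ∈ Set.Icc (0 : ℝ) 1) (hS : ∑ b, ∑ c, X b c ≤ t * M) :
    ∑ z : Fin t → Fin L, {z | t * β ≤ ∑ b, X b (z b)}.indicator (fun _ => (1 : ℝ)) z ≤
      Fintype.card (Fin t → Fin L) *
        Real.exp (-max 0.6 (0.2 * (t * β * Real.log (β * L / M)))) := by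
  have hL0 : (0 : ℝ) < L := by exact_mod_cast hL
  have ht0 : (0 : ℝ) < t := by exact_mod_cast ht
  set N := (Fintype.card (Fin t → Fin L) : ℝ) with hN
  have hN0 : 0 ≤ N := by positivity
  set r := β * L / M with hr'
  have hr0 : 0 < r := by linarith
  have hrinv : M / L = β / r := by
    rw [hr']
    field_simp
  rcases le_total (0.2 * (t * β * Real.log r)) 0.6 with hcase | hcase
  · rw [max_eq_left hcase]
    have h1 : ∀ z : Fin t → Fin L,
        {z | t * β ≤ ∑ b, X b (z b)}.indicator (fun _ => (1 : ℝ)) z ≤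
          (∑ b, X b (z b)) / (t * β) := by
      intro z
      refine Set.indicator_apply_le' (fun h => ?_) fun _ => ?_
      · rw [le_div_iff₀ (by positivity), one_mul]
        exact h
      · exact div_nonneg (Finset.sum_nonneg fun b _ => (hX b _).1) (by positivity)
    refine (Finset.sum_le_sum fun z _ => h1 z).trans ?_
    rw [← Finset.sum_div, sum_pi_sum hL, mul_div_assoc]
    refine mul_le_mul_of_nonneg_left ?_ hN0
    have h2 : (∑ b, ∑ c, X b c) / L / (t * β) ≤ 1 / r := by
      calc (∑ b, ∑ c, X b c) / L / (t * β) ≤ t * M / L / (t * β) := by gcongr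
        _ = M / L / β := by field_simp
        _ = 1 / r := by
          rw [hrinv]
          field_simp
    refine h2.trans ?_
    have h3 : Real.exp 0.6 ≤ 1.98 := by
      have h5 : Real.exp 0.6 ^ 5 ≤ 1.98 ^ 5 := by
        rw [← Real.exp_nat_mul]
        calc Real.exp ((5 : ℕ) * 0.6) = Real.exp 1 ^ 3 := by
              rw [← Real.exp_nat_mul]
              norm_num
          _ ≤ 2.7182818286 ^ 3 := by
              gcongr
              exact Real.exp_one_lt_d9.le
          _ ≤ _ := by norm_num
      exact le_of_pow_le_pow_left₀ (by norm_num) (by norm_num) h5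
    rw [Real.exp_neg, ← one_div]
    exact one_div_le_one_div_of_le (Real.exp_pos _) (h3.trans hr)
  · rw [max_eq_right hcase]
    set u := Real.log r with hu
    have hu0 : 0 ≤ u := Real.log_nonneg (by linarith)
    have hur : Real.exp u = r := Real.exp_log hr0
    have h1 : ∀ z : Fin t → Fin L,
        {z | t * β ≤ ∑ b, X b (z b)}.indicator (fun _ => (1 : ℝ)) z ≤
          Real.exp (-(u * (t * β))) * ∏ b, Real.exp (u * X b (z b)) := by
      intro z
      refine Set.indicator_apply_le' (fun h => ?_) fun _ => by positivity
      rw [← Real.exp_sum, ← Real.exp_add, ← Finset.mul_sum]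
      refine Real.one_le_exp ?_
      have := mul_le_mul_of_nonneg_left (show t * β ≤ ∑ b, X b (z b) from h) hu0
      linarith
    refine (Finset.sum_le_sum fun z _ => h1 z).trans ?_
    rw [← Finset.mul_sum, sum_pi_prod fun b c => Real.exp (u * X b c)]
    have h2 : ∀ b, ∑ c, Real.exp (u * X b c) ≤ L * Real.exp ((r - 1) * ((∑ c, X b c) / L)) := by
      intro b
      calc ∑ c, Real.exp (u * X b c) ≤ ∑ c, (1 + (Real.exp u - 1) * X b c) :=
            Finset.sum_le_sum fun c _ => exp_mul_le_one_add (hX b c).1 (hX b c).2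
        _ = L * ((r - 1) * ((∑ c, X b c) / L) + 1) := by
            rw [Finset.sum_add_distrib, ← Finset.mul_sum, hur]
            simp only [Finset.sum_const, Finset.card_univ, Fintype.card_fin, nsmul_eq_mul, mul_one]
            field_simp
            ring
        _ ≤ _ := mul_le_mul_of_nonneg_left (Real.add_one_le_exp _) hL0.le
    have h3 : ∏ b, ∑ c, Real.exp (u * X b c) ≤ N * Real.exp ((r - 1) * (t * (β / r))) := by
      refine (Finset.prod_le_prod (fun b _ => Finset.sum_nonneg fun c _ => (Real.exp_pos _).le)
        fun b _ => h2 b).trans ?_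
      rw [Finset.prod_mul_distrib, ← Real.exp_sum, ← Finset.mul_sum, ← Finset.sum_div]
      have h4 : (∑ b, ∑ c, X b c) / L ≤ t * (β / r) := by
        rw [← hrinv, ← mul_div_assoc]
        gcongr
      have h5 : ∏ _b : Fin t, (L : ℝ) = N := by simp [hN]
      rw [h5]
      have h6 : 0 ≤ r - 1 := by linarith
      gcongr
    refine (mul_le_mul_of_nonneg_left h3 (Real.exp_pos _).le).trans ?_
    rw [mul_left_comm, ← Real.exp_add]
    refine mul_le_mul_of_nonneg_left (Real.exp_le_exp.2 ?_) hN0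
    have h4 := mul_le_mul_of_nonneg_left (log_sub_one_add_inv_ge hr)
      (show 0 ≤ t * β by positivity)
    rw [← hu] at h4
    have h5 : (r - 1) * (t * (β / r)) = t * β * (1 - 1 / r) := by field_simp
    rw [h5]
    linarith

/-! ### Separation of the hard family -/

theorem sum_min_eq {k : ℕ} (p q : PMF (Fin k)) :
    ∑ x, min (p x).toReal (q x).toReal = 1 - tv p q := by
  have h : ∀ a b : ℝ, min a b = (a + b - |a - b|) / 2 := fun a b => by
    rcases le_total a b with hab | hab
    · rw [min_eq_left hab, abs_of_nonpos (by linarith)]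
      ring
    · rw [min_eq_right hab, abs_of_nonneg (by linarith)]
      ring
  simp only [h]
  rw [← Finset.sum_div, Finset.sum_sub_distrib, Finset.sum_add_distrib, sum_toReal_pmf,
    sum_toReal_pmf, tv]
  ring

theorem min_add_sum_le {ι : Type*} [Fintype ι] {u q : ℝ} {w : ι → ℝ} (hu : 0 ≤ u) (hq : 0 ≤ q)
    (hw : ∀ b, 0 ≤ w b) : min (u + ∑ b, w b) q ≤ u + ∑ b, min (w b) q := by
  by_cases h : ∃ b, q ≤ w b
  · obtain ⟨b, hb⟩ := h
    have := Finset.single_le_sum (f := fun b => min (w b) q) (fun b _ => le_min (hw b) hq)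
      (Finset.mem_univ b)
    simp only [min_eq_right hb] at this
    exact (min_le_right _ _).trans (by linarith)
  · push Not at h
    refine (min_le_left _ _).trans (le_of_eq ?_)
    congr 1
    exact Finset.sum_congr rfl fun b _ => (min_eq_left (h b).le).symm

variable {k t L : ℕ}

/-- The overlap of two distributions is one minus their distance, and `x₀` accounts for at most `1 -
γ` of it; the spikes must supply the rest. -/
theorem le_sum_min_of_tv_le {γ α : ℝ} (h0 : 0 ≤ γ) (h1 : γ ≤ 1) (ht : 0 < t) (x₀ : Fin k)
    (pt : Fin t → Fin L → Fin k) (z : Fin t → Fin L) (q : PMF (Fin k))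
    (h : tv (spikePMF h0 h1 ht x₀ pt z) q ≤ α) :
    γ - α ≤ ∑ b, min (γ / t) (q (pt b (z b))).toReal := by
  have h2 := sum_min_eq (spikePMF h0 h1 ht x₀ pt z) q
  simp only [spikePMF_toReal, spikeWeight] at h2
  have h3 : ∀ x : Fin k, min ((if x = x₀ then 1 - γ else 0) +
      ∑ b, if x = pt b (z b) then γ / t else 0) (q x).toReal ≤
      (if x = x₀ then 1 - γ else 0) +
        ∑ b, if x = pt b (z b) then min (γ / t) (q x).toReal else 0 := by
    intro x
    refine (min_add_sum_le ?_ ENNReal.toReal_nonneg fun b => ?_).trans (le_of_eq ?_)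
    · split_ifs <;> linarith
    · split_ifs
      · positivity
      · exact le_rfl
    · congr 1
      refine Finset.sum_congr rfl fun b _ => ?_
      split_ifs
      · rfl
      · exact min_eq_left ENNReal.toReal_nonneg
  have h4 := Finset.sum_le_sum fun x (_ : x ∈ Finset.univ) => h3 x
  rw [h2, Finset.sum_add_distrib, Finset.sum_comm] at h4
  simp only [Finset.sum_ite_eq', Finset.mem_univ, if_true] at h4
  linarith

/-- Truncating `q` at `γ / t` and rescaling by `t / γ` gives weights in [0, 1]. Closeness forces
their sum along `z` to be at least `t * β`, and `hq` bounds their total, so `card_large_sum_le`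
applies. If no member is close, nothing is left to count. -/
theorem spike_separation {γ α β M : ℝ} (hγ : 0 < γ) (h1 : γ ≤ 1) (hL : 0 < L) (ht : 0 < t)
    (hβ : 0 < β) (hM : 0 < M) (hr : 1.98 ≤ β * L / M) (hα : γ * β ≤ γ - α) (x₀ : Fin k)
    (pt : Fin t → Fin L → Fin k) (q : PMF (Fin k))
    (hq : ∀ z, tv (spikePMF hγ.le h1 ht x₀ pt z) q ≤ α →
      ∑ b, ∑ c, (q (pt b c)).toReal ≤ γ * M) :
    ∑ z, {z | tv (spikePMF hγ.le h1 ht x₀ pt z) q ≤ α}.indicator (fun _ => (1 : ℝ)) z ≤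
      Fintype.card (Fin t → Fin L) *
        Real.exp (-max 0.6 (0.2 * (t * β * Real.log (β * L / M)))) := by
  have ht0 : (0 : ℝ) < t := by exact_mod_cast ht
  by_cases hz : ∃ z, tv (spikePMF hγ.le h1 ht x₀ pt z) q ≤ α
  · obtain ⟨z₀, hz₀⟩ := hz
    refine le_trans (Finset.sum_le_sum fun z _ => ?_)
      (card_large_sum_le hL ht hβ hM hr (fun b c => t / γ * min (γ / t) (q (pt b c)).toReal)
        (fun b c => ⟨by positivity, ?_⟩) ?_)
    · refine Set.indicator_le_indicator_of_subset (fun z hz => ?_) (fun _ => zero_le_one) z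
      have h := le_sum_min_of_tv_le hγ.le h1 ht x₀ pt z q hz
      rw [Set.mem_ofPred_eq, ← Finset.mul_sum]
      calc t * β = t / γ * (γ * β) := by field_simp
        _ ≤ t / γ * ∑ b, min (γ / t) (q (pt b (z b))).toReal := by
          gcongr
          linarith
    · calc t / γ * min (γ / t) (q (pt b c)).toReal ≤ t / γ * (γ / t) := by
            gcongr
            exact min_le_left _ _
        _ = 1 := by field_simp
    · simp only [← Finset.mul_sum]
      calc t / γ * ∑ b, ∑ c, min (γ / t) (q (pt b c)).toReal
          ≤ t / γ * ∑ b, ∑ c, (q (pt b c)).toReal := by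
            gcongr
            exact min_le_right _ _
        _ ≤ t / γ * (γ * M) := by
            gcongr
            exact hq z₀ hz₀
        _ = t * M := by field_simp
  · push Not at hz
    refine le_of_eq_of_le (Finset.sum_eq_zero fun z _ => ?_) (by positivity)
    rw [Set.indicator_apply, if_neg]
    exact fun h : tv _ q ≤ α => (hz z).not_ge h

/-- The points `1, …, t L`, arranged in `t` blocks of length `L`. -/
def spikePoint (h : t * L < k) (b : Fin t) (c : Fin L) : Fin k :=
  ⟨finProdFinEquiv (b, c) + 1, lt_of_le_of_lt (finProdFinEquiv (b, c)).isLt h⟩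

theorem sum_spikePoint_le (h : t * L < k) (q : PMF (Fin k)) :
    ∑ b, ∑ c, (q (spikePoint h b c)).toReal ≤ 1 - (q ⟨0, by omega⟩).toReal := by
  have hs := sum_toReal_pmf q
  rw [← Finset.add_sum_erase _ _ (Finset.mem_univ (⟨0, by omega⟩ : Fin k))] at hs
  have hinj : Function.Injective fun x : Fin t × Fin L => spikePoint h x.1 x.2 := by
    intro x y hxy
    simp only [spikePoint, Fin.mk.injEq, Nat.add_right_cancel_iff] at hxy
    exact finProdFinEquiv.injective (Fin.ext hxy)
  rw [← Fintype.sum_prod_type fun x : Fin t × Fin L => (q (spikePoint h x.1 x.2)).toReal,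
    ← Finset.sum_image (f := fun x => (q x).toReal) (g := fun x : Fin t × Fin L =>
      spikePoint h x.1 x.2) (s := Finset.univ) (hinj.injOn)]
  refine le_trans (Finset.sum_le_sum_of_subset_of_nonneg ?_ fun x _ _ =>
    ENNReal.toReal_nonneg) (eq_sub_of_add_eq' hs).le
  intro x hx
  obtain ⟨y, -, rfl⟩ := Finset.mem_image.1 hx
  refine Finset.mem_erase.2 ⟨?_, Finset.mem_univ _⟩
  simp [spikePoint]

/-- For `γ = 1` the point `x₀` costs no support, so all `s` points can serve as spikes; for `γ < 1`
only `s - 1` can. -/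
theorem support_spikePMF_subset {γ : ℝ} (h0 : 0 ≤ γ) (h1 : γ ≤ 1) (ht : 0 < t) (x₀ : Fin k)
    (pt : Fin t → Fin L → Fin k) (z : Fin t → Fin L) :
    (spikePMF h0 h1 ht x₀ pt z).support ⊆
      (if γ = 1 then ∅ else {x₀}) ∪ Set.range fun b => pt b (z b) := by
  intro x hx
  rw [PMF.mem_support_iff] at hx
  by_contra hn
  rw [Set.mem_union, not_or] at hn
  apply hx
  refine (ENNReal.toReal_eq_zero_iff _).1 ?_ |>.resolve_right (PMF.apply_ne_top _ _)
  rw [spikePMF_toReal, spikeWeight]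
  have h2 : ∀ b, x ≠ pt b (z b) := fun b hb => hn.2 ⟨b, hb.symm⟩
  simp only [h2, if_false, Finset.sum_const_zero, add_zero]
  split_ifs with hx₀
  · by_cases hγ : γ = 1
    · linarith
    · exact absurd (by simpa [hγ] using hx₀) hn.1
  · rfl

theorem ncard_range_le (f : Fin t → Fin k) : (Set.range f).ncard ≤ t := by
  rw [← Set.image_univ]
  refine (Set.ncard_image_le (Set.toFinite _)).trans ?_
  simp [Set.ncard_univ]

theorem isSparse_spikePMF_one (ht : 0 < t) (x₀ : Fin k) (pt : Fin t → Fin L → Fin k)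
    (z : Fin t → Fin L) : IsSparse t (spikePMF zero_le_one le_rfl ht x₀ pt z) := by
  have h := support_spikePMF_subset zero_le_one le_rfl ht x₀ pt z
  rw [if_pos rfl, Set.empty_union] at h
  exact (Set.ncard_le_ncard h (Set.toFinite _)).trans (ncard_range_le _)

theorem isSparse_spikePMF {γ : ℝ} (h0 : 0 ≤ γ) (h1 : γ ≤ 1) (ht : 0 < t) (x₀ : Fin k)
    (pt : Fin t → Fin L → Fin k) (z : Fin t → Fin L) :
    IsSparse (t + 1) (spikePMF h0 h1 ht x₀ pt z) := by
  have h : (spikePMF h0 h1 ht x₀ pt z).support ⊆ insert x₀ (Set.range fun b => pt b (z b)) := by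
    refine (support_spikePMF_subset h0 h1 ht x₀ pt z).trans ?_
    split_ifs
    · rw [Set.empty_union]
      exact Set.subset_insert _ _
    · rw [Set.singleton_union]
  refine (Set.ncard_le_ncard h (Set.toFinite _)).trans ((Set.ncard_insert_le _ _).trans ?_)
  exact Nat.add_le_add_right (ncard_range_le _) 1

end SparseLDP
end

/-! ### Lower bound on the sample complexity -/

noncomputable section

namespace SparseLDP

/-- The lower integral is superadditive without any measurability, which is the direction needed for
arbitrary public-coin protocols. -/
theorem sum_lintegral_le {Ω ι : Type*} [MeasurableSpace Ω] (ρ : Measure Ω) (s : Finset ι)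
    (f : ι → Ω → ℝ≥0∞) : ∑ i ∈ s, ∫⁻ ω, f i ω ∂ρ ≤ ∫⁻ ω, ∑ i ∈ s, f i ω ∂ρ := by
  classical
  induction s using Finset.induction_on with
  | empty => simp
  | insert a s ha ih =>
    simp only [Finset.sum_insert ha]
    exact (add_le_add le_rfl ih).trans (le_lintegral_add _ _)

theorem successProb_ne_top {k n : ℕ} {M : Type} [MeasurableSpace M] (W : Fin n → Channel k M)
    (est : (Fin n → M) → PMF (Fin k)) (α : ℝ) (p : PMF (Fin k)) :
    successProb W est α p ≠ ⊤ := measure_ne_top _ _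

/-- Few users cannot solve the problem for a well separated hard family, even with public
coins. -/
theorem le_of_publicCoinAchievable {k s t L n : ℕ} {γ ε α lam : ℝ} (hL : 0 < L) (hε : 0 < ε)
    (h0 : 0 ≤ γ) (h1 : γ ≤ 1) (ht : 0 < t) (x₀ : Fin k) (pt : Fin t → Fin L → Fin k)
    (hs : ∀ z, IsSparse s (spikePMF h0 h1 ht x₀ pt z)) (hlam : 0.6 ≤ lam)
    (hsep : ∀ q : PMF (Fin k),
      ∑ z, {z | tv (spikePMF h0 h1 ht x₀ pt z) q ≤ α}.indicator (fun _ => (1 : ℝ)) z ≤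
        Fintype.card (Fin t → Fin L) * Real.exp (-lam))
    (h : PublicCoinAchievable k s ε α n) :
    0.09 * lam ≤ n * (γ ^ 2 / t * (Real.exp ε - 1) ^ 2) := by
  have : Nonempty (Fin L) := ⟨⟨0, hL⟩⟩
  have hc := card_pos_of_nonempty (t := t) (L := L)
  obtain ⟨Ω, _, ρ, _, W, est, hW, hest⟩ := h
  set V := γ ^ 2 / t * (Real.exp ε - 1) ^ 2 with hV
  set N := (Fintype.card (Fin t → Fin L) : ℝ) with hN
  set K := N * (n * V + 0.81 * lam) / lam with hK
  have hlam0 : 0 < lam := by linarith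
  have hK0 : 0 ≤ K := by positivity
  have h2 : ∀ ω, ∑ z, successProb (W ω) (est ω) α (spikePMF h0 h1 ht x₀ pt z) ≤
      ENNReal.ofReal K := by
    intro ω
    have h3 := sum_successProb_spike_le hε h0 h1 ht x₀ pt (W ω) (hW ω) (est ω) hlam hsep
    rw [← ENNReal.toReal_sum fun z _ => successProb_ne_top _ _ _ _, mul_comm,
      ← le_div_iff₀ hlam0] at h3
    exact (ENNReal.le_ofReal_iff_toReal_le
      (ENNReal.sum_ne_top.2 fun z _ => successProb_ne_top _ _ _ _) hK0).2 h3
  have h3 : ∑ _z : Fin t → Fin L, (9 / 10 : ℝ≥0∞) ≤ ENNReal.ofReal K := by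
    calc ∑ _z : Fin t → Fin L, (9 / 10 : ℝ≥0∞)
        ≤ ∑ z, ∫⁻ ω, successProb (W ω) (est ω) α (spikePMF h0 h1 ht x₀ pt z) ∂ρ :=
          Finset.sum_le_sum fun z _ => hest _ (hs z)
      _ ≤ ∫⁻ ω, ∑ z, successProb (W ω) (est ω) α (spikePMF h0 h1 ht x₀ pt z) ∂ρ :=
          sum_lintegral_le _ _ _
      _ ≤ ∫⁻ _, ENNReal.ofReal K ∂ρ := lintegral_mono h2
      _ = ENNReal.ofReal K := by simp
  have h4 := ENNReal.toReal_mono ENNReal.ofReal_ne_top h3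
  rw [ENNReal.toReal_ofReal hK0, Finset.sum_const, Finset.card_univ, nsmul_eq_mul,
    ENNReal.toReal_mul, ENNReal.toReal_natCast, ENNReal.toReal_div, ENNReal.toReal_ofNat, ENNReal.toReal_ofNat, hK,
    le_div_iff₀ hlam0, ← hN, mul_assoc] at h4
  have := le_of_mul_le_mul_left h4 hc
  linarith

theorem exp_sub_one_sq_le {ε E : ℝ} (hε : 0 < ε) (hE : ε ≤ E) :
    (Real.exp ε - 1) ^ 2 ≤ ε ^ 2 * Real.exp E ^ 2 := by
  rw [← mul_pow]
  have h0 := Real.add_one_le_exp ε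
  have h1 := Real.add_one_le_exp (-ε)
  have h2 : Real.exp ε * Real.exp (-ε) = 1 := by
    rw [← Real.exp_add, add_neg_cancel, Real.exp_zero]
  have h3 := Real.exp_le_exp.2 hE
  refine pow_le_pow_left₀ (by linarith) ?_ 2
  nlinarith [Real.exp_pos ε]

/-- The block length is computed from `k - 1`, because the point 0 is kept free for `x₀`. -/
theorem div_le_blockLength_add_one {k s : ℕ} (hs : 1 ≤ s) (hk : 1 ≤ k) :
    (k : ℝ) / s ≤ ((k - 1) / s : ℕ) + 1 := by
  have h := Nat.lt_mul_div_succ (k - 1) (show 0 < s by omega)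
  have h2 : k ≤ s * ((k - 1) / s + 1) := by omega
  have h3 : (k : ℝ) ≤ s * (((k - 1) / s : ℕ) + 1) := by exact_mod_cast h2
  have hs0 : (0 : ℝ) < s := by exact_mod_cast hs
  rw [div_le_iff₀ hs0]
  linarith

theorem mul_blockLength_lt {k s t : ℕ} (ht : t ≤ s) (hk : 1 ≤ k) : t * ((k - 1) / s) < k := by
  have h1 := Nat.mul_div_le (k - 1) s
  have h2 := Nat.mul_le_mul_right ((k - 1) / s) ht
  omega

theorem rate_eq_of_large {k s : ℕ} {ε α : ℝ} (hx : 100 ≤ (k : ℝ) / s) :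
    rate k s ε α = (s : ℝ) ^ 2 * Real.log ((k : ℝ) / s) / (α ^ 2 * ε ^ 2) := by
  rw [rate, max_eq_left]
  rw [Real.le_log_iff_exp_le (by linarith)]
  linarith [Real.exp_one_lt_d9]

/-- Takes `γ = 1`, `t = s`, `β = 1 - α` and `M = 1`. The hypothesis `hα2` is what gives `(1 - α) * L
≥ 1.98`. The constant 0.0045 is 0.09 · 0.2 / 4, where 1/4 is a lower bound for `α ^ 2`. -/
theorem lower_bound_large_accuracy {E α₀ : ℝ} (hα₀ : α₀ < 1) {k s n : ℕ} {ε α : ℝ}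
    (hs : 2 ≤ s) (hk : 100 * s ≤ k) (hε : 0 < ε) (hεE : ε ≤ E) (hα : 1 / 2 ≤ α) (hαα₀ : α ≤ α₀)
    (hα2 : α ≤ 1 - 2 * (s : ℝ) / k) (h : PublicCoinAchievable k s ε α n) :
    0.0045 * (1 - α₀) / ((1 + 2 * Real.log (2 / (1 - α₀))) * Real.exp E ^ 2) * rate k s ε α
      ≤ n := by
  have hs0 : (0 : ℝ) < s := by exact_mod_cast (by omega : 0 < s)
  have hk0 : (0 : ℝ) < k := by exact_mod_cast (by omega : 0 < k)
  have hx : 100 ≤ (k : ℝ) / s := by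
    rw [le_div_iff₀ hs0]
    exact_mod_cast hk
  have hLx := div_le_blockLength_add_one (k := k) (s := s) (by omega) (by omega)
  rw [rate_eq_of_large hx]
  set x := (k : ℝ) / s with hxdef
  have hax : 2 / x ≤ 1 - α := by
    have : 2 / x = 2 * (s : ℝ) / k := by
      rw [hxdef]
      field_simp
    linarith
  set L := (k - 1) / s with hLdef
  have hL99 : 0.99 * x ≤ L := by linarith
  have hL0 : 0 < L := by
    have : (0 : ℝ) < L := by linarith
    exact_mod_cast this
  have hβ : 0 < 1 - α := by linarith
  have hr : 1.98 ≤ (1 - α) * L / 1 := by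
    rw [div_one]
    calc (1.98 : ℝ) = 2 / x * (0.99 * x) := by
          field_simp
          norm_num
      _ ≤ (1 - α) * L := by gcongr
  have hlt := mul_blockLength_lt (le_refl s) (show 1 ≤ k by omega)
  have h2 := le_of_publicCoinAchievable hL0 hε zero_le_one le_rfl (by omega) ⟨0, by omega⟩
    (spikePoint hlt) (isSparse_spikePMF_one (by omega) _ _) (le_max_left _ _)
    (fun q => spike_separation one_pos le_rfl hL0 (by omega) hβ one_pos hr (by linarith)
      ⟨0, by omega⟩ (spikePoint hlt) q fun z _ => (sum_spikePoint_le hlt q).trans (by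
        have : 0 ≤ (q ⟨0, by omega⟩).toReal := ENNReal.toReal_nonneg
        linarith)) h
  rw [div_one] at h2 hr
  set r := (1 - α) * L with hrdef
  have hlogr : 1 / 2 ≤ Real.log r := by
    have h3 := Real.le_log_one_add_of_nonneg (x := 0.98) (by norm_num)
    have h4 : Real.log (1 + 0.98) ≤ Real.log r := Real.log_le_log (by norm_num) (by linarith)
    norm_num at h3 h4
    linarith
  have hb0 : 0 < 1 - α₀ := by linarith
  have hlog2 : 0 ≤ Real.log (2 / (1 - α₀)) := Real.log_nonneg (by
    rw [le_div_iff₀ hb0]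
    linarith)
  set A := 1 + 2 * Real.log (2 / (1 - α₀)) with hA
  -- `x` exceeds `r` at most by the factor `2 / (1 - α₀)`, and `log r ≥ 1 / 2` turns this additive
  -- loss into a multiplicative one.
  have hlogx : Real.log x ≤ A * Real.log r := by
    have h3 : x ≤ 2 / (1 - α₀) * r := by
      rw [div_mul_eq_mul_div, le_div_iff₀ hb0, hrdef]
      nlinarith
    have h4 := Real.log_le_log (by linarith) h3
    rw [Real.log_mul (by positivity) (by linarith)] at h4
    nlinarith
  have h3 := (mul_le_mul_of_nonneg_left (le_max_right 0.6 _)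
    (by norm_num : (0 : ℝ) ≤ 0.09)).trans h2
  have h4 := exp_sub_one_sq_le hε hεE
  have hA0 : 0 < A := by linarith
  have hα0 : 0 < α := by linarith
  have hlx : 0 < Real.log x := Real.log_pos (by linarith)
  -- clear the denominators
  have h5 : 0.018 * (s : ℝ) ^ 2 * ((1 - α₀) * Real.log x) ≤
      A * (n * (ε ^ 2 * Real.exp E ^ 2)) := by
    calc 0.018 * (s : ℝ) ^ 2 * ((1 - α₀) * Real.log x)
        ≤ 0.018 * (s : ℝ) ^ 2 * ((1 - α) * (A * Real.log r)) := by gcongr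
      _ = A * (s * (0.09 * (0.2 * (s * (1 - α) * Real.log r)))) := by ring
      _ ≤ A * (s * (n * (1 ^ 2 / s * (Real.exp ε - 1) ^ 2))) := by gcongr
      _ = A * (n * (Real.exp ε - 1) ^ 2) := by field_simp
      _ ≤ _ := by gcongr
  have h6 : 1 / 4 ≤ α ^ 2 := by nlinarith
  rw [← mul_div_assoc, div_mul_eq_mul_div, div_div, div_le_iff₀ (by positivity)]
  calc 0.0045 * (1 - α₀) * ((s : ℝ) ^ 2 * Real.log x)
      = 1 / 4 * (0.018 * (s : ℝ) ^ 2 * ((1 - α₀) * Real.log x)) := by ring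
    _ ≤ α ^ 2 * (A * (n * (ε ^ 2 * Real.exp E ^ 2))) := by gcongr
    _ = _ := by ring

/-- Takes `γ = 2 * α`, `t = s - 1`, `β = 1 / 2` and `M = 2`; `γ` proportional to `α` produces the
factor `1 / α ^ 2`. -/
theorem lower_bound_small_accuracy {E : ℝ} {k s n : ℕ} {ε α : ℝ}
    (hs : 2 ≤ s) (hk : 100 * s ≤ k) (hε : 0 < ε) (hεE : ε ≤ E) (hα0 : 0 < α) (hα : α ≤ 1 / 2)
    (h : PublicCoinAchievable k s ε α n) :
    0.00028 / Real.exp E ^ 2 * rate k s ε α ≤ n := by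
  have hs0 : (0 : ℝ) < s := by exact_mod_cast (by omega : 0 < s)
  have hx : 100 ≤ (k : ℝ) / s := by
    rw [le_div_iff₀ hs0]
    exact_mod_cast hk
  have hLx := div_le_blockLength_add_one (k := k) (s := s) (by omega) (by omega)
  rw [rate_eq_of_large hx]
  set x := (k : ℝ) / s with hxdef
  set L := (k - 1) / s with hLdef
  have hL99 : 0.99 * x ≤ L := by linarith
  have hL0 : 0 < L := by
    have : (0 : ℝ) < L := by linarith
    exact_mod_cast this
  have hr : 1.98 ≤ 1 / 2 * (L : ℝ) / 2 := by linarith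
  obtain ⟨t, rfl⟩ : ∃ t, s = t + 1 := ⟨s - 1, by omega⟩
  have ht : 0 < t := by omega
  have ht0 : (0 : ℝ) < t := by exact_mod_cast ht
  have hst : ((t + 1 : ℕ) : ℝ) ≤ 2 * t := by exact_mod_cast (by omega : t + 1 ≤ 2 * t)
  have hlt := mul_blockLength_lt (k := k) (Nat.le_succ t) (show 1 ≤ k by omega)
  have hγ : 0 < 2 * α := by linarith
  have hγ1 : 2 * α ≤ 1 := by linarith
  have h2 := le_of_publicCoinAchievable hL0 hε hγ.le hγ1 ht ⟨0, by omega⟩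
    (spikePoint hlt) (isSparse_spikePMF hγ.le hγ1 ht _ _) (le_max_left _ _)
    (fun q => spike_separation hγ hγ1 hL0 ht one_half_pos two_pos hr (by linarith)
      ⟨0, by omega⟩ (spikePoint hlt) q fun z hz => (sum_spikePoint_le hlt q).trans (by
        -- A single coordinate differs by at most twice the distance, so a close `q` keeps mass at
        -- least `1 - 4 * α` at `x₀` and leaves at most `γ * 2` for the spikes.
        have h3 := Finset.single_le_sum (f := fun x =>
          |(spikePMF hγ.le hγ1 ht ⟨0, by omega⟩ (spikePoint hlt) z x).toReal - (q x).toReal|)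
          (fun _ _ => abs_nonneg _) (Finset.mem_univ (⟨0, by omega⟩ : Fin k))
        simp only [spikePMF_toReal] at h3
        have h4 := (le_abs_self _).trans h3
        have h5 : 1 - 2 * α ≤ spikeWeight (2 * α) (⟨0, by omega⟩ : Fin k) (spikePoint hlt) z
            ⟨0, by omega⟩ := by
          rw [spikeWeight, if_pos rfl, le_add_iff_nonneg_right]
          refine Finset.sum_nonneg fun b _ => ?_
          split_ifs
          · positivity
          · exact le_rfl
        simp only [tv, spikePMF_toReal] at hz
        linarith)) h
  have hrL : 1 / 2 * (L : ℝ) / 2 = L / 4 := by ring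
  rw [hrL] at h2 hr
  have hlogx : Real.log x ≤ 2 * Real.log ((L : ℝ) / 4) := by
    have h3 : x ≤ ((L : ℝ) / 4) ^ 2 := by nlinarith
    have h4 := Real.log_le_log (by linarith) h3
    rwa [Real.log_pow, Nat.cast_ofNat] at h4
  have h3 := (mul_le_mul_of_nonneg_left (le_max_right 0.6 _)
    (by norm_num : (0 : ℝ) ≤ 0.09)).trans h2
  have h4 := exp_sub_one_sq_le hε hεE
  have hlx : 0 < Real.log x := Real.log_pos (by linarith)
  rw [← mul_div_assoc, div_mul_eq_mul_div, div_div, div_le_iff₀ (by positivity)]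
  -- Replacing `s` by `2 * t` and `log x` by `2 * log (L / 4)` costs a factor 8, and 8 · 0.00028 is
  -- below 0.09 · 0.2 / 8.
  calc 0.00028 * (((t + 1 : ℕ) : ℝ) ^ 2 * Real.log x)
      ≤ 0.00028 * ((2 * t) ^ 2 * (2 * Real.log ((L : ℝ) / 4))) := by gcongr
    _ ≤ t / 4 * (0.09 * (0.2 * (t * (1 / 2) * Real.log ((L : ℝ) / 4)))) := by
        have h5 : 0 ≤ (t : ℝ) ^ 2 * Real.log ((L : ℝ) / 4) := by
          have : 0 ≤ Real.log ((L : ℝ) / 4) := by linarith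
          positivity
        norm_num
        linarith
    _ ≤ t / 4 * (n * ((2 * α) ^ 2 / t * (Real.exp ε - 1) ^ 2)) := by gcongr
    _ = n * (α ^ 2 * (Real.exp ε - 1) ^ 2) := by
        field_simp
        ring
    _ ≤ n * (α ^ 2 * (ε ^ 2 * Real.exp E ^ 2)) := by gcongr
    _ = _ := by ring

theorem PrivateCoinAchievable.publicCoin {k s n : ℕ} {ε α : ℝ}
    (h : PrivateCoinAchievable k s ε α n) : PublicCoinAchievable k s ε α n := by
  obtain ⟨W, est, hW, hest⟩ := h
  exact ⟨Unit, inferInstance, Measure.dirac (), inferInstance, fun _ => W, fun _ => est,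
    fun _ => hW, fun p hp => by simpa using hest p hp⟩

theorem ofReal_le_iInf_natCast {S : Set ℕ} {a : ℝ} (h : ∀ n ∈ S, a ≤ n) :
    ENNReal.ofReal a ≤ ((⨅ n ∈ S, (n : ℕ∞) : ℕ∞) : ℝ≥0∞) := by
  rcases S.eq_empty_or_nonempty with rfl | hS
  · simp
  · have h1 : (⨅ n ∈ S, (n : ℕ∞)) = ((sInf S : ℕ) : ℕ∞) :=
      le_antisymm (iInf₂_le _ (Nat.sInf_mem hS))
        (le_iInf₂ fun n hn => by exact_mod_cast Nat.sInf_le hn)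
    rw [h1, ENat.toENNReal_coe]
    exact ENNReal.ofReal_le_of_le_toReal (by simpa using h _ (Nat.sInf_mem hS))

theorem lower_bound {E α₀ : ℝ} (hα₀ : α₀ < 1) (hα₀' : 0 < α₀) : ∃ c : ℝ, 0 < c ∧
    ∀ (k s : ℕ) (ε α : ℝ), 2 ≤ s → 100 * s ≤ k → 0 < ε → ε ≤ E → 0 < α → α ≤ α₀ →
      α ≤ 1 - 2 * (s : ℝ) / k →
        ENNReal.ofReal (c * rate k s ε α) ≤ (sampleComplexityPublic k s ε α : ℝ≥0∞) ∧
        ENNReal.ofReal (c * rate k s ε α) ≤ (sampleComplexity k s ε α : ℝ≥0∞) := by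
  have hb0 : 0 < 1 - α₀ := by linarith
  have hlog2 : 0 ≤ Real.log (2 / (1 - α₀)) := Real.log_nonneg (by
    rw [le_div_iff₀ hb0]
    linarith)
  refine ⟨min (0.0045 * (1 - α₀) / ((1 + 2 * Real.log (2 / (1 - α₀))) * Real.exp E ^ 2))
    (0.00028 / Real.exp E ^ 2), lt_min (by positivity) (by positivity), ?_⟩
  intro k s ε α hs hk hε hεE hα hαα₀ hα2
  have hrate := (rate_pos (k := k) (s := s) (show 1 ≤ s by omega) hε hα).le
  have key : ∀ n, PublicCoinAchievable k s ε α n →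
      min (0.0045 * (1 - α₀) / ((1 + 2 * Real.log (2 / (1 - α₀))) * Real.exp E ^ 2))
        (0.00028 / Real.exp E ^ 2) * rate k s ε α ≤ n := by
    intro n hn
    rcases le_total α (1 / 2) with hc | hc
    · exact (mul_le_mul_of_nonneg_right (min_le_right _ _) hrate).trans
        (lower_bound_small_accuracy hs hk hε hεE hα hc hn)
    · exact (mul_le_mul_of_nonneg_right (min_le_left _ _) hrate).trans
        (lower_bound_large_accuracy hα₀ hs hk hε hεE hc hαα₀ hα2 hn)
  exact ⟨ofReal_le_iInf_natCast key,
    ofReal_le_iInf_natCast fun n hn => key n (PrivateCoinAchievable.publicCoin hn)⟩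

end SparseLDP
end

noncomputable section

namespace SparseLDP

/-! ### Upper bound on the sample complexity -/

theorem IsLDP.map {k : ℕ} {M M' : Type} [Fintype M] {ε : ℝ} {W : Channel k M} (h : IsLDP ε W)
    (f : M → M') : IsLDP ε fun x => (W x).map f := by
  classical
  intro x x' y
  simp only [PMF.map_apply, tsum_fintype, Finset.mul_sum]
  refine Finset.sum_le_sum fun b _ => ?_
  split_ifs
  · exact h x x' b
  · simp

/-- Bits are embedded as strings of length one; the default of `headD` is never used on such
messages. -/
theorem successProb_map_singleton {k n : ℕ} (W : Fin n → Channel k Bool)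
    (est : (Fin n → Bool) → PMF (Fin k)) (α : ℝ) (p : PMF (Fin k)) :
    successProb (fun i x => (W i x).map fun b => [b])
      (fun y => est fun i => (y i).headD false) α p = successProb W est α p := by
  have hf : Measurable fun b : Bool => [b] := measurable_of_finite _
  have h1 : ∀ i, (p.bind fun x => (W i x).map fun b => [b]).toMeasure =
      (p.bind (W i)).toMeasure.map fun b => [b] := by
    intro i
    rw [← PMF.map_bind, PMF.toMeasure_map _ _ hf]
  have : ∀ i, IsProbabilityMeasure ((p.bind (W i)).toMeasure.map fun b => [b]) := fun i =>
    Measure.isProbabilityMeasure_map hf.aemeasurable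
  simp only [successProb, h1]
  rw [← Measure.pi_map_pi fun i => hf.aemeasurable, Measure.map_apply (measurable_of_finite _)
    (Set.to_countable _).measurableSet]
  rfl

theorem privateCoinAchievable_of_hrChannel {k s n : ℕ} {ε α : ℝ} (hε : 0 < ε) (col : Fin n → ℕ)
    (est : (Fin n → Bool) → PMF (Fin k))
    (h : ∀ p : PMF (Fin k), IsSparse s p →
      (9 / 10 : ℝ≥0∞) ≤ successProb (fun i => hrChannel k ε (col i)) est α p) :
    PrivateCoinAchievable k s ε α n :=
  ⟨fun i x => (hrChannel k ε (col i) x).map fun b => [b], fun y => est fun i => (y i).headD false,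
    fun i => (isLDP_hrChannel hε (col i)).map _,
    fun p hp => by rw [successProb_map_singleton]; exact h p hp⟩

theorem upper_bound {E : ℝ} (hE : 0 < E) : ∃ C : ℝ, 0 < C ∧ ∀ (k s : ℕ) (ε α : ℝ),
    1 ≤ s → s ≤ k → 0 < ε → ε ≤ E → 0 < α → α < 1 →
      (sampleComplexity k s ε α : ℝ≥0∞) ≤ ENNReal.ofReal (C * rate k s ε α) := by
  obtain ⟨C, hC, h⟩ := hadamard_response_protocol hE
  -- The number of users is rounded up; the extra 1 is absorbed because `E ^ 2 * rate k s ε α ≥ 1`.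
  refine ⟨C + E ^ 2, by positivity, ?_⟩
  intro k s ε α hs hsk hε hεE hα hα1
  have hrate := rate_pos (k := k) hs hε hα
  obtain ⟨hn1, col, hcol, -, hest⟩ := h k s ⌈C * rate k s ε α⌉₊ ε α hs hsk hε hεE hα hα1
    (Nat.le_ceil _)
  have hk : 1 ≤ k := hs.trans hsk
  obtain ⟨hB, hnB⟩ := word_bounds hk hn1
  obtain ⟨est, hproj, -⟩ := exists_serverComputes hs hsk hε hB hnB hn1 col hcol
  have hach := privateCoinAchievable_of_hrChannel hε col est (hest est hproj)
  have h1 : sampleComplexity k s ε α ≤ (⌈C * rate k s ε α⌉₊ : ℕ∞) := iInf₂_le _ hach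
  have h2 : (⌈C * rate k s ε α⌉₊ : ℝ) ≤ (C + E ^ 2) * rate k s ε α := by
    have h3 := Nat.ceil_lt_add_one (mul_pos hC hrate).le
    have h4 : 1 ≤ E ^ 2 * rate k s ε α := by
      have hs1 : (1 : ℝ) ≤ s := by exact_mod_cast hs
      rw [rate, ← mul_div_assoc, le_div_iff₀ (by positivity), one_mul]
      have h5 : α ^ 2 ≤ 1 := by nlinarith
      have h6 : ε ^ 2 ≤ E ^ 2 := by gcongr
      have h7 : (1 : ℝ) ≤ (s : ℝ) ^ 2 * max (Real.log ((k : ℝ) / s)) 1 :=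
        one_le_mul_of_one_le_of_one_le (one_le_pow₀ hs1) (le_max_right _ _)
      calc α ^ 2 * ε ^ 2 ≤ 1 * E ^ 2 := by gcongr
        _ = E ^ 2 * 1 := by ring
        _ ≤ _ := by gcongr
    linarith
  calc (sampleComplexity k s ε α : ℝ≥0∞) ≤ ((⌈C * rate k s ε α⌉₊ : ℕ∞) : ℝ≥0∞) := by
        exact_mod_cast h1
    _ = ENNReal.ofReal (⌈C * rate k s ε α⌉₊ : ℝ) := by simp
    _ ≤ _ := ENNReal.ofReal_le_ofReal h2

/-- One-bit Hadamard Response with sparse projection, run by fixed programs in nearly linear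
time. -/
theorem efficient_protocol {E : ℝ} (hE : 0 < E) : ∃ C : ℝ, 0 < C ∧
    ∀ (k s n : ℕ) (ε α : ℝ), 1 ≤ s → s ≤ k → 0 < ε → ε ≤ E → 0 < α → α < 1 →
      C * rate k s ε α ≤ n →
      ∃ (col : Fin n → ℕ) (est : (Fin n → Bool) → PMF (Fin k)),
        (∀ i, col i < hadamardDim k) ∧
        (hadamardDim k ≤ n → ∀ i, col i = (i : ℕ) % hadamardDim k) ∧
        (∀ i, IsLDP ε (hrChannel k ε (col i))) ∧
        (∀ y, IsSparseProjection s (hrEstimate k ε col y) (est y)) ∧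
        (∀ p : PMF (Fin k), IsSparse s p →
          (9 / 10 : ℝ≥0∞) ≤ successProb (fun i => hrChannel k ε (col i)) est α p) ∧
        ∃ Tu Ts : ℕ,
          (∀ i, UserSamples ((n + k + 1) ^ 3) Tu userProg k s n (col i) ε
            (hrChannel k ε (col i))) ∧
          ServerComputes ((n + k + 1) ^ 3) Ts serverProg s ε col est ∧
          (n : ℝ) * Tu + Ts ≤ 1000 * ((n : ℝ) + k) * Real.log ((n : ℝ) + k + 1) ^ 1 := by
  obtain ⟨C, hC, h⟩ := hadamard_response_protocol hE
  refine ⟨C, hC, ?_⟩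
  intro k s n ε α hs hsk hε hεE hα hα1 hn
  obtain ⟨hn1, col, hcol, hcyc, hest⟩ := h k s n ε α hs hsk hε hεE hα hα1 hn
  have hk : 1 ≤ k := hs.trans hsk
  obtain ⟨hB, hnB⟩ := word_bounds hk hn1
  obtain ⟨est, hproj, hcomp⟩ := exists_serverComputes hs hsk hε hB hnB hn1 col hcol
  have hkB := (lt_hadamardDim k).le
  refine ⟨col, est, hcol, hcyc, fun i => isLDP_hrChannel hε (col i), hproj, hest est hproj,
    hadamardLog k * 14 + 9, serverTime k s n, fun i => ?_, hcomp, running_time_le hsk hk hn1⟩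
  have hi := (hcol i).le
  exact userSamples ε (by omega) (by omega) (by omega)

end SparseLDP
end

theorem theorem1 :
    -- upper bound on the sample complexity
    (∀ E : ℝ, 0 < E → ∃ C : ℝ, 0 < C ∧ ∀ (k s : ℕ) (ε α : ℝ),
      1 ≤ s → s ≤ k → 0 < ε → ε ≤ E → 0 < α → α < 1 →
        (SparseLDP.sampleComplexity k s ε α : ℝ≥0∞)
          ≤ ENNReal.ofReal (C * SparseLDP.rate k s ε α)) ∧
    -- lower bound on the sample complexity, for private-coin and for public-coin protocols
    (∀ E α₀ : ℝ, 0 < E → 0 < α₀ → α₀ < 1 → ∃ c : ℝ, 0 < c ∧ ∀ (k s : ℕ) (ε α : ℝ),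
      2 ≤ s → 100 * s ≤ k → 0 < ε → ε ≤ E → 0 < α → α ≤ α₀ → α ≤ 1 - 2 * (s : ℝ) / k →
        ENNReal.ofReal (c * SparseLDP.rate k s ε α)
            ≤ (SparseLDP.sampleComplexityPublic k s ε α : ℝ≥0∞) ∧
        ENNReal.ofReal (c * SparseLDP.rate k s ε α)
            ≤ (SparseLDP.sampleComplexity k s ε α : ℝ≥0∞)) ∧
    -- one-bit private-coin Hadamard Response with sparse projection attains the upper bound in
    -- nearly linear time
    (∃ (user server : SparseLDP.Prog) (D A : ℕ) (Ct : ℝ), ∀ E : ℝ, 0 < E →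
      ∃ C : ℝ, 0 < C ∧ ∀ (k s n : ℕ) (ε α : ℝ),
        1 ≤ s → s ≤ k → 0 < ε → ε ≤ E → 0 < α → α < 1 →
        C * SparseLDP.rate k s ε α ≤ n →
        ∃ (col : Fin n → ℕ) (est : (Fin n → Bool) → PMF (Fin k)),
          (∀ i, col i < SparseLDP.hadamardDim k) ∧
          (SparseLDP.hadamardDim k ≤ n →
            ∀ i, col i = (i : ℕ) % SparseLDP.hadamardDim k) ∧
          (∀ i, SparseLDP.IsLDP ε (SparseLDP.hrChannel k ε (col i))) ∧
          (∀ y, SparseLDP.IsSparseProjection s (SparseLDP.hrEstimate k ε col y) (est y)) ∧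
          (∀ p : PMF (Fin k), SparseLDP.IsSparse s p →
            (9 / 10 : ℝ≥0∞) ≤
              SparseLDP.successProb (fun i => SparseLDP.hrChannel k ε (col i)) est α p) ∧
          ∃ Tu Ts : ℕ,
            (∀ i, SparseLDP.UserSamples ((n + k + 1) ^ D) Tu user k s n (col i) ε
              (SparseLDP.hrChannel k ε (col i))) ∧
            SparseLDP.ServerComputes ((n + k + 1) ^ D) Ts server s ε col est ∧
            (n : ℝ) * Tu + Ts ≤ Ct * ((n : ℝ) + k) * Real.log ((n : ℝ) + k + 1) ^ A) :=
  ⟨fun _ hE => SparseLDP.upper_bound hE,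
    fun _ _ _ h0 h1 => SparseLDP.lower_bound h1 h0,
    SparseLDP.userProg, SparseLDP.serverProg, 3, 1, 1000,
    fun _ hE => SparseLDP.efficient_protocol hE⟩
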